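/- **Classification of self-adjoint endomorphisms of $\mathbf R^{2,2}$.** *Conventions.* $\mathbf R^{p,q}$ is $\mathbf R^{p+q}$ with the scalar product for which the standard basis is pseudo-orthonormal ($\Psi$-ON) of signature $(p,q)$: $s(e_i,e_i)=1$ for $i\le p$, $s(e_i,e_i)=-1$ for $i>p$, $s(e_i,e_j)=0$ for $i\ne j$. Write $s=s_{2,2}$. A Witt basis $E_1,\dots,E_{2k}$ is a basis whose only nonzero scalar products are $s(E_i,E_{k+i})=s(E_{k+i},E_i)=1$. The matrix $A$ of $S$ in a basis $(v_j)$ is defined by $S v_j=\sum_i A_{ij}v_i$. $J_n(\lambda)$ is the $n\times n$ Jordan block with $1$'s on the superdiagonal; $K_1(a,b)=\begin{pmatrix}a&b\\-b&a\end{pmatrix}$, $K_2(a,b)=\begin{pmatrix}K_1(a,b)&1_2\\0&K_1(a,b)\end{pmatrix}$. $S_{\mathbf C}$ is the complexification of $S$; $s_{\mathbf C}$ and $h$ are the complex bilinear and the Hermitian extension of $s$ to $\mathbf C^4$; $\mathbf C^2_{\rm E}$ is $\mathbf C^2$ with the bilinear form $x_1y_1+x_2y_2$. Throughout, $\epsilon,\omega\in\{1,-1\}$,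 and Greek letters $\lambda,\mu,\nu,\sigma$ and $a,b,c,d$ as block parameters are real unless said otherwise. $S$ is self-adjoint if $s(Sx,y)=s(x,Sy)$ for all $x,y$. *Part A (decomposition).* Every self-adjoint $S$ has an orthogonal direct sum decomposition $\mathbf R^{2,2}=U_1\perp\dots\perp U_k$, $1\le k\le4$, into $S$-invariant subspaces $U$, each of one of these kinds: (i) $U=\langle v\rangle$, $s(v,v)=\pm1$, $S|_U=\lambda 1$. (ii) $\dim U=2$, $U\cong\mathbf R^{1,1}$, and either (1) $U$ has a basis $v_1,v_2$ whose only nonzero scalar products are $s(v_1,v_2)=s(v_2,v_1)=\epsilon$ and in which $S|_U$ is $J_2(\lambda)$, or (2) $U$ has a $\Psi$-ON basis $u,v$ of signature $(1,1)$ in which $S|_U$ is $K_1(a,b)$, $b\neq0$. (iii) $\dim U=3$ and $U$ has a basis $v_1,v_2,v_3$ whose only nonzero scalar products are $s(v_1,v_3)=s(v_3,v_1)=s(v_2,v_2)=\epsilon$ and in which $S|_U$ is $J_3(\lambda)$, with $U\cong\mathbf R^{1,2}$ if $\epsilon=-1$ and $U\cong\mathbf R^{2,1}$ if $\epsilon=1$.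 (iv) $U=\mathbf R^{2,2}$, and either (1) there is a basis $v_1,\dots,v_4$ whose only nonzero scalar products are $s(v_i,v_{5-i})=\epsilon$ and in which $S$ is $J_4(\lambda)$, or (2) there is a basis $u_1,v_1,u_2,v_2$ whose only nonzero scalar products are $s(u_1,u_2)=s(u_2,u_1)=1$, $s(v_1,v_2)=s(v_2,v_1)=-1$ and in which $S$ is $K_2(a,b)$, $b\ne0$. The following are equivalent descriptions, for given $S$, $U$ and vectors. In (ii)(1): $\{v_1,\epsilon v_2\}$ is a Witt basis of $U$ in which $S|_U$ is $\begin{pmatrix}\lambda&\epsilon\\0&\lambda\end{pmatrix}$; or, $\{\frac{v_1+\epsilon v_2}{\sqrt2},\frac{v_1-\epsilon v_2}{\sqrt2}\}$ is a $\Psi$-ON basis of $U$ in which it is $\begin{pmatrix}\lambda+\frac\epsilon2&-\frac\epsilon2\\\frac\epsilon2&\lambda-\frac\epsilon2\end{pmatrix}$. In (iii), with $x=\frac{v_1+\epsilon v_3}{\sqrt2}$, $y=\frac{v_1-\epsilon v_3}{\sqrt2}$: $\{x,v_2,y\}$ is a $\Psi$-ON basis of $U$, of signature $(1,2)$ for $\epsilon=-1$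 and $(2,1)$ for $\epsilon=1$, in which $S|_U$ is, respectively, $$\begin{pmatrix}\lambda&\frac1{\sqrt2}&0\\-\frac1{\sqrt2}&\lambda&\frac1{\sqrt2}\\0&\frac1{\sqrt2}&\lambda\end{pmatrix},\qquad \begin{pmatrix}\lambda&\frac1{\sqrt2}&0\\\frac1{\sqrt2}&\lambda&-\frac1{\sqrt2}\\0&\frac1{\sqrt2}&\lambda\end{pmatrix}.$$ In (ii)(2), for a $\Psi$-ON basis $u,v$ of $U$ and $w=u+iv$, $\lambda=a+ib$: $w,\bar w$ is a basis of $\mathbf CU$, and $S|_U$ is $K_1(a,b)$ in $u,v$ if and only if $S_{\mathbf C}$ is $\mathrm{diag}(\lambda,\bar\lambda)$ in $w,\bar w$; moreover $h(w,w)=h(\bar w,\bar w)=0\neq h(w,\bar w)$, while $s_{\mathbf C}(w,w)\ne0\ne s_{\mathbf C}(\bar w,\bar w)$ and $s_{\mathbf C}(w,\bar w)=0$. *Part B (the ten types).* Consider the following orthogonal invariant decompositions, where $(\mathbf R^{p,q},B)$ stands for a summand isometric to $\mathbf R^{p,q}$ with a basis as in (i)–(iv) in which $S$ is $B$ (and $J_n$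 carries the sign $\epsilon$ written as superscript): I: $(\mathbf R^{2,2},J_4^\epsilon(\lambda))$; II: $(\mathbf R^{2,2},K_2(a,b))$; IIIa: $(\mathbf R^{1,0},J_1(\lambda))\perp(\mathbf R^{1,2},J_3^{-}(\mu))$; IIIb: $(\mathbf R^{2,1},J_3^{+}(\lambda))\perp(\mathbf R^{0,1},J_1(\mu))$; IV: $(\mathbf R^{1,0},J_1(\lambda))\perp(\mathbf R^{1,1},J_2^\epsilon(\mu))\perp(\mathbf R^{0,1},J_1(\nu))$; V: $(\mathbf R^{1,0},J_1(\lambda))\perp(\mathbf R^{1,1},K_1(a,b))\perp(\mathbf R^{0,1},J_1(\nu))$; VI: $(\mathbf R^{1,1},J_2^\epsilon(\lambda))\perp(\mathbf R^{1,1},K_1(a,b))$; VII: $(\mathbf R^{1,1},J_2^\epsilon(\lambda))\perp(\mathbf R^{1,1},J_2^\omega(\mu))$; VIII: $(\mathbf R^{1,1},K_1(a,b))\perp(\mathbf R^{1,1},K_1(c,d))$; IX: $(\mathbf R^{1,0},J_1(\lambda))\perp(\mathbf R^{1,0},J_1(\mu))\perp(\mathbf R^{0,1},J_1(\nu))\perp(\mathbf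 R^{0,1},J_1(\sigma))$. $S$ is of a given type if it has such a decomposition for some values of the parameters, with $b\ne0$ in II, V, VI and $b\neq0\neq d$ in VIII. Then every self-adjoint endomorphism of $\mathbf R^{2,2}$ is of exactly one of the ten types. Conversely, every endomorphism with a decomposition of one of these forms is self-adjoint, and each form occurs for all values of its parameters. *Part C (normal matrices).* List the bases of the summands one after the other as $v_1,\dots,v_4$ (in type II, $u_1,v_1,u_2,v_2$). This basis gives $S$ its realized Jordan canonical form. $S$ has the given scalar products and the given form in it if and only if the following $\Psi$-ON basis of signature $(2,2)$ is one, and $S$ has the following matrix in it; and $S$ has a decomposition of the given form if and only if it has this matrix in some $\Psi$-ON basis of signature $(2,2)$. I, basis $\frac{v_1+\epsilon v_4}{\sqrt2},\frac{v_2+\epsilon v_3}{\sqrt2},\frac{v_1-\epsilon v_4}{\sqrt2},\frac{v_2-\epsilon v_3}{\sqrt2}$: $\begin{pmatrix}\lambda&\frac12&0&\frac12\\\frac12&\lambda+\frac\epsilon2&-\frac12&-\frac\epsilon2\\0&\frac12&\lambda&\frac12\\-\frac12&\frac\epsilon2&\frac12&\lambda-\frac\epsilon2\end{pmatrix}$.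 II, basis $\frac{u_1+u_2}{\sqrt2},\frac{v_1-v_2}{\sqrt2},\frac{u_1-u_2}{\sqrt2},\frac{v_1+v_2}{\sqrt2}$: $\begin{pmatrix}a+\frac12&0&-\frac12&b\\0&a-\frac12&-b&\frac12\\\frac12&b&a-\frac12&0\\-b&-\frac12&0&a+\frac12\end{pmatrix}$. IIIa, basis $v_1,\frac{v_2-v_4}{\sqrt2},v_3,\frac{v_2+v_4}{\sqrt2}$: $\begin{pmatrix}\lambda&0&0&0\\0&\mu&\frac1{\sqrt2}&0\\0&-\frac1{\sqrt2}&\mu&\frac1{\sqrt2}\\0&0&\frac1{\sqrt2}&\mu\end{pmatrix}$. IIIb, basis $\frac{v_1+v_3}{\sqrt2},v_2,\frac{v_1-v_3}{\sqrt2},v_4$: $\begin{pmatrix}\lambda&\frac1{\sqrt2}&0&0\\\frac1{\sqrt2}&\lambda&-\frac1{\sqrt2}&0\\0&\frac1{\sqrt2}&\lambda&0\\0&0&0&\mu\end{pmatrix}$. IV, basis $v_1,\frac{v_2+\epsilon v_3}{\sqrt2},\frac{v_2-\epsilon v_3}{\sqrt2},v_4$: $\begin{pmatrix}\lambda&0&0&0\\0&\mu+\frac\epsilon2&-\frac\epsilon2&0\\0&\frac\epsilon2&\mu-\frac\epsilon2&0\\0&0&0&\nu\end{pmatrix}$.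 V, basis $v_1,v_2,v_3,v_4$: $\begin{pmatrix}\lambda&0&0&0\\0&a&b&0\\0&-b&a&0\\0&0&0&\nu\end{pmatrix}$. VI, basis $\frac{v_1+\epsilon v_2}{\sqrt2},v_3,v_4,\frac{v_1-\epsilon v_2}{\sqrt2}$: $\begin{pmatrix}\lambda+\frac\epsilon2&0&0&-\frac\epsilon2\\0&a&b&0\\0&-b&a&0\\\frac\epsilon2&0&0&\lambda-\frac\epsilon2\end{pmatrix}$. VII, basis $\frac{v_1+\epsilon v_2}{\sqrt2},\frac{v_3+\omega v_4}{\sqrt2},\frac{v_1-\epsilon v_2}{\sqrt2},\frac{v_3-\omega v_4}{\sqrt2}$: $\begin{pmatrix}\lambda+\frac\epsilon2&0&-\frac\epsilon2&0\\0&\mu+\frac\omega2&0&-\frac\omega2\\\frac\epsilon2&0&\lambda-\frac\epsilon2&0\\0&\frac\omega2&0&\mu-\frac\omega2\end{pmatrix}$. VIII, basis $v_1,v_3,v_2,v_4$: $\begin{pmatrix}a&0&b&0\\0&c&0&d\\-b&0&a&0\\0&-d&0&c\end{pmatrix}$. IX, basis $v_1,v_2,v_3,v_4$: $\mathrm{diag}(\lambda,\mu,\nu,\sigma)$.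 The same two equivalences hold for types I, II and VII with Witt bases in place of $\Psi$-ON bases: the basis $v_1,v_2,\epsilon v_4,\epsilon v_3$ for I, $u_1,v_1,u_2,-v_2$ for II, $v_1,v_3,\epsilon v_2,\omega v_4$ for VII, with the respective matrices $$\begin{pmatrix}\lambda&1&0&0\\0&\lambda&0&\epsilon\\0&0&\lambda&0\\0&0&1&\lambda\end{pmatrix},\quad\begin{pmatrix}a&b&1&0\\-b&a&0&-1\\0&0&a&-b\\0&0&b&a\end{pmatrix},\quad\begin{pmatrix}\lambda&0&\epsilon&0\\0&\mu&0&\omega\\0&0&\lambda&0\\0&0&0&\mu\end{pmatrix}.$$ In type II put $w_j=u_j+iv_j$, $\lambda=a+ib$, $W=\langle w_1,w_2\rangle_{\mathbf C}$. Then $w_1,w_2,\bar w_1,\bar w_2$ is a basis of $\mathbf C^4$ in which $S_{\mathbf C}$ is $J_2(\lambda)\oplus J_2(\bar\lambda)$; each of these vectors is null for $s_{\mathbf C}$ and for $h$; $\mathbf C^4=W\oplus\overline W$ is orthogonal for $s_{\mathbf C}$, with $W\cong\overline W\cong\mathbf C^2_{\rm E}$, and $W$ and $\overline W$ are totally null for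 $h$. *Part D (Jordan form, multiplicities, Segre characteristics).* If $S$ has type as in Part B, then $S_{\mathbf C}$ has as Jordan canonical form the direct sum of the blocks of the decomposition, each $K_m(a,b)$ contributing $J_m(a+ib)\oplus J_m(a-ib)$. For each $z\in\mathbf C$ the algebraic multiplicity of $z$ for $S_{\mathbf C}$ is the sum of the sizes of the blocks belonging to $z$ and the geometric multiplicity is their number, and for real $z$ the same holds for $S$. The Segre characteristic lists the sizes of the blocks in the order of the decomposition ($\bar m$ marks the conjugate of the preceding block), round brackets grouping the blocks that belong to one eigenvalue; blocks between vertical lines are not included in the group formed around them. When only the stated coincidences hold among the eigenvalues it is as follows. I: $[4]$. II: $[2\bar2]$. IIIa, with the blocks listed in the order $J_1,J_3$: $[13]$; $\lambda=\mu$: $[(13)]$. IIIb: the same, with the blocks listed in the order $J_1,J_3$ (in the order $J_3,J_1$ it is written $[31]$, $[(31)]$). IV: $[121]$; $\lambda=\mu$: $[(12)1]$; $\mu=\nu$: $[1(21)]$; $\lambda=\nu$: $[(1|2|1)]$; $\lambda=\mu=\nu$: $[(121)]$. V: $[11\bar11]$; the only coincidence within the type is $\lambda=\nu$: $[(1|1\bar1|1)]$.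 VI: $[21\bar1]$, with no coincidences. VII: $[22]$; $\lambda=\mu$: $[(22)]$. VIII: $[1\bar11\bar1]$; for $a+ib=c+id$: $[(1\bar11\bar1)]$ (the two eigenvalues $a\pm ib$ each have two blocks). The parameter $d$ may always be replaced by $-d$, so that the coincidence $a+ib=c-id$ is only a relabelling. IX: $[1111]$; $\lambda=\mu$: $[(11)11]$; $\lambda=\nu$: $[(1|1|1)1]$; $\lambda=\sigma$: $[(1|11|1)]$; $\mu=\nu$: $[1(11)1]$; $\mu=\sigma$: $[1(1|1|1)]$; $\nu=\sigma$: $[11(11)]$; $\lambda=\mu$, $\nu=\sigma$: $[(11)(11)]$; $\lambda=\nu$, $\mu=\sigma$: $[(1|(1|1)|1)]$, i.e. the first and third, and the second and fourth entries are grouped; $\lambda=\sigma$, $\mu=\nu$: $[(1|(11)|1)]$; $\lambda=\mu=\nu$: $[(111)1]$; $\lambda=\mu=\sigma$: $[(11|1|1)]$; $\lambda=\nu=\sigma$: $[(1|1|11)]$; $\mu=\nu=\sigma$: $[1(111)]$; $\lambda=\mu=\nu=\sigma$: $[(1111)]$. *Part E (degenerations).* Let complex conjugate eigenvalues coincide in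 the matrices of Part C. (1) If $S$ has the Witt matrix of type II with $b=0$, then in the same basis it has the Witt matrix of type VII with $\epsilon=1$, $\omega=-1$, $\lambda=\mu=a$; it is of type VII with $[(22)]$. (2) If $S$ has the $\Psi$-ON matrix of type V with $b=0$, then in the same basis it has that of type IX with parameters $(\lambda,a,a,\nu)$; it is of type IX, with $[1(11)1]$ if $\lambda,a,\nu$ are distinct. (3) If $S$ has the $\Psi$-ON matrix of type VI with $b=0$ in $E_1,\dots,E_4$, then in the $\Psi$-ON basis $E_2,E_1,E_4,E_3$ it has that of type IV with the same $\epsilon$ and eigenvalue parameters $(a,\lambda,a)$; it is of type IV, with $[(1|2|1)]$ if $a\ne\lambda$. (4) If $S$ has the $\Psi$-ON matrix of type VIII in $E_1,\dots,E_4$ with $b=0\neq d$ (respectively $d=0\ne b$), then in the $\Psi$-ON basis $E_1,E_2,E_4,E_3$ (respectively $E_2,E_1,E_3,E_4$) it has that of type V with $(\lambda,a,b,\nu)$ replaced by $(a,c,d,a)$ (respectively $(c,a,b,c)$); it is of type V with $[(1|1\bar1|1)]$, i.e. with two equal real eigenvalues and a complex conjugate pair. (5) If $b=d=0$ in (4),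 then in the same basis $S$ has the matrix $\mathrm{diag}(a,c,a,c)$ of type IX; it is of type IX and, if $a\neq c$, its first and third and its second and fourth eigenvalues coincide in pairs, $[(1|(1|1)|1)]$. -/

import Mathlib

namespace Neutral22

/-! ### The scalar product spaces -/

/-- Gram matrix of a pseudo-orthonormal basis of signature `(p, q)`. -/
def psiGram (p q : ℕ) : Matrix (Fin (p + q)) (Fin (p + q)) ℝ :=
  Matrix.diagonal fun i => if i.val < p then 1 else -1

/-- Gram matrix of a Witt basis `E₁, …, E₂ₖ`: the only nonzero scalar products are
`s(Eᵢ, Eₖ₊ᵢ) = s(Eₖ₊ᵢ, Eᵢ) = 1`. -/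
def wittGram (k : ℕ) : Matrix (Fin (k + k)) (Fin (k + k)) ℝ :=
  Matrix.of fun i j => if i.val + k = j.val ∨ j.val + k = i.val then 1 else 0

/-- The scalar product of `ℝ^{p,q}`. -/
noncomputable def pqForm (p q : ℕ) : LinearMap.BilinForm ℝ (Fin (p + q) → ℝ) :=
  Matrix.toBilin' (psiGram p q)

/-- The underlying vector space of `ℝ^{2,2}`. -/
abbrev R22 : Type := Fin 4 → ℝ

/-- The underlying vector space of the complexification `ℂ^{2,2}` of `ℝ^{2,2}`. -/
abbrev C22 : Type := Fin 4 → ℂ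

/-- The scalar product of `ℝ^{2,2}`. -/
noncomputable def s22 : LinearMap.BilinForm ℝ R22 := pqForm 2 2

/-- The complex bilinear extension of `s22`, the scalar product of `ℂ^{2,2}`. -/
noncomputable def sC : LinearMap.BilinForm ℂ C22 :=
  Matrix.toBilin' ((psiGram 2 2).map (algebraMap ℝ ℂ))

/-- The Hermitian extension of `s22`, conjugate-linear in the first argument. -/
noncomputable def hC (x y : C22) : ℂ := sC (star x) y

/-- The inclusion of `ℝ⁴` in `ℂ⁴`. -/
def cvec (v : R22) : C22 := fun i => (v i : ℂ)

/-- `u + i v`. -/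
noncomputable def cpair (u v : R22) : C22 := cvec u + Complex.I • cvec v

/-- The complexification of an endomorphism of `ℝ⁴`. -/
noncomputable def cplxEnd (S : Module.End ℝ R22) : Module.End ℂ C22 :=
  Matrix.toLin' ((LinearMap.toMatrix' S).map (algebraMap ℝ ℂ))

/-- The complexification of a subspace of `ℝ⁴`. -/
def cplxSub (U : Submodule ℝ R22) : Submodule ℂ C22 :=
  Submodule.span ℂ (cvec '' (U : Set R22))

/-- The subspace `U` of `ℝ^{2,2}` is isometric to `ℝ^{p,q}`. -/
def IsIsometricTo (U : Submodule ℝ R22) (p q : ℕ) : Prop :=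
  ∃ e : U ≃ₗ[ℝ] (Fin (p + q) → ℝ), ∀ x y : U, pqForm p q (e x) (e y) = s22 x y

/-! ### Bases and matrix representations -/

/-- `v` is a basis of the subspace `U` of `ℝ^{2,2}` whose Gram matrix is `G`. -/
structure IsFrame {n : ℕ} (U : Submodule ℝ R22) (v : Fin n → R22)
    (G : Matrix (Fin n) (Fin n) ℝ) : Prop where
  indep : LinearIndependent ℝ v
  span_eq : Submodule.span ℝ (Set.range v) = U
  gram : ∀ i j, s22 (v i) (v j) = G i j

/-- `v` is a pseudo-orthonormal basis of `U`, of signature `(p, q)`. -/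
def IsPsiON (p q : ℕ) (U : Submodule ℝ R22) (v : Fin (p + q) → R22) : Prop :=
  IsFrame U v (psiGram p q)

/-- `v` is a Witt basis of the `2k`-dimensional subspace `U`. -/
def IsWitt (k : ℕ) (U : Submodule ℝ R22) (v : Fin (k + k) → R22) : Prop :=
  IsFrame U v (wittGram k)

/-- `T vⱼ = ∑ᵢ Aᵢⱼ vᵢ` for all `j`. When `v` is a basis of a subspace, this says that the subspace
is `T`-invariant and that `A` represents the restriction of `T` to it with respect to `v`. -/
def HasMatrix {K M : Type*} [Field K] [AddCommGroup M] [Module K M] {n : ℕ}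
    (T : Module.End K M) (v : Fin n → M) (A : Matrix (Fin n) (Fin n) K) : Prop :=
  ∀ j, T (v j) = ∑ i, A i j • v i

/-- A sign `±1` as a real number. -/
def sg (e : ℤˣ) : ℝ := ((e : ℤ) : ℝ)

/-- `(x + y) / √2`. -/
noncomputable def hadd (x y : R22) : R22 := (Real.sqrt 2)⁻¹ • (x + y)

/-- `(x - y) / √2`. -/
noncomputable def hsub (x y : R22) : R22 := (Real.sqrt 2)⁻¹ • (x - y)

/-! ### Jordan blocks -/

/-- The Jordan block `Jₙ(c)`, with 1's on the superdiagonal. -/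
def jordanBlock {K : Type*} [Field K] (n : ℕ) (c : K) : Matrix (Fin n) (Fin n) K :=
  Matrix.of fun i j => if i = j then c else if i.val + 1 = j.val then 1 else 0

/-- The `2m × 2m` real Jordan block `Kₘ(a, b)`: the 2 × 2 blocks `(a, b; -b, a)` on the
diagonal and 2 × 2 identity blocks on the block superdiagonal. -/
def realJordanBlock (m : ℕ) (a b : ℝ) : Matrix (Fin (2 * m)) (Fin (2 * m)) ℝ :=
  Matrix.of fun i j =>
    if i.val / 2 = j.val / 2 then
      (if i = j then a else if i.val < j.val then b else -b)
    else if i.val + 2 = j.val then 1 else 0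

/-- `s(vᵢ, vⱼ) = ε` if `i + j = n + 1` (indices counted from 1), and zero otherwise. -/
def antiGram (n : ℕ) (e : ℤˣ) : Matrix (Fin n) (Fin n) ℝ :=
  Matrix.of fun i j => if i.val + j.val + 1 = n then sg e else 0

/-- Gram matrix of a basis `u₁, v₁, …, uₘ, vₘ` with `s(uᵢ, uⱼ) = 1 = -s(vᵢ, vⱼ)` if
`i + j = m + 1` (indices counted from 1), all other scalar products being zero. -/
def pairGram (m : ℕ) : Matrix (Fin (2 * m)) (Fin (2 * m)) ℝ :=
  Matrix.of fun i j =>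
    if i.val / 2 + j.val / 2 + 1 = m ∧ i.val % 2 = j.val % 2 then
      (if i.val % 2 = 0 then 1 else -1)
    else 0

/-- The model summands: `real n ε c` is an `n`-dimensional summand with Jordan block `Jₙ(c)` and
antidiagonal Gram matrix `ε`; `cplx m a b` is a `2m`-dimensional summand with block `Kₘ(a, b)`. -/
inductive Summand : Type
  | real (n : ℕ) (e : ℤˣ) (c : ℝ)
  | cplx (m : ℕ) (a b : ℝ)

/-- Dimension of a model summand. -/
def Summand.dim : Summand → ℕ
  | .real n _ _ => n
  | .cplx m _ _ => 2 * m

/-- Gram matrix of a model summand. -/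
def Summand.gram : (s : Summand) → Matrix (Fin s.dim) (Fin s.dim) ℝ
  | .real n e _ => antiGram n e
  | .cplx m _ _ => pairGram m

/-- Matrix of the endomorphism on a model summand. -/
noncomputable def Summand.mat : (s : Summand) → Matrix (Fin s.dim) (Fin s.dim) ℝ
  | .real n _ c => jordanBlock n c
  | .cplx m a b => realJordanBlock m a b

/-- Signature `(p, q)` of a model summand. -/
def Summand.sig : Summand → ℕ × ℕ
  | .real n e _ => if e = 1 then ((n + 1) / 2, n / 2) else (n / 2, (n + 1) / 2)
  | .cplx m _ _ => (m, m)

/-- `v` is a basis of `U` with respect to which the scalar product and `S` have the matrices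
prescribed by the model summand `s`. -/
def Fits (S : Module.End ℝ R22) (U : Submodule ℝ R22) (s : Summand) (v : Fin s.dim → R22) : Prop :=
  IsFrame U v s.gram ∧ HasMatrix S v s.mat

/-! ### Orthogonal invariant decompositions -/

/-- `ℝ^{2,2}` is the orthogonal direct sum of the `S`-invariant subspaces `Uᵢ`. -/
structure IsOrthInvDecomp {k : ℕ} (S : Module.End ℝ R22) (U : Fin k → Submodule ℝ R22) : Prop where
  internal : DirectSum.IsInternal U
  orth : ∀ i j, i ≠ j → ∀ x ∈ U i, ∀ y ∈ U j, s22 x y = 0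
  inv : ∀ i, ∀ x ∈ U i, S x ∈ U i

/-- The four kinds of summands, by dimension. -/
def IsListedSummand (S : Module.End ℝ R22) (U : Submodule ℝ R22) : Prop :=
  -- dimension one
  (∃ (v : R22) (c : ℝ), U = Submodule.span ℝ {v} ∧ (s22 v v = 1 ∨ s22 v v = -1) ∧
    ∀ u ∈ U, S u = c • u) ∨
  -- dimension two
  (Module.finrank ℝ U = 2 ∧ IsIsometricTo U 1 1 ∧
    ((∃ (e : ℤˣ) (c : ℝ) (v : Fin 2 → R22), Fits S U (.real 2 e c) v) ∨
      (∃ (a b : ℝ) (v : Fin 2 → R22), b ≠ 0 ∧ Fits S U (.cplx 1 a b) v))) ∨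
  -- dimension three
  (Module.finrank ℝ U = 3 ∧
    ((IsIsometricTo U 1 2 ∧ ∃ (c : ℝ) (v : Fin 3 → R22), Fits S U (.real 3 (-1) c) v) ∨
      (IsIsometricTo U 2 1 ∧ ∃ (c : ℝ) (v : Fin 3 → R22), Fits S U (.real 3 1 c) v))) ∨
  -- dimension four
  (U = ⊤ ∧
    ((∃ (e : ℤˣ) (c : ℝ) (v : Fin 4 → R22), Fits S U (.real 4 e c) v) ∨
      (∃ (a b : ℝ) (v : Fin 4 → R22), b ≠ 0 ∧ Fits S U (.cplx 2 a b) v)))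

/-- `S` has an orthogonal invariant decomposition into summands modelled on the members of `L`. -/
def Decomposes (S : Module.End ℝ R22) (L : List Summand) : Prop :=
  ∃ U : Fin L.length → Submodule ℝ R22, IsOrthInvDecomp S U ∧
    ∀ i, ∃ v : Fin (L.get i).dim → R22, Fits S (U i) (L.get i) v

/-! ### The ten types -/

/-- The names of the ten types. -/
inductive SAType : Type
  | I | II | IIIa | IIIb | IV | V | VI | VII | VIII | IX

/-- A type together with values of its parameters. -/
inductive NForm : Type
  | I (e : ℤˣ) (lam : ℝ)
  | II (a b : ℝ)
  | IIIa (lam mu : ℝ)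
  | IIIb (lam mu : ℝ)
  | IV (e : ℤˣ) (lam mu nu : ℝ)
  | V (lam a b nu : ℝ)
  | VI (e : ℤˣ) (lam a b : ℝ)
  | VII (e w : ℤˣ) (lam mu : ℝ)
  | VIII (a b c d : ℝ)
  | IX (lam mu nu sigma : ℝ)

namespace NForm

/-- The type of a normal form. -/
def type : NForm → SAType
  | I .. => .I
  | II .. => .II
  | IIIa .. => .IIIa
  | IIIb .. => .IIIb
  | IV .. => .IV
  | V .. => .V
  | VI .. => .VI
  | VII .. => .VII
  | VIII .. => .VIII
  | IX .. => .IX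

/-- The blocks `Kₘ(a, b)` belong to genuinely complex (nonreal) eigenvalues. -/
def Admissible : NForm → Prop
  | II _ b => b ≠ 0
  | V _ _ b _ => b ≠ 0
  | VI _ _ _ b => b ≠ 0
  | VIII _ b _ d => b ≠ 0 ∧ d ≠ 0
  | _ => True

/-- The summands of each type. -/
def summands : NForm → List Summand
  | I e lam => [.real 4 e lam]
  | II a b => [.cplx 2 a b]
  | IIIa lam mu => [.real 1 1 lam, .real 3 (-1) mu]
  | IIIb lam mu => [.real 3 1 lam, .real 1 (-1) mu]
  | IV e lam mu nu => [.real 1 1 lam, .real 2 e mu, .real 1 (-1) nu]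
  | V lam a b nu => [.real 1 1 lam, .cplx 1 a b, .real 1 (-1) nu]
  | VI e lam a b => [.real 2 e lam, .cplx 1 a b]
  | VII e w lam mu => [.real 2 e lam, .real 2 w mu]
  | VIII a b c d => [.cplx 1 a b, .cplx 1 c d]
  | IX lam mu nu sigma => [.real 1 1 lam, .real 1 1 mu, .real 1 (-1) nu, .real 1 (-1) sigma]

/-- Gram matrix of the basis `v₁, v₂, v₃, v₄` (for type II: `u₁, v₁, u₂, v₂`) of `ℝ^{2,2}`
obtained by listing the bases of the summands one after the other. -/
def baseGram : NForm → Matrix (Fin 4) (Fin 4) ℝ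
  | I e _ => !![0, 0, 0, sg e; 0, 0, sg e, 0; 0, sg e, 0, 0; sg e, 0, 0, 0]
  | II _ _ => !![0, 0, 1, 0; 0, 0, 0, -1; 1, 0, 0, 0; 0, -1, 0, 0]
  | IIIa _ _ => !![1, 0, 0, 0; 0, 0, 0, -1; 0, 0, -1, 0; 0, -1, 0, 0]
  | IIIb _ _ => !![0, 0, 1, 0; 0, 1, 0, 0; 1, 0, 0, 0; 0, 0, 0, -1]
  | IV e _ _ _ => !![1, 0, 0, 0; 0, 0, sg e, 0; 0, sg e, 0, 0; 0, 0, 0, -1]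
  | V _ _ _ _ => !![1, 0, 0, 0; 0, 1, 0, 0; 0, 0, -1, 0; 0, 0, 0, -1]
  | VI e _ _ _ => !![0, sg e, 0, 0; sg e, 0, 0, 0; 0, 0, 1, 0; 0, 0, 0, -1]
  | VII e w _ _ => !![0, sg e, 0, 0; sg e, 0, 0, 0; 0, 0, 0, sg w; 0, 0, sg w, 0]
  | VIII _ _ _ _ => !![1, 0, 0, 0; 0, -1, 0, 0; 0, 0, 1, 0; 0, 0, 0, -1]
  | IX _ _ _ _ => !![1, 0, 0, 0; 0, 1, 0, 0; 0, 0, -1, 0; 0, 0, 0, -1]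

/-- The realized Jordan canonical form, with respect to the same basis. -/
def baseMat : NForm → Matrix (Fin 4) (Fin 4) ℝ
  | I _ lam => !![lam, 1, 0, 0; 0, lam, 1, 0; 0, 0, lam, 1; 0, 0, 0, lam]
  | II a b => !![a, b, 1, 0; -b, a, 0, 1; 0, 0, a, b; 0, 0, -b, a]
  | IIIa lam mu => !![lam, 0, 0, 0; 0, mu, 1, 0; 0, 0, mu, 1; 0, 0, 0, mu]
  | IIIb lam mu => !![lam, 1, 0, 0; 0, lam, 1, 0; 0, 0, lam, 0; 0, 0, 0, mu]
  | IV _ lam mu nu => !![lam, 0, 0, 0; 0, mu, 1, 0; 0, 0, mu, 0; 0, 0, 0, nu]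
  | V lam a b nu => !![lam, 0, 0, 0; 0, a, b, 0; 0, -b, a, 0; 0, 0, 0, nu]
  | VI _ lam a b => !![lam, 1, 0, 0; 0, lam, 0, 0; 0, 0, a, b; 0, 0, -b, a]
  | VII _ _ lam mu => !![lam, 1, 0, 0; 0, lam, 0, 0; 0, 0, mu, 1; 0, 0, 0, mu]
  | VIII a b c d => !![a, b, 0, 0; -b, a, 0, 0; 0, 0, c, d; 0, 0, -d, c]
  | IX lam mu nu sigma => !![lam, 0, 0, 0; 0, mu, 0, 0; 0, 0, nu, 0; 0, 0, 0, sigma]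

/-- The pseudo-orthonormal basis of signature `(2, 2)` built from the basis `v`. -/
noncomputable def psiBasis : NForm → (Fin 4 → R22) → (Fin 4 → R22)
  | I e _, v => ![hadd (v 0) (sg e • v 3), hadd (v 1) (sg e • v 2),
      hsub (v 0) (sg e • v 3), hsub (v 1) (sg e • v 2)]
  | II _ _, v => ![hadd (v 0) (v 2), hsub (v 1) (v 3), hsub (v 0) (v 2), hadd (v 1) (v 3)]
  | IIIa _ _, v => ![v 0, hsub (v 1) (v 3), v 2, hadd (v 1) (v 3)]
  | IIIb _ _, v => ![hadd (v 0) (v 2), v 1, hsub (v 0) (v 2), v 3]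
  | IV e _ _ _, v => ![v 0, hadd (v 1) (sg e • v 2), hsub (v 1) (sg e • v 2), v 3]
  | V _ _ _ _, v => v
  | VI e _ _ _, v => ![hadd (v 0) (sg e • v 1), v 2, v 3, hsub (v 0) (sg e • v 1)]
  | VII e w _ _, v => ![hadd (v 0) (sg e • v 1), hadd (v 2) (sg w • v 3),
      hsub (v 0) (sg e • v 1), hsub (v 2) (sg w • v 3)]
  | VIII _ _ _ _, v => ![v 0, v 2, v 1, v 3]
  | IX _ _ _ _, v => v

/-- The normal matrix of each type with respect to a pseudo-orthonormal basis. -/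
noncomputable def psiMat : NForm → Matrix (Fin 4) (Fin 4) ℝ
  | I e lam =>
      !![lam, 1 / 2, 0, 1 / 2;
         1 / 2, lam + sg e / 2, -1 / 2, -sg e / 2;
         0, 1 / 2, lam, 1 / 2;
         -1 / 2, sg e / 2, 1 / 2, lam - sg e / 2]
  | II a b =>
      !![a + 1 / 2, 0, -1 / 2, b;
         0, a - 1 / 2, -b, 1 / 2;
         1 / 2, b, a - 1 / 2, 0;
         -b, -1 / 2, 0, a + 1 / 2]
  | IIIa lam mu =>
      !![lam, 0, 0, 0;
         0, mu, 1 / Real.sqrt 2, 0;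
         0, -1 / Real.sqrt 2, mu, 1 / Real.sqrt 2;
         0, 0, 1 / Real.sqrt 2, mu]
  | IIIb lam mu =>
      !![lam, 1 / Real.sqrt 2, 0, 0;
         1 / Real.sqrt 2, lam, -1 / Real.sqrt 2, 0;
         0, 1 / Real.sqrt 2, lam, 0;
         0, 0, 0, mu]
  | IV e lam mu nu =>
      !![lam, 0, 0, 0;
         0, mu + sg e / 2, -sg e / 2, 0;
         0, sg e / 2, mu - sg e / 2, 0;
         0, 0, 0, nu]
  | V lam a b nu =>
      !![lam, 0, 0, 0;
         0, a, b, 0;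
         0, -b, a, 0;
         0, 0, 0, nu]
  | VI e lam a b =>
      !![lam + sg e / 2, 0, 0, -sg e / 2;
         0, a, b, 0;
         0, -b, a, 0;
         sg e / 2, 0, 0, lam - sg e / 2]
  | VII e w lam mu =>
      !![lam + sg e / 2, 0, -sg e / 2, 0;
         0, mu + sg w / 2, 0, -sg w / 2;
         sg e / 2, 0, lam - sg e / 2, 0;
         0, sg w / 2, 0, mu - sg w / 2]
  | VIII a b c d =>
      !![a, 0, b, 0;
         0, c, 0, d;
         -b, 0, a, 0;
         0, -d, 0, c]
  | IX lam mu nu sigma =>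
      !![lam, 0, 0, 0;
         0, mu, 0, 0;
         0, 0, nu, 0;
         0, 0, 0, sigma]

end NForm

/-- `S` has an orthogonal invariant decomposition of the form `D`. -/
def HasForm (S : Module.End ℝ R22) (D : NForm) : Prop := Decomposes S D.summands

/-- `S` is of type `t`. -/
def IsOfType (S : Module.End ℝ R22) (t : SAType) : Prop :=
  ∃ D : NForm, D.type = t ∧ D.Admissible ∧ HasForm S D

/-- `v` is a basis of `ℝ^{2,2}` in which the scalar product and `S` have the matrices of `D`. -/
def IsAdapted (S : Module.End ℝ R22) (D : NForm) (v : Fin 4 → R22) : Prop :=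
  IsFrame ⊤ v D.baseGram ∧ HasMatrix S v D.baseMat

/-- Normal matrix of type I with respect to a Witt basis. -/
def wittMatI (e : ℤˣ) (lam : ℝ) : Matrix (Fin 4) (Fin 4) ℝ :=
  !![lam, 1, 0, 0;
     0, lam, 0, sg e;
     0, 0, lam, 0;
     0, 0, 1, lam]

/-- Normal matrix of type II with respect to a Witt basis. -/
def wittMatII (a b : ℝ) : Matrix (Fin 4) (Fin 4) ℝ :=
  !![a, b, 1, 0;
     -b, a, 0, -1;
     0, 0, a, -b;
     0, 0, b, a]

/-- Normal matrix of type VII with respect to a Witt basis. -/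
def wittMatVII (e w : ℤˣ) (lam mu : ℝ) : Matrix (Fin 4) (Fin 4) ℝ :=
  !![lam, 0, sg e, 0;
     0, mu, 0, sg w;
     0, 0, lam, 0;
     0, 0, 0, mu]

/-! ### Jordan canonical form of the complexification and Segre characteristic -/

/-- A complex Jordan block. The flag `barred` marks the conjugate partner of the preceding block. -/
structure JBlock : Type where
  size : ℕ
  barred : Bool
  eig : ℂ

/-- The blocks of the complexification of a model summand. -/
noncomputable def Summand.blocks : Summand → List JBlock
  | .real n _ c => [⟨n, false, (c : ℂ)⟩]
  | .cplx m a b => [⟨m, false, ⟨a, b⟩⟩, ⟨m, true, ⟨a, -b⟩⟩]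

/-- The blocks of the complexification of an endomorphism of the form `D`, in the order of the
decomposition. -/
noncomputable def NForm.blocks (D : NForm) : List JBlock := D.summands.flatMap Summand.blocks

/-- In some basis of `ℂ⁴` the matrix of `T` is block diagonal with the Jordan blocks in `L`. -/
def HasJCF (T : Module.End ℂ C22) (L : List JBlock) : Prop :=
  ∃ b : Module.Basis (Σ i : Fin L.length, Fin (L.get i).size) ℂ C22,
    LinearMap.toMatrix b b T =
      Matrix.blockDiagonal' fun i => jordanBlock (L.get i).size (L.get i).eig

/-- An entry of a Segre characteristic. Two entries have the same `cls` precisely when they belong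
to the same eigenvalue, i.e. when they are grouped together by round brackets. -/
structure SegreEntry : Type where
  size : ℕ
  barred : Bool
  cls : ℕ

/-- The list of block sizes, grouped according to the eigenvalue: `cls` is the position of the
first block in the list that has the same eigenvalue. -/
noncomputable def segre (L : List JBlock) : List SegreEntry :=
  open Classical in
  L.map fun B => ⟨B.size, B.barred, L.findIdx fun C => decide (C.eig = B.eig)⟩

/-- The complexification of `S` has the Jordan blocks `L`, and, listed in that order, they give the
Segre characteristic `σ`. -/
def HasSegre (S : Module.End ℝ R22) (L : List JBlock) (σ : List SegreEntry) : Prop :=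
  HasJCF (cplxEnd S) L ∧ segre L = σ

/-- The unbarred entry `n` in the group `c`. -/
def ent (n c : ℕ) : SegreEntry := ⟨n, false, c⟩

/-- The barred entry `n` in the group `c`. -/
def bar (n c : ℕ) : SegreEntry := ⟨n, true, c⟩

/-- Sum of the sizes of the blocks in `L` that belong to `z`. -/
noncomputable def algMult (L : List JBlock) (z : ℂ) : ℕ :=
  open Classical in
  ((L.filter fun B => decide (B.eig = z)).map JBlock.size).sum

/-- Number of blocks in `L` that belong to `z`. -/
noncomputable def geoMult (L : List JBlock) (z : ℂ) : ℕ :=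
  open Classical in
  (L.filter fun B => decide (B.eig = z)).length

end Neutral22

open Neutral22

/-!
A self-adjoint endomorphism `S` of `ℝ^{2,2}` is put into normal form by splitting off one Jordan
block at a time. Let `N = S - c` for an eigenvalue `c`, real or complex. The scalar product, extended
to `ℂ⁴` if `c` is not real, is nondegenerate on the generalized eigenspace of `c`, so polarization
gives a vector `z` there with `s(z, N^{m-1} z) ≠ 0`, where `m` is the nilpotency index of `N`.
Correcting `z` by multiples of `N z, N² z, …` yields a vector `x` for which `s(x, Nᵏ x)` is nonzero
only for `k = m - 1` (`exists_jordan_chain`), and then `N^{m-1} x, …, N x, x`, suitably scaled, has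
the antidiagonal Gram matrix of a model summand. For nonreal `c` the generalized eigenspaces of `c`
and of its conjugate are orthogonal, and the real and imaginary parts of the chain form the basis
required (`exists_summand`). The orthogonal complement of the span is again nondegenerate and
invariant, and induction exhausts the space. The resulting list of summands may be reordered, and
since `ℝ^{2,2}` contains no definite subspace of dimension three, its total signature is `(2, 2)`;
only the ten forms have this signature (`exists_normalForm`, `exists_form`).

The normal matrices and the equivalent descriptions of the summands are changes of basis: if
`Pᵀ G P = G'` with `G'` involutive and `A P = P A'`, then `v` has Gram matrix `G` and matrix `A` if
and only if `v P` has Gram matrix `G'` and matrix `A'` (`frame_matrix_iff`). Everything is thereby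
reduced to identities between matrices of size at most four.

Over `ℂ` the pairs `u + iv`, `u - iv` turn an adapted basis into a Jordan basis (`HasForm.hasJCF`),
from which the multiplicities are read off. The geometric multiplicities determine the eigenvalues of
the blocks as a multiset, hence the number of blocks and the number of blocks with a nonreal
eigenvalue. These two numbers distinguish all types except IIIa, IIIb and VII. For two real
eigenvalues `λ`, `μ` the quadratic form `chainForm`, built from `(S - λ)(S - μ)`, is negative
semidefinite and nonzero for IIIa, positive semidefinite and nonzero for IIIb, and zero for VII
(`HasForm.type_eq`).
-/

namespace Neutral22

/-! ### Frames and changes of basis -/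

section Comb

variable {K M : Type*} [Field K] [AddCommGroup M] [Module K M] {n : ℕ}

/-- The family `v * P`, whose `j`-th member is `∑ᵢ Pᵢⱼ vᵢ`. -/
def comb (v : Fin n → M) (P : Matrix (Fin n) (Fin n) K) : Fin n → M :=
  fun j => ∑ i, P i j • v i

theorem comb_comb (v : Fin n → M) (P Q : Matrix (Fin n) (Fin n) K) :
    comb (comb v P) Q = comb v (P * Q) := by
  funext j
  simp only [comb, Finset.smul_sum, smul_smul, Matrix.mul_apply, Finset.sum_smul]
  rw [Finset.sum_comm]
  simp only [mul_comm]

@[simp] theorem comb_one (v : Fin n → M) : comb v (1 : Matrix (Fin n) (Fin n) K) = v := by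
  funext j
  simp [comb, Matrix.one_apply]

theorem hasMatrix_iff_comb {T : Module.End K M} {v : Fin n → M} {A : Matrix (Fin n) (Fin n) K} :
    HasMatrix T v A ↔ (fun j => T (v j)) = comb v A :=
  funext_iff.symm

theorem map_comb (T : Module.End K M) (v : Fin n → M) (P : Matrix (Fin n) (Fin n) K) :
    (fun j => T (comb v P j)) = comb (fun j => T (v j)) P := by
  funext j
  simp [comb]

theorem HasMatrix.comb {T : Module.End K M} {v : Fin n → M} {A A' P : Matrix (Fin n) (Fin n) K}
    (h : HasMatrix T v A) (hA : A * P = P * A') : HasMatrix T (comb v P) A' := by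
  rw [hasMatrix_iff_comb] at *
  rw [map_comb, h, comb_comb, comb_comb, hA]

theorem gram_comb (B : LinearMap.BilinForm K M) {v : Fin n → M} {G : Matrix (Fin n) (Fin n) K}
    (h : ∀ i j, B (v i) (v j) = G i j) (P : Matrix (Fin n) (Fin n) K) (i j : Fin n) :
    B (comb v P i) (comb v P j) = (P.transpose * G * P) i j := by
  simp only [comb, map_sum, LinearMap.sum_apply, map_smul, LinearMap.smul_apply, h, smul_eq_mul,
    Matrix.mul_apply, Matrix.transpose_apply, Finset.sum_mul, Finset.mul_sum]
  exact Finset.sum_congr rfl fun a _ => Finset.sum_congr rfl fun b _ => by ring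

theorem span_comb_le (v : Fin n → M) (P : Matrix (Fin n) (Fin n) K) :
    Submodule.span K (Set.range (comb v P)) ≤ Submodule.span K (Set.range v) := by
  rw [Submodule.span_le]
  rintro _ ⟨j, rfl⟩
  exact Submodule.sum_mem _ fun i _ =>
    Submodule.smul_mem _ _ (Submodule.subset_span ⟨i, rfl⟩)

theorem span_comb (v : Fin n → M) {P Q : Matrix (Fin n) (Fin n) K} (h : P * Q = 1) :
    Submodule.span K (Set.range (comb v P)) = Submodule.span K (Set.range v) := by
  refine le_antisymm (span_comb_le v P) ?_
  conv_lhs => rw [← comb_one (K := K) v, ← h, ← comb_comb]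
  exact span_comb_le _ _

/-- A family whose Gram matrix has a left inverse is linearly independent. -/
theorem linearIndependent_of_gram {ι : Type*} [Fintype ι] [DecidableEq ι]
    (B : LinearMap.BilinForm K M) {v : ι → M}
    {G G' : Matrix ι ι K} (h : ∀ i j, B (v i) (v j) = G i j) (hG : G' * G = 1) :
    LinearIndependent K v := by
  rw [Fintype.linearIndependent_iff]
  intro g hg
  have h0 : G.mulVec g = 0 := by
    funext k
    have := congrArg (B (v k)) hg
    simpa [h, Matrix.mulVec, dotProduct, mul_comm] using this
  have h1 : g = 0 := by
    rw [← Matrix.one_mulVec g, ← hG, ← Matrix.mulVec_mulVec, h0, Matrix.mulVec_zero]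
  exact congrFun h1

theorem linearIndependent_comb {v : Fin n → M} (hv : LinearIndependent K v)
    {P Q : Matrix (Fin n) (Fin n) K} (h : P * Q = 1) : LinearIndependent K (comb v P) := by
  rw [linearIndependent_iff_card_eq_finrank_span] at *
  rw [hv, Set.finrank, Set.finrank, span_comb v h]

end Comb

section Frames

variable {n : ℕ} {U : Submodule ℝ R22} {v : Fin n → R22} {S : Module.End ℝ R22}
  {G G' P Q A A' : Matrix (Fin n) (Fin n) ℝ}

theorem IsFrame.comb (h : IsFrame U v G) (hPQ : P * Q = 1) :
    IsFrame U (comb v P) (P.transpose * G * P) :=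
  ⟨linearIndependent_comb h.indep hPQ, by rw [span_comb v hPQ, h.span_eq], gram_comb _ h.gram P⟩

/-- The inverse of a base change `P` that carries the Gram matrix `G` to an involutive Gram matrix
`G'` is `G' Pᵀ G`. -/
theorem gram_inverse (hG : P.transpose * G * P = G') (hG' : G' * G' = 1) :
    P * (G' * P.transpose * G) = 1 := by
  rw [mul_eq_one_comm, Matrix.mul_assoc, Matrix.mul_assoc, ← Matrix.mul_assoc P.transpose, hG, hG']

/-- The Gram matrix and the matrix of an endomorphism under the change of basis `P`, in both
directions: that `P` is invertible follows from the equation for the Gram matrices. -/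
theorem frame_matrix_iff (hG : P.transpose * G * P = G') (hG' : G' * G' = 1)
    (hA : A * P = P * A') :
    IsFrame U v G ∧ HasMatrix S v A ↔
      IsFrame U (comb v P) G' ∧ HasMatrix S (comb v P) A' := by
  have hPQ := gram_inverse hG hG'
  set Q := G' * P.transpose * G
  have hQP : Q * P = 1 := mul_eq_one_comm.mp hPQ
  constructor
  · rintro ⟨h1, h2⟩
    exact ⟨hG ▸ h1.comb hPQ, h2.comb hA⟩
  · rintro ⟨h1, h2⟩
    have e : Neutral22.comb (Neutral22.comb v P) Q = v := by rw [comb_comb, hPQ, comb_one]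
    have h3 := h1.comb hQP
    have h4 := h2.comb (P := Q) (A' := A) (by
      calc A' * Q = Q * P * A' * Q := by rw [hQP, Matrix.one_mul]
        _ = Q * A * (P * Q) := by rw [Matrix.mul_assoc Q, ← hA]; simp only [Matrix.mul_assoc]
        _ = Q * A := by rw [hPQ, Matrix.mul_one])
    rw [e] at h3 h4
    refine ⟨?_, h4⟩
    convert h3 using 1
    rw [← hG]
    calc G = (P * Q).transpose * G * (P * Q) := by rw [hPQ]; simp
      _ = _ := by rw [Matrix.transpose_mul]; simp only [Matrix.mul_assoc]

theorem exists_frame_matrix_iff (hG : P.transpose * G * P = G') (hG' : G' * G' = 1)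
    (hA : A * P = P * A') :
    (∃ v, IsFrame U v G ∧ HasMatrix S v A) ↔ ∃ E, IsFrame U E G' ∧ HasMatrix S E A' := by
  constructor
  · rintro ⟨v, hv⟩
    exact ⟨_, (frame_matrix_iff hG hG' hA).mp hv⟩
  · rintro ⟨E, hE⟩
    refine ⟨Neutral22.comb E (G' * P.transpose * G), (frame_matrix_iff hG hG' hA).mpr ?_⟩
    rwa [comb_comb, mul_eq_one_comm.mp (gram_inverse hG hG'), comb_one]

/-- Four vectors with an invertible Gram matrix form a basis of `ℝ^{2,2}`. -/
theorem isFrame_top {v : Fin 4 → R22} {G G' : Matrix (Fin 4) (Fin 4) ℝ}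
    (h : ∀ i j, s22 (v i) (v j) = G i j) (hG : G' * G = 1) : IsFrame ⊤ v G := by
  have hi := linearIndependent_of_gram s22 h hG
  exact ⟨hi, hi.span_eq_top_of_card_eq_finrank (by simp), h⟩

end Frames

theorem s22_apply (x y : R22) : s22 x y = x 0 * y 0 + x 1 * y 1 - x 2 * y 2 - x 3 * y 3 := by
  simp only [s22, pqForm, Matrix.toBilin'_apply, psiGram]
  rw [show (∑ i : Fin (2 + 2), ∑ j : Fin (2 + 2), x i * Matrix.diagonal
    (fun i : Fin (2 + 2) => if i.val < 2 then (1 : ℝ) else -1) i j * y j) =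
    ∑ i : Fin 4, ∑ j : Fin 4, x i * Matrix.diagonal
    (fun i : Fin 4 => if i.val < 2 then (1 : ℝ) else -1) i j * y j from rfl]
  simp [Matrix.diagonal_apply, Fin.sum_univ_four]
  ring

theorem s22_comm (x y : R22) : s22 x y = s22 y x := by
  simp only [s22_apply]; ring

theorem sg_mul_self (e : ℤˣ) : sg e * sg e = 1 := by
  rcases Int.units_eq_one_or e with rfl | rfl <;> simp [sg]

/-! ### Normal matrices -/

theorem inv_sqrt_two_sq : (Real.sqrt 2)⁻¹ * (Real.sqrt 2)⁻¹ = 1 / 2 := by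
  rw [← mul_inv, Real.mul_self_sqrt (by norm_num)]; norm_num

theorem psiGram22 : psiGram 2 2 =
    (!![1, 0, 0, 0; 0, 1, 0, 0; 0, 0, -1, 0; 0, 0, 0, -1] : Matrix (Fin 4) (Fin 4) ℝ) := by
  ext i j
  change Fin 4 at i j
  fin_cases i <;> fin_cases j <;> simp [psiGram, Matrix.diagonal]

theorem wittGram2 : wittGram 2 =
    (!![0, 0, 1, 0; 0, 0, 0, 1; 1, 0, 0, 0; 0, 1, 0, 0] : Matrix (Fin 4) (Fin 4) ℝ) := by
  ext i j
  change Fin 4 at i j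
  fin_cases i <;> fin_cases j <;> simp [wittGram]

theorem psiGram_mul_self (p q : ℕ) : psiGram p q * psiGram p q = 1 := by
  rw [psiGram, Matrix.diagonal_mul_diagonal, ← Matrix.diagonal_one]
  congr 1
  funext i
  split_ifs <;> norm_num

theorem wittGram2_mul_self : wittGram 2 * wittGram 2 = 1 := by
  rw [wittGram2]
  ext i j
  fin_cases i <;> fin_cases j <;> simp [Matrix.mul_apply, Fin.sum_univ_four]

/-- The base change matrix from an adapted basis `v` to the pseudo-orthonormal basis
`D.psiBasis v`. -/
noncomputable def NForm.psiChange (D : NForm) : Matrix (Fin 4) (Fin 4) ℝ :=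
  let r : ℝ := (Real.sqrt 2)⁻¹
  match D with
  | .I e _ => !![r, 0, r, 0; 0, r, 0, r; 0, r * sg e, 0, -(r * sg e); r * sg e, 0, -(r * sg e), 0]
  | .II _ _ => !![r, 0, r, 0; 0, r, 0, r; r, 0, -r, 0; 0, -r, 0, r]
  | .IIIa _ _ => !![1, 0, 0, 0; 0, r, 0, r; 0, 0, 1, 0; 0, -r, 0, r]
  | .IIIb _ _ => !![r, 0, r, 0; 0, 1, 0, 0; r, 0, -r, 0; 0, 0, 0, 1]
  | .IV e _ _ _ => !![1, 0, 0, 0; 0, r, r, 0; 0, r * sg e, -(r * sg e), 0; 0, 0, 0, 1]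
  | .V _ _ _ _ => 1
  | .VI e _ _ _ => !![r, 0, 0, r; r * sg e, 0, 0, -(r * sg e); 0, 1, 0, 0; 0, 0, 1, 0]
  | .VII e w _ _ => !![r, 0, r, 0; r * sg e, 0, -(r * sg e), 0; 0, r, 0, r;
      0, r * sg w, 0, -(r * sg w)]
  | .VIII _ _ _ _ => !![1, 0, 0, 0; 0, 0, 1, 0; 0, 1, 0, 0; 0, 0, 0, 1]
  | .IX _ _ _ _ => 1

theorem psiBasis_eq_comb (D : NForm) (v : Fin 4 → R22) : D.psiBasis v = comb v D.psiChange := by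
  cases D <;> simp only [NForm.psiBasis, NForm.psiChange, comb_one] <;> funext j <;>
    fin_cases j <;> simp [comb, hadd, hsub, Fin.sum_univ_four, smul_smul] <;> module

theorem psiChange_gram (D : NForm) :
    D.psiChange.transpose * D.baseGram * D.psiChange = psiGram 2 2 := by
  have hr := inv_sqrt_two_sq
  rw [psiGram22]
  cases D
  case V | IX => simp [NForm.psiChange, NForm.baseGram]
  all_goals
    simp only [NForm.psiChange, NForm.baseGram]
    generalize (Real.sqrt 2)⁻¹ = r at hr
    ext i j
    fin_cases i <;> fin_cases j <;> simp [Matrix.mul_apply, Fin.sum_univ_four] <;>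
      grind [sg_mul_self]

theorem psiChange_mat (D : NForm) : D.baseMat * D.psiChange = D.psiChange * D.psiMat := by
  have hr := inv_sqrt_two_sq
  cases D
  case V | IX => simp [NForm.psiChange, NForm.baseMat, NForm.psiMat]
  all_goals
    simp only [NForm.psiChange, NForm.baseMat, NForm.psiMat, div_eq_mul_inv]
    generalize (Real.sqrt 2)⁻¹ = r at hr
    ext i j
    fin_cases i <;> fin_cases j <;> simp [Matrix.mul_apply, Fin.sum_univ_four] <;>
      grind [sg_mul_self]

theorem isAdapted_iff_psi (S : Module.End ℝ R22) (D : NForm) (v : Fin 4 → R22) :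
    IsAdapted S D v ↔ IsPsiON 2 2 ⊤ (D.psiBasis v) ∧ HasMatrix S (D.psiBasis v) D.psiMat := by
  rw [psiBasis_eq_comb]
  exact frame_matrix_iff (psiChange_gram D) (psiGram_mul_self 2 2) (psiChange_mat D)

theorem exists_isAdapted_iff_psi (S : Module.End ℝ R22) (D : NForm) :
    (∃ v, IsAdapted S D v) ↔ ∃ E, IsPsiON 2 2 ⊤ E ∧ HasMatrix S E D.psiMat :=
  exists_frame_matrix_iff (psiChange_gram D) (psiGram_mul_self 2 2) (psiChange_mat D)

/-! ### Pseudo-orthonormal and Witt bases of the summands -/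

theorem antiGram_one (e : ℤˣ) : antiGram 1 e = !![sg e] := by
  ext i j
  fin_cases i; fin_cases j; simp [antiGram]

theorem antiGram_two (e : ℤˣ) : antiGram 2 e = !![0, sg e; sg e, 0] := by
  ext i j
  fin_cases i <;> fin_cases j <;> simp [antiGram]

theorem antiGram_three (e : ℤˣ) : antiGram 3 e = !![0, 0, sg e; 0, sg e, 0; sg e, 0, 0] := by
  ext i j
  fin_cases i <;> fin_cases j <;> simp [antiGram]

theorem antiGram_four (e : ℤˣ) : antiGram 4 e =
    !![0, 0, 0, sg e; 0, 0, sg e, 0; 0, sg e, 0, 0; sg e, 0, 0, 0] := by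
  ext i j
  fin_cases i <;> fin_cases j <;> simp [antiGram]

theorem pairGram_one : pairGram 1 = (!![1, 0; 0, -1] : Matrix (Fin 2) (Fin 2) ℝ) := by
  ext i j
  change Fin 2 at i j
  fin_cases i <;> fin_cases j <;> simp [pairGram]

theorem pairGram_two : pairGram 2 =
    (!![0, 0, 1, 0; 0, 0, 0, -1; 1, 0, 0, 0; 0, -1, 0, 0] : Matrix (Fin 4) (Fin 4) ℝ) := by
  ext i j
  change Fin 4 at i j
  fin_cases i <;> fin_cases j <;> simp [pairGram]

theorem psiGram11 : psiGram 1 1 = (!![1, 0; 0, -1] : Matrix (Fin 2) (Fin 2) ℝ) := by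
  ext i j
  change Fin 2 at i j
  fin_cases i <;> fin_cases j <;> simp [psiGram, Matrix.diagonal]

theorem psiGram12 : psiGram 1 2 =
    (!![1, 0, 0; 0, -1, 0; 0, 0, -1] : Matrix (Fin 3) (Fin 3) ℝ) := by
  ext i j
  change Fin 3 at i j
  fin_cases i <;> fin_cases j <;> simp [psiGram, Matrix.diagonal]

theorem psiGram21 : psiGram 2 1 =
    (!![1, 0, 0; 0, 1, 0; 0, 0, -1] : Matrix (Fin 3) (Fin 3) ℝ) := by
  ext i j
  change Fin 3 at i j
  fin_cases i <;> fin_cases j <;> simp [psiGram, Matrix.diagonal]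

theorem wittGram1 : wittGram 1 = (!![0, 1; 1, 0] : Matrix (Fin 2) (Fin 2) ℝ) := by
  ext i j
  change Fin 2 at i j
  fin_cases i <;> fin_cases j <;> simp [wittGram]

theorem wittGram1_mul_self : wittGram 1 * wittGram 1 = 1 := by
  rw [wittGram1]
  ext i j
  fin_cases i <;> fin_cases j <;> simp [Matrix.mul_apply]

theorem jordanBlock_two {K : Type*} [Field K] (c : K) : jordanBlock 2 c = !![c, 1; 0, c] := by
  ext i j
  fin_cases i <;> fin_cases j <;> simp [jordanBlock]

theorem jordanBlock_three {K : Type*} [Field K] (c : K) :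
    jordanBlock 3 c = !![c, 1, 0; 0, c, 1; 0, 0, c] := by
  ext i j
  fin_cases i <;> fin_cases j <;> simp [jordanBlock]

theorem realJordanBlock_one (a b : ℝ) :
    realJordanBlock 1 a b = (!![a, b; -b, a] : Matrix (Fin 2) (Fin 2) ℝ) := by
  ext i j
  change Fin 2 at i j
  fin_cases i <;> fin_cases j <;> simp [realJordanBlock]

theorem realJordanBlock_two (a b : ℝ) : realJordanBlock 2 a b =
    (!![a, b, 1, 0; -b, a, 0, 1; 0, 0, a, b; 0, 0, -b, a] : Matrix (Fin 4) (Fin 4) ℝ) := by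
  ext i j
  change Fin 4 at i j
  fin_cases i <;> fin_cases j <;> simp [realJordanBlock]

section Change

/-- Base change from a basis with Gram matrix `(0, ε; ε, 0)` to a pseudo-orthonormal basis. -/
noncomputable def change11 (e : ℤˣ) : Matrix (Fin 2) (Fin 2) ℝ :=
  !![(Real.sqrt 2)⁻¹, (Real.sqrt 2)⁻¹; (Real.sqrt 2)⁻¹ * sg e, -((Real.sqrt 2)⁻¹ * sg e)]

theorem change11_gram (e : ℤˣ) :
    (change11 e).transpose * antiGram 2 e * change11 e = psiGram 1 1 := by
  have hr := inv_sqrt_two_sq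
  rw [psiGram11, antiGram_two, change11]
  generalize (Real.sqrt 2)⁻¹ = r at hr
  ext i j
  fin_cases i <;> fin_cases j <;> simp [Matrix.mul_apply] <;> grind [sg_mul_self]

/-- Base change from a basis with Gram matrix `-1` on the antidiagonal to a pseudo-orthonormal
basis. -/
noncomputable def change12 : Matrix (Fin 3) (Fin 3) ℝ :=
  !![(Real.sqrt 2)⁻¹, 0, (Real.sqrt 2)⁻¹; 0, 1, 0; -(Real.sqrt 2)⁻¹, 0, (Real.sqrt 2)⁻¹]

/-- Base change from a basis with Gram matrix `1` on the antidiagonal to a pseudo-orthonormal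
basis. -/
noncomputable def change21 : Matrix (Fin 3) (Fin 3) ℝ :=
  !![(Real.sqrt 2)⁻¹, 0, (Real.sqrt 2)⁻¹; 0, 1, 0; (Real.sqrt 2)⁻¹, 0, -(Real.sqrt 2)⁻¹]

theorem change12_gram : change12.transpose * antiGram 3 (-1) * change12 = psiGram 1 2 := by
  have hr := inv_sqrt_two_sq
  rw [psiGram12, antiGram_three, change12]
  generalize (Real.sqrt 2)⁻¹ = r at hr
  ext i j
  fin_cases i <;> fin_cases j <;> simp [Matrix.mul_apply, Fin.sum_univ_three, sg] <;> grind

theorem change21_gram : change21.transpose * antiGram 3 1 * change21 = psiGram 2 1 := by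
  have hr := inv_sqrt_two_sq
  rw [psiGram21, antiGram_three, change21]
  generalize (Real.sqrt 2)⁻¹ = r at hr
  ext i j
  fin_cases i <;> fin_cases j <;> simp [Matrix.mul_apply, Fin.sum_univ_three, sg] <;> grind

end Change

section Summands

variable (S : Module.End ℝ R22) (U : Submodule ℝ R22)

theorem fits_real_two_iff_witt (e : ℤˣ) (c : ℝ) (v : Fin 2 → R22) :
    Fits S U (.real 2 e c) v ↔
      IsWitt 1 U ![v 0, sg e • v 1] ∧ HasMatrix S ![v 0, sg e • v 1] !![c, sg e; 0, c] := by
  have hP : ![v 0, sg e • v 1] = comb v !![1, 0; 0, sg e] := by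
    funext j
    fin_cases j <;> simp [comb]
  rw [hP]
  refine frame_matrix_iff (G := antiGram 2 e) ?_ wittGram1_mul_self ?_
  · rw [wittGram1, antiGram_two]
    ext i j
    fin_cases i <;> fin_cases j <;> simp [Matrix.mul_apply, sg_mul_self]
  · change jordanBlock 2 c * _ = _
    rw [jordanBlock_two]
    ext i j
    fin_cases i <;> fin_cases j <;> simp [Matrix.mul_apply, mul_comm]

theorem fits_real_two_iff_psi (e : ℤˣ) (c : ℝ) (v : Fin 2 → R22) :
    Fits S U (.real 2 e c) v ↔
      IsPsiON 1 1 U ![hadd (v 0) (sg e • v 1), hsub (v 0) (sg e • v 1)] ∧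
        HasMatrix S ![hadd (v 0) (sg e • v 1), hsub (v 0) (sg e • v 1)]
          !![c + sg e / 2, -sg e / 2; sg e / 2, c - sg e / 2] := by
  have hP : ![hadd (v 0) (sg e • v 1), hsub (v 0) (sg e • v 1)] = comb v (change11 e) := by
    funext j
    fin_cases j <;> simp [comb, change11, hadd, hsub] <;> module
  rw [hP]
  refine frame_matrix_iff (G := antiGram 2 e) (change11_gram e) (psiGram_mul_self 1 1) ?_
  change jordanBlock 2 c * _ = _
  have hr := inv_sqrt_two_sq
  rw [jordanBlock_two, change11]
  generalize (Real.sqrt 2)⁻¹ = r at hr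
  ext i j
  fin_cases i <;> fin_cases j <;> simp [Matrix.mul_apply] <;> grind [sg_mul_self]

theorem fits_cplx_one_iff (a b : ℝ) (v : Fin 2 → R22) :
    Fits S U (.cplx 1 a b) v ↔ IsPsiON 1 1 U v ∧ HasMatrix S v !![a, b; -b, a] := by
  change IsFrame U v (pairGram 1) ∧ HasMatrix S v (realJordanBlock 1 a b) ↔
    IsFrame U v (psiGram 1 1) ∧ _
  rw [pairGram_one, psiGram11, realJordanBlock_one]

theorem fits_real_three_neg_iff (c : ℝ) (v : Fin 3 → R22) :
    Fits S U (.real 3 (-1) c) v ↔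
      IsPsiON 1 2 U ![hsub (v 0) (v 2), v 1, hadd (v 0) (v 2)] ∧
        HasMatrix S ![hsub (v 0) (v 2), v 1, hadd (v 0) (v 2)]
          !![c, 1 / √2, 0; -1 / √2, c, 1 / √2; 0, 1 / √2, c] := by
  have hP : ![hsub (v 0) (v 2), v 1, hadd (v 0) (v 2)] = comb v change12 := by
    funext j
    fin_cases j <;> simp [comb, change12, hadd, hsub, Fin.sum_univ_three]
    all_goals module
  rw [hP]
  refine frame_matrix_iff (G := antiGram 3 (-1)) change12_gram (psiGram_mul_self 1 2) ?_
  change jordanBlock 3 c * _ = _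
  have hr := inv_sqrt_two_sq
  rw [jordanBlock_three, change12]
  simp only [div_eq_mul_inv]
  generalize (Real.sqrt 2)⁻¹ = r at hr
  ext i j
  fin_cases i <;> fin_cases j <;> simp [Matrix.mul_apply, Fin.sum_univ_three] <;> grind

theorem fits_real_three_pos_iff (c : ℝ) (v : Fin 3 → R22) :
    Fits S U (.real 3 1 c) v ↔
      IsPsiON 2 1 U ![hadd (v 0) (v 2), v 1, hsub (v 0) (v 2)] ∧
        HasMatrix S ![hadd (v 0) (v 2), v 1, hsub (v 0) (v 2)]
          !![c, 1 / √2, 0; 1 / √2, c, -1 / √2; 0, 1 / √2, c] := by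
  have hP : ![hadd (v 0) (v 2), v 1, hsub (v 0) (v 2)] = comb v change21 := by
    funext j
    fin_cases j <;> simp [comb, change21, hadd, hsub, Fin.sum_univ_three]
    all_goals module
  rw [hP]
  refine frame_matrix_iff (G := antiGram 3 1) change21_gram (psiGram_mul_self 2 1) ?_
  change jordanBlock 3 c * _ = _
  have hr := inv_sqrt_two_sq
  rw [jordanBlock_three, change21]
  simp only [div_eq_mul_inv]
  generalize (Real.sqrt 2)⁻¹ = r at hr
  ext i j
  fin_cases i <;> fin_cases j <;> simp [Matrix.mul_apply, Fin.sum_univ_three] <;> grind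

end Summands

section Witt

variable (S : Module.End ℝ R22)

/-- The Witt basis equivalences for one normal form, from the base change matrix `P`. -/
theorem adapted_iff_witt {D : NForm} {P A' : Matrix (Fin 4) (Fin 4) ℝ}
    (hG : P.transpose * D.baseGram * P = wittGram 2) (hA : D.baseMat * P = P * A') :
    (∀ v, IsAdapted S D v ↔ IsWitt 2 ⊤ (comb v P) ∧ HasMatrix S (comb v P) A') ∧
    ((∃ v, IsAdapted S D v) ↔ ∃ E, IsWitt 2 ⊤ E ∧ HasMatrix S E A') :=
  ⟨fun _ => frame_matrix_iff hG wittGram2_mul_self hA,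
    exists_frame_matrix_iff hG wittGram2_mul_self hA⟩

theorem adapted_I_iff_witt (e : ℤˣ) (lam : ℝ) :
    (∀ v, IsAdapted S (.I e lam) v ↔
      IsWitt 2 ⊤ ![v 0, v 1, sg e • v 3, sg e • v 2] ∧
        HasMatrix S ![v 0, v 1, sg e • v 3, sg e • v 2] (wittMatI e lam)) ∧
    ((∃ v, IsAdapted S (.I e lam) v) ↔ ∃ E, IsWitt 2 ⊤ E ∧ HasMatrix S E (wittMatI e lam)) := by
  have hP (v : Fin 4 → R22) : ![v 0, v 1, sg e • v 3, sg e • v 2] =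
      comb v !![1, 0, 0, 0; 0, 1, 0, 0; 0, 0, 0, sg e; 0, 0, sg e, 0] := by
    funext j
    fin_cases j <;> simp [comb, Fin.sum_univ_four]
  simp only [hP]
  apply adapted_iff_witt
  · rw [wittGram2]
    ext i j
    fin_cases i <;> fin_cases j <;>
      simp [Matrix.mul_apply, Fin.sum_univ_four, sg_mul_self, NForm.baseGram]
  · ext i j
    fin_cases i <;> fin_cases j <;>
      simp [Matrix.mul_apply, Fin.sum_univ_four, NForm.baseMat, wittMatI, mul_comm]

theorem adapted_II_iff_witt (a b : ℝ) :
    (∀ v, IsAdapted S (.II a b) v ↔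
      IsWitt 2 ⊤ ![v 0, v 1, v 2, -v 3] ∧
        HasMatrix S ![v 0, v 1, v 2, -v 3] (wittMatII a b)) ∧
    ((∃ v, IsAdapted S (.II a b) v) ↔ ∃ E, IsWitt 2 ⊤ E ∧ HasMatrix S E (wittMatII a b)) := by
  have hP (v : Fin 4 → R22) : ![v 0, v 1, v 2, -v 3] =
      comb v !![1, 0, 0, 0; 0, 1, 0, 0; 0, 0, 1, 0; 0, 0, 0, (-1 : ℝ)] := by
    funext j
    fin_cases j <;> simp [comb, Fin.sum_univ_four]
  simp only [hP]
  apply adapted_iff_witt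
  · rw [wittGram2]
    ext i j
    fin_cases i <;> fin_cases j <;>
      simp [Matrix.mul_apply, Fin.sum_univ_four, NForm.baseGram]
  · ext i j
    fin_cases i <;> fin_cases j <;>
      simp [Matrix.mul_apply, Fin.sum_univ_four, NForm.baseMat, wittMatII]

theorem adapted_VII_iff_witt (e w : ℤˣ) (lam mu : ℝ) :
    (∀ v, IsAdapted S (.VII e w lam mu) v ↔
      IsWitt 2 ⊤ ![v 0, v 2, sg e • v 1, sg w • v 3] ∧
        HasMatrix S ![v 0, v 2, sg e • v 1, sg w • v 3] (wittMatVII e w lam mu)) ∧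
    ((∃ v, IsAdapted S (.VII e w lam mu) v) ↔
      ∃ E, IsWitt 2 ⊤ E ∧ HasMatrix S E (wittMatVII e w lam mu)) := by
  have hP (v : Fin 4 → R22) : ![v 0, v 2, sg e • v 1, sg w • v 3] =
      comb v !![1, 0, 0, 0; 0, 0, sg e, 0; 0, 1, 0, 0; 0, 0, 0, sg w] := by
    funext j
    fin_cases j <;> simp [comb, Fin.sum_univ_four]
  simp only [hP]
  apply adapted_iff_witt
  · rw [wittGram2]
    ext i j
    fin_cases i <;> fin_cases j <;>
      simp [Matrix.mul_apply, Fin.sum_univ_four, sg_mul_self, NForm.baseGram]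
  · ext i j
    fin_cases i <;> fin_cases j <;>
      simp [Matrix.mul_apply, Fin.sum_univ_four, NForm.baseMat, wittMatVII, mul_comm]

end Witt

/-! ### Signatures of the summands -/

/-- A subspace with a pseudo-orthonormal basis of signature `(p, q)` is isometric to `ℝ^{p,q}`. -/
theorem IsFrame.isIsometricTo {p q : ℕ} {U : Submodule ℝ R22} {v : Fin (p + q) → R22}
    (h : IsFrame U v (psiGram p q)) : IsIsometricTo U p q := by
  obtain ⟨hi, rfl, hg⟩ := h
  let b := Module.Basis.span hi
  refine ⟨b.equivFun, fun x y => ?_⟩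
  have hx (x : Submodule.span ℝ (Set.range v)) : (x : R22) = ∑ i, b.equivFun x i • v i := by
    conv_lhs => rw [← b.sum_equivFun x]
    simp [b, Module.Basis.span_apply]
  conv_rhs => rw [hx x, hx y]
  simp only [pqForm, Matrix.toBilin'_apply, map_sum, LinearMap.sum_apply, map_smul,
    LinearMap.smul_apply, hg, smul_eq_mul]
  rw [Finset.sum_comm]
  simp only [Finset.mul_sum]
  exact Finset.sum_congr rfl fun _ _ => Finset.sum_congr rfl fun _ _ => by ring

theorem IsFrame.exists_psi_of_change {p q : ℕ} {U : Submodule ℝ R22}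
    {v : Fin (p + q) → R22} {G : Matrix (Fin (p + q)) (Fin (p + q)) ℝ} (h : IsFrame U v G)
    (P : Matrix (Fin (p + q)) (Fin (p + q)) ℝ) (hG : P.transpose * G * P = psiGram p q) :
    ∃ v', IsFrame U v' (psiGram p q) :=
  ⟨_, hG ▸ h.comb (gram_inverse hG (psiGram_mul_self p q))⟩

/-- Every summand has a pseudo-orthonormal basis of the expected signature. -/
theorem Fits.exists_psi {D : NForm} {S : Module.End ℝ R22} {s : Summand}
    (hs : s ∈ D.summands) {U : Submodule ℝ R22} {v : Fin s.dim → R22} (h : Fits S U s v) :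
    ∃ v', IsFrame U v' (psiGram s.sig.1 s.sig.2) := by
  have r1p (c) (v : Fin 1 → R22) (h : Fits S U (.real 1 1 c) v) :
      ∃ v', IsFrame U v' (psiGram 1 0) := by
    have hG : psiGram 1 0 = antiGram 1 1 := by
      ext i j
      fin_cases i; fin_cases j; simp [antiGram, psiGram, sg]
    exact ⟨v, hG ▸ h.1⟩
  have r1m (c) (v : Fin 1 → R22) (h : Fits S U (.real 1 (-1) c) v) :
      ∃ v', IsFrame U v' (psiGram 0 1) := by
    have hG : psiGram 0 1 = antiGram 1 (-1) := by
      ext i j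
      fin_cases i; fin_cases j; simp [antiGram, psiGram, sg]
    exact ⟨v, hG ▸ h.1⟩
  have r2 (e c) (v : Fin 2 → R22) (h : Fits S U (.real 2 e c) v) :
      ∃ v', IsFrame U v' (psiGram 1 1) :=
    IsFrame.exists_psi_of_change (p := 1) (q := 1) h.1 (change11 e) (change11_gram e)
  have r3p (c) (v : Fin 3 → R22) (h : Fits S U (.real 3 1 c) v) :
      ∃ v', IsFrame U v' (psiGram 2 1) :=
    IsFrame.exists_psi_of_change (p := 2) (q := 1) h.1 change21 change21_gram
  have r3m (c) (v : Fin 3 → R22) (h : Fits S U (.real 3 (-1) c) v) :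
      ∃ v', IsFrame U v' (psiGram 1 2) :=
    IsFrame.exists_psi_of_change (p := 1) (q := 2) h.1 change12 change12_gram
  have r4 (e c) (v : Fin 4 → R22) (h : Fits S U (.real 4 e c) v) :
      ∃ v', IsFrame U v' (psiGram 2 2) := by
    refine IsFrame.exists_psi_of_change (p := 2) (q := 2) h.1 (NForm.I e c).psiChange ?_
    rw [← psiChange_gram (.I e c)]
    congr 2
    exact antiGram_four e
  have c1 (a b) (v : Fin 2 → R22) (h : Fits S U (.cplx 1 a b) v) :
      ∃ v', IsFrame U v' (psiGram 1 1) :=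
    ⟨v, ((fits_cplx_one_iff S U a b v).mp h).1⟩
  have c2 (a b) (v : Fin 4 → R22) (h : Fits S U (.cplx 2 a b) v) :
      ∃ v', IsFrame U v' (psiGram 2 2) := by
    refine IsFrame.exists_psi_of_change (p := 2) (q := 2) h.1 (NForm.II a b).psiChange ?_
    rw [← psiChange_gram (.II a b)]
    congr 2
    exact pairGram_two
  cases D <;> simp only [NForm.summands, List.mem_cons, List.not_mem_nil, or_false] at hs
  case I e lam =>
    subst hs
    rcases Int.units_eq_one_or e with rfl | rfl <;> exact r4 _ _ v h
  case II => subst hs; exact c2 _ _ v h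
  case IIIa => rcases hs with rfl | rfl; exacts [r1p _ v h, r3m _ v h]
  case IIIb => rcases hs with rfl | rfl; exacts [r3p _ v h, r1m _ v h]
  case IV e _ _ _ =>
    rcases hs with rfl | rfl | rfl
    · exact r1p _ v h
    · rcases Int.units_eq_one_or e with rfl | rfl <;> exact r2 _ _ v h
    · exact r1m _ v h
  case V => rcases hs with rfl | rfl | rfl; exacts [r1p _ v h, c1 _ _ v h, r1m _ v h]
  case VI e _ _ _ =>
    rcases hs with rfl | rfl
    · rcases Int.units_eq_one_or e with rfl | rfl <;> exact r2 _ _ v h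
    · exact c1 _ _ v h
  case VII e w _ _ =>
    rcases hs with rfl | rfl
    · rcases Int.units_eq_one_or e with rfl | rfl <;> exact r2 _ _ v h
    · rcases Int.units_eq_one_or w with rfl | rfl <;> exact r2 _ _ v h
  case VIII => rcases hs with rfl | rfl <;> exact c1 _ _ v h
  case IX =>
    rcases hs with rfl | rfl | rfl | rfl
    exacts [r1p _ v h, r1p _ v h, r1m _ v h, r1m _ v h]

theorem Fits.isIsometricTo {D : NForm} {S : Module.End ℝ R22} {s : Summand}
    (hs : s ∈ D.summands) {U : Submodule ℝ R22} {v : Fin s.dim → R22} (h : Fits S U s v) :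
    IsIsometricTo U s.sig.1 s.sig.2 :=
  (h.exists_psi hs).elim fun _ h' => h'.isIsometricTo

/-! ### Decompositions and adapted bases -/

/-- Position, in the concatenation of the bases of the summands of `D`, of the `a`-th vector of the
`i`-th summand. (The reduction modulo 4 has no effect: all positions are below 4.) -/
def NForm.idx (D : NForm) (i : Fin D.summands.length) (a : Fin (D.summands.get i).dim) : Fin 4 :=
  ⟨(((D.summands.take i).map Summand.dim).sum + a) % 4, Nat.mod_lt _ (by norm_num)⟩

theorem idx_same (D : NForm) (i : Fin D.summands.length) (a b : Fin (D.summands.get i).dim) :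
    D.baseGram (D.idx i a) (D.idx i b) = (D.summands.get i).gram a b ∧
    D.baseMat (D.idx i a) (D.idx i b) = (D.summands.get i).mat a b := by
  obtain ⟨i, hi⟩ := i
  obtain ⟨a, ha⟩ := a
  obtain ⟨b, hb⟩ := b
  cases D <;> simp only [NForm.summands, List.length_cons, List.length_nil] at hi <;>
    interval_cases i <;> simp only [NForm.summands, List.get_eq_getElem, List.getElem_cons_zero,
      List.getElem_cons_succ, Summand.dim] at ha hb <;>
    interval_cases a <;> interval_cases b <;>
    simp [NForm.summands, NForm.idx, Summand.dim, Summand.gram, Summand.mat, NForm.baseGram,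
      NForm.baseMat, antiGram, pairGram, jordanBlock, realJordanBlock, sg]

theorem idx_ne (D : NForm) (i j : Fin D.summands.length) (hij : i ≠ j)
    (a : Fin (D.summands.get i).dim) (b : Fin (D.summands.get j).dim) :
    D.baseGram (D.idx i a) (D.idx j b) = 0 ∧ D.baseMat (D.idx i a) (D.idx j b) = 0 := by
  obtain ⟨i, hi⟩ := i
  obtain ⟨j, hj⟩ := j
  obtain ⟨a, ha⟩ := a
  obtain ⟨b, hb⟩ := b
  replace hij : i ≠ j := fun h => hij (Fin.ext h)
  cases D <;> simp only [NForm.summands, List.length_cons, List.length_nil] at hi hj <;>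
    interval_cases i <;> interval_cases j <;> (try exact absurd rfl hij) <;>
    simp only [NForm.summands, List.get_eq_getElem, List.getElem_cons_zero,
      List.getElem_cons_succ, Summand.dim] at ha hb <;>
    interval_cases a <;> interval_cases b <;>
    simp [NForm.summands, NForm.idx, Summand.dim, NForm.baseGram, NForm.baseMat]

theorem idx_bijective (D : NForm) : Function.Bijective
    (fun p : Σ i : Fin D.summands.length, Fin (D.summands.get i).dim => D.idx p.1 p.2) := by
  rw [Fintype.bijective_iff_surjective_and_card]
  constructor
  · intro k
    cases D <;> fin_cases k <;> first
      | exact ⟨⟨⟨0, Nat.le_of_ble_eq_true rfl⟩, ⟨0, Nat.le_of_ble_eq_true rfl⟩⟩, rfl⟩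
      | exact ⟨⟨⟨0, Nat.le_of_ble_eq_true rfl⟩, ⟨1, Nat.le_of_ble_eq_true rfl⟩⟩, rfl⟩
      | exact ⟨⟨⟨0, Nat.le_of_ble_eq_true rfl⟩, ⟨2, Nat.le_of_ble_eq_true rfl⟩⟩, rfl⟩
      | exact ⟨⟨⟨0, Nat.le_of_ble_eq_true rfl⟩, ⟨3, Nat.le_of_ble_eq_true rfl⟩⟩, rfl⟩
      | exact ⟨⟨⟨1, Nat.le_of_ble_eq_true rfl⟩, ⟨0, Nat.le_of_ble_eq_true rfl⟩⟩, rfl⟩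
      | exact ⟨⟨⟨1, Nat.le_of_ble_eq_true rfl⟩, ⟨1, Nat.le_of_ble_eq_true rfl⟩⟩, rfl⟩
      | exact ⟨⟨⟨1, Nat.le_of_ble_eq_true rfl⟩, ⟨2, Nat.le_of_ble_eq_true rfl⟩⟩, rfl⟩
      | exact ⟨⟨⟨2, Nat.le_of_ble_eq_true rfl⟩, ⟨0, Nat.le_of_ble_eq_true rfl⟩⟩, rfl⟩
      | exact ⟨⟨⟨3, Nat.le_of_ble_eq_true rfl⟩, ⟨0, Nat.le_of_ble_eq_true rfl⟩⟩, rfl⟩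
  · simp only [Fintype.card_sigma, Fintype.card_fin]
    cases D <;> rfl

/-- The indices of the vectors of the summands, identified with the positions `0, …, 3`. -/
noncomputable def NForm.idxEquiv (D : NForm) :
    (Σ i : Fin D.summands.length, Fin (D.summands.get i).dim) ≃ Fin 4 :=
  Equiv.ofBijective _ (idx_bijective D)

theorem idxEquiv_apply (D : NForm) (i : Fin D.summands.length)
    (a : Fin (D.summands.get i).dim) : D.idxEquiv ⟨i, a⟩ = D.idx i a := rfl

theorem baseGram_inverse (D : NForm) :
    D.psiChange * psiGram 2 2 * D.psiChange.transpose * D.baseGram = 1 := by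
  have := gram_inverse (psiChange_gram D) (psiGram_mul_self 2 2)
  simpa only [Matrix.mul_assoc] using this

theorem baseMat_selfAdjoint (D : NForm) :
    D.baseMat.transpose * D.baseGram = D.baseGram * D.baseMat := by
  cases D <;> simp only [NForm.baseMat, NForm.baseGram] <;> ext i j <;> fin_cases i <;>
    fin_cases j <;> simp [Matrix.mul_apply, Fin.sum_univ_four] <;> ring

/-- Orthogonal nondegenerate subspaces that span the space form a direct sum. -/
theorem isInternal_of_orthogonal {k : ℕ} {U : Fin k → Submodule ℝ R22}
    (ho : ∀ i j, i ≠ j → ∀ x ∈ U i, ∀ y ∈ U j, s22 x y = 0)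
    (hn : ∀ i, ∀ x ∈ U i, (∀ y ∈ U i, s22 x y = 0) → x = 0) (ht : ⨆ i, U i = ⊤) :
    DirectSum.IsInternal U := by
  refine DirectSum.isInternal_submodule_of_iSupIndep_of_iSup_eq_top ?_ ht
  intro i
  rw [Submodule.disjoint_def]
  intro x hx hx'
  refine hn i x hx fun y hy => ?_
  have hle : (⨆ j, ⨆ (_ : j ≠ i), U j) ≤ LinearMap.ker (s22.flip y) :=
    iSup₂_le fun j hj z hz => ho j i hj z hz y hy
  exact hle hx'

theorem IsFrame.nondegenerate {n : ℕ} {U : Submodule ℝ R22} {v : Fin n → R22}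
    {G G' : Matrix (Fin n) (Fin n) ℝ} (h : IsFrame U v G) (hG : G' * G = 1) {x : R22}
    (hx : x ∈ U) (h0 : ∀ y ∈ U, s22 x y = 0) : x = 0 := by
  rw [← h.span_eq, Submodule.mem_span_range_iff_exists_fun] at hx
  obtain ⟨c, rfl⟩ := hx
  have h1 : G.mulVec c = 0 := by
    funext k
    have := h0 (v k) (h.span_eq ▸ Submodule.subset_span ⟨k, rfl⟩)
    rw [s22_comm] at this
    simpa [h.gram, Matrix.mulVec, dotProduct, mul_comm] using this
  have h2 : c = 0 := by
    rw [← Matrix.one_mulVec c, ← hG, ← Matrix.mulVec_mulVec, h1, Matrix.mulVec_zero]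
  simp [h2]

theorem HasMatrix.map_mem_span {n : ℕ} {S : Module.End ℝ R22} {v : Fin n → R22}
    {A : Matrix (Fin n) (Fin n) ℝ} (h : HasMatrix S v A) {x : R22}
    (hx : x ∈ Submodule.span ℝ (Set.range v)) : S x ∈ Submodule.span ℝ (Set.range v) := by
  rw [Submodule.mem_span_range_iff_exists_fun] at hx
  obtain ⟨c, rfl⟩ := hx
  simp only [map_sum, map_smul, h _]
  exact Submodule.sum_mem _ fun j _ => Submodule.smul_mem _ _ <| Submodule.sum_mem _ fun i _ =>
    Submodule.smul_mem _ _ (Submodule.subset_span ⟨i, rfl⟩)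

/-- The Gram matrices of the model summands are involutive: each is a signed permutation matrix
belonging to an involution that preserves the signs. -/
theorem Summand.gram_mul_self (s : Summand) : s.gram * s.gram = 1 := by
  have key {n : ℕ} (σ : Fin n → Fin n) (c : Fin n → ℝ) (h : ∀ i, σ (σ i) = i)
      (hc : ∀ i, c i * c (σ i) = 1) :
      (Matrix.of fun i j => if j = σ i then c i else 0) *
        (Matrix.of fun i j => if j = σ i then c i else 0) = 1 := by
    ext i j
    rw [Matrix.mul_apply, Finset.sum_eq_single (σ i)]
    · simp [Matrix.one_apply, h, hc, eq_comm]
    · intro k _ hk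
      simp [hk]
    · simp
  cases s with
  | real n e c =>
    change antiGram n e * antiGram n e = 1
    have : antiGram n e = Matrix.of fun i j => if j = Fin.rev i then sg e else 0 := by
      ext i j
      simp only [antiGram, Matrix.of_apply]
      congr 1
      simp only [Fin.ext_iff, Fin.val_rev, eq_iff_iff]
      omega
    rw [this]
    exact key _ _ Fin.rev_rev fun _ => sg_mul_self e
  | cplx m a b =>
    change pairGram m * pairGram m = 1
    have : pairGram m = Matrix.of fun i j =>
        if j = (⟨2 * (m - 1 - i.val / 2) + i.val % 2, by omega⟩ : Fin (2 * m)) then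
          (if i.val % 2 = 0 then (1 : ℝ) else -1) else 0 := by
      ext i j
      simp only [pairGram, Matrix.of_apply]
      congr 1
      simp only [Fin.ext_iff, eq_iff_iff]
      omega
    rw [this]
    refine key _ _ (fun i => ?_) fun i => ?_
    · simp only [Fin.ext_iff]
      omega
    · have : (2 * (m - 1 - i.val / 2) + i.val % 2) % 2 = i.val % 2 := by omega
      simp only [this]
      split_ifs <;> norm_num

/-- Bases of mutually orthogonal summands, listed one after the other, form an adapted basis. -/
theorem exists_isAdapted_of_family {S : Module.End ℝ R22} {D : NForm}
    {w : (i : Fin D.summands.length) → Fin (D.summands.get i).dim → R22}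
    (hg : ∀ i a b, s22 (w i a) (w i b) = (D.summands.get i).gram a b)
    (hm : ∀ i, HasMatrix S (w i) (D.summands.get i).mat)
    (ho : ∀ i j, i ≠ j → ∀ a b, s22 (w i a) (w j b) = 0) : ∃ v, IsAdapted S D v := by
  obtain ⟨v, hv⟩ : ∃ v : Fin 4 → R22, ∀ p, v (D.idxEquiv p) = w p.1 p.2 :=
    ⟨fun k => (fun q : Σ i : Fin D.summands.length, Fin (D.summands.get i).dim => w q.1 q.2)
      (D.idxEquiv.symm k), fun p => congrArg (fun q : Σ i : Fin D.summands.length,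
        Fin (D.summands.get i).dim => w q.1 q.2) (D.idxEquiv.symm_apply_apply p)⟩
  refine ⟨v, isFrame_top ?_ (baseGram_inverse D), ?_⟩
  · intro k l
    obtain ⟨⟨i, a⟩, rfl⟩ := D.idxEquiv.surjective k
    obtain ⟨⟨j, b⟩, rfl⟩ := D.idxEquiv.surjective l
    rw [hv, hv]
    by_cases hij : i = j
    · subst hij
      rw [hg, idxEquiv_apply, idxEquiv_apply, (idx_same D i a b).1]
    · rw [idxEquiv_apply, idxEquiv_apply, (idx_ne D i j hij a b).1]
      exact ho i j hij a b
  · intro l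
    obtain ⟨⟨j, b⟩, rfl⟩ := D.idxEquiv.surjective l
    rw [← D.idxEquiv.sum_comp, Fintype.sum_sigma, Finset.sum_eq_single j]
    · rw [hv, hm j b]
      refine Finset.sum_congr rfl fun a _ => ?_
      rw [hv, idxEquiv_apply, idxEquiv_apply, (idx_same D j a b).2]
    · intro i _ hij
      refine Finset.sum_eq_zero fun a _ => ?_
      rw [idxEquiv_apply, idxEquiv_apply, (idx_ne D i j hij a b).2, zero_smul]
    · simp

/-- A decomposition of the form `D` is the same as an adapted basis: the bases of the summands are
listed one after the other, and conversely the spans of the pieces of an adapted basis are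
orthogonal nondegenerate invariant subspaces. -/
theorem hasForm_iff_adapted (S : Module.End ℝ R22) (D : NForm) :
    HasForm S D ↔ ∃ v, IsAdapted S D v := by
  constructor
  · rintro ⟨U, hU, hf⟩
    choose w hw using hf
    exact exists_isAdapted_of_family (w := w) (fun i => (hw i).1.gram) (fun i => (hw i).2)
      fun i j hij a b => hU.orth i j hij _ ((hw i).1.span_eq ▸ Submodule.subset_span ⟨a, rfl⟩) _
        ((hw j).1.span_eq ▸ Submodule.subset_span ⟨b, rfl⟩)
  · rintro ⟨v, hv⟩
    have hfit (i : Fin D.summands.length) :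
        Fits S (Submodule.span ℝ (Set.range fun a => v (D.idx i a))) (D.summands.get i)
          (fun a => v (D.idx i a)) := by
      refine ⟨⟨hv.1.indep.comp _ fun a b hab => ?_, rfl, fun a b => ?_⟩, fun b => ?_⟩
      · have := D.idxEquiv.injective (a₁ := ⟨i, a⟩) (a₂ := ⟨i, b⟩) hab
        simpa using this
      · rw [hv.1.gram, (idx_same D i a b).1]
      · rw [hv.2, ← D.idxEquiv.sum_comp, Fintype.sum_sigma, Finset.sum_eq_single i]
        · exact Finset.sum_congr rfl fun a _ => by rw [idxEquiv_apply, (idx_same D i a b).2]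
        · intro j _ hji
          refine Finset.sum_eq_zero fun a _ => ?_
          rw [idxEquiv_apply, (idx_ne D j i hji a b).2, zero_smul]
        · simp
    have ho (i j : Fin D.summands.length) (hij : i ≠ j) :
        ∀ x ∈ Submodule.span ℝ (Set.range fun a => v (D.idx i a)),
        ∀ y ∈ Submodule.span ℝ (Set.range fun a => v (D.idx j a)), s22 x y = 0 := by
      intro x hx y hy
      rw [Submodule.mem_span_range_iff_exists_fun] at hx hy
      obtain ⟨c, rfl⟩ := hx
      obtain ⟨d, rfl⟩ := hy
      simp [hv.1.gram, (idx_ne D i j hij _ _).1]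
    refine ⟨fun i => Submodule.span ℝ (Set.range fun a => v (D.idx i a)),
      ⟨isInternal_of_orthogonal ho
        (fun i x hx h0 => (hfit i).1.nondegenerate (Summand.gram_mul_self _) hx h0) ?_,
        ho, fun i x hx => (hfit i).2.map_mem_span hx⟩, fun i => ⟨_, hfit i⟩⟩
    rw [eq_top_iff, ← hv.1.span_eq, Submodule.span_le]
    rintro _ ⟨k, rfl⟩
    obtain ⟨⟨i, a⟩, rfl⟩ := D.idxEquiv.surjective k
    exact Submodule.mem_iSup_of_mem i (Submodule.subset_span ⟨a, rfl⟩)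

theorem IsFrame.isSelfAdjoint {n : ℕ} {v : Fin n → R22} {S : Module.End ℝ R22}
    {G A : Matrix (Fin n) (Fin n) ℝ} (h : IsFrame ⊤ v G) (hA : HasMatrix S v A)
    (hs : A.transpose * G = G * A) : LinearMap.IsSelfAdjoint s22 S := by
  intro x y
  have hmem (z : R22) : ∃ c : Fin n → ℝ, ∑ i, c i • v i = z := by
    rw [← Submodule.mem_span_range_iff_exists_fun, h.span_eq]
    trivial
  obtain ⟨c, rfl⟩ := hmem x
  obtain ⟨d, rfl⟩ := hmem y
  have key (i j : Fin n) : s22 (S (v i)) (v j) = s22 (v i) (S (v j)) := by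
    have := congrFun (congrFun hs i) j
    simp only [Matrix.mul_apply, Matrix.transpose_apply] at this
    simpa [hA i, hA j, h.gram, mul_comm] using this
  simp [key]

theorem HasForm.isSelfAdjoint {S : Module.End ℝ R22} {D : NForm} (h : HasForm S D) :
    LinearMap.IsSelfAdjoint s22 S := by
  obtain ⟨v, hv⟩ := (hasForm_iff_adapted S D).mp h
  exact hv.1.isSelfAdjoint hv.2 (baseMat_selfAdjoint D)

theorem hasForm_iff_psi (S : Module.End ℝ R22) (D : NForm) :
    HasForm S D ↔ ∃ E, IsPsiON 2 2 ⊤ E ∧ HasMatrix S E D.psiMat :=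
  (hasForm_iff_adapted S D).trans (exists_isAdapted_iff_psi S D)

theorem exists_hasForm (D : NForm) : ∃ S : Module.End ℝ R22, HasForm S D := by
  refine ⟨Matrix.toLin' D.psiMat, (hasForm_iff_psi _ D).mpr
    ⟨fun i => Pi.single i 1, isFrame_top (fun i j => ?_) (psiGram_mul_self 2 2), fun j => ?_⟩⟩
  · rw [psiGram22, s22_apply]
    fin_cases i <;> fin_cases j <;> simp
  · ext k
    simp [Pi.single_apply, Matrix.mulVec_single]

/-! ### Cyclic vectors of self-adjoint endomorphisms -/

section Cyclic

variable {K V : Type*} [Field K] [AddCommGroup V] [Module K V]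
  {B : LinearMap.BilinForm K V}

theorem bilin_pow_apply {N : Module.End K V} (hN : ∀ x y, B (N x) y = B x (N y)) (k : ℕ)
    (x y : V) : B ((N ^ k) x) y = B x ((N ^ k) y) := by
  induction k generalizing x with
  | zero => rfl
  | succ k ih => rw [pow_succ, Module.End.mul_apply, ih, hN, ← pow_succ, pow_succ',
      Module.End.mul_apply]

/-- Subtracting `α Nʲ⁺¹ x` with `α = B(x, N^{m-2-j} x) / (2 B(x, N^{m-1} x))` kills the next
product `B(x, N^{m-2-j} x)` and does not change those already treated. -/
theorem exists_clean_vector (h2 : (2 : K) ≠ 0) {N : Module.End K V}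
    (hN : ∀ x y, B (N x) y = B x (N y)) {m : ℕ} {z : V} (hz : (N ^ m) z = 0)
    (hc : B z ((N ^ (m - 1)) z) ≠ 0) (j : ℕ) (hj : j ≤ m - 1) :
    ∃ x, (N ^ m) x = 0 ∧ B x ((N ^ (m - 1)) x) ≠ 0 ∧
      ∀ i, 1 ≤ i → i ≤ j → B x ((N ^ (m - 1 - i)) x) = 0 := by
  induction j with
  | zero => exact ⟨z, hz, hc, fun i h1 h0 => absurd h0 (by omega)⟩
  | succ j ih =>
    obtain ⟨x, hx, hxc, hx0⟩ := ih (by omega)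
    have hbig (k : ℕ) (hk : m ≤ k) : (N ^ k) x = 0 := by
      obtain ⟨t, rfl⟩ := Nat.exists_eq_add_of_le' hk
      rw [pow_add, Module.End.mul_apply, hx, map_zero]
    set α := B x ((N ^ (m - 1 - (j + 1))) x) / (2 * B x ((N ^ (m - 1)) x)) with hα
    have hpow (k : ℕ) : (N ^ k) (x - α • (N ^ (j + 1)) x) =
        (N ^ k) x - α • (N ^ (k + (j + 1))) x := by
      rw [map_sub, map_smul, pow_add N k, Module.End.mul_apply]
    have hexp (k : ℕ) : B (x - α • (N ^ (j + 1)) x) ((N ^ k) (x - α • (N ^ (j + 1)) x)) =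
        B x ((N ^ k) x) - 2 * α * B x ((N ^ (k + (j + 1))) x) +
          α ^ 2 * B x ((N ^ (k + 2 * (j + 1))) x) := by
      have e1 : B ((N ^ (j + 1)) x) ((N ^ k) x) = B x ((N ^ (k + (j + 1))) x) := by
        rw [bilin_pow_apply hN, ← Module.End.mul_apply, ← pow_add, add_comm k]
      have e2 : B ((N ^ (j + 1)) x) ((N ^ (k + (j + 1))) x) =
          B x ((N ^ (k + 2 * (j + 1))) x) := by
        rw [bilin_pow_apply hN, ← Module.End.mul_apply, ← pow_add]
        congr 3
        ring
      rw [hpow]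
      simp only [map_sub, map_smul, LinearMap.sub_apply, LinearMap.smul_apply, smul_eq_mul, e1, e2]
      ring
    refine ⟨x - α • (N ^ (j + 1)) x, ?_, ?_, ?_⟩
    · rw [hpow, hx, hbig _ (by omega), smul_zero, sub_zero]
    · rw [hexp, hbig (m - 1 + (j + 1)) (by omega), hbig (m - 1 + 2 * (j + 1)) (by omega)]
      simpa using hxc
    · intro i h1 hi
      rw [hexp, hbig (m - 1 - i + 2 * (j + 1)) (by omega)]
      rcases Nat.lt_or_ge i (j + 1) with h | h
      · rw [hbig (m - 1 - i + (j + 1)) (by omega), hx0 i h1 (by omega)]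
        simp
      · obtain rfl : i = j + 1 := by omega
        rw [show m - 1 - (j + 1) + (j + 1) = m - 1 by omega, hα]
        field_simp
        simp

/-- A self-adjoint endomorphism with eigenvalue `c` has a Jordan chain `N^{m-1} x, …, N x, x`, where
`N = T - c`, such that `B(x, Nᵏ x) ≠ 0` for exactly one `k`, namely `k = m - 1`.
One starts with a generalized eigenvector `z` such that `B(z, N^{m-1} z) ≠ 0`, where `m` is the
nilpotency index of `N` on the generalized eigenspace; it exists because `B` is nondegenerate on the
generalized eigenspace. -/
theorem exists_jordan_chain [FiniteDimensional K V] (h2 : (2 : K) ≠ 0)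
    (hB : ∀ x y, B x y = B y x) (hnd : ∀ x, (∀ y, B x y = 0) → x = 0) {T : Module.End K V}
    (hT : ∀ x y, B (T x) y = B x (T y)) {c : K} {e : V} (he : e ≠ 0) (hTe : T e = c • e) :
    ∃ (m : ℕ) (x : V), 1 ≤ m ∧ ((T - c • 1) ^ m) x = 0 ∧
      ∀ k, B x (((T - c • 1) ^ k) x) ≠ 0 ↔ k = m - 1 := by
  set N : Module.End K V := T - c • 1
  have hN (x y : V) : B (N x) y = B x (N y) := by
    simp [N, hT]
  have hNe : N e = 0 := by simp [N, hTe]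
  obtain ⟨d, hd, hd1⟩ := ((LinearMap.eventually_isCompl_ker_pow_range_pow N).and
    (Filter.eventually_ge_atTop 1)).exists
  have hex : ∃ m, ∀ g, (N ^ d) g = 0 → (N ^ m) g = 0 := ⟨d, fun _ h => h⟩
  classical
  set m := Nat.find hex
  have hm : ∀ g, (N ^ d) g = 0 → (N ^ m) g = 0 := Nat.find_spec hex
  have heG : (N ^ d) e = 0 := by
    obtain ⟨t, rfl⟩ := Nat.exists_eq_add_of_le' hd1
    rw [pow_succ, Module.End.mul_apply, hNe, map_zero]
  have hm1 : 1 ≤ m := by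
    by_contra h
    have h0 := hm e heG
    rw [show m = 0 by omega] at h0
    exact he (by simpa using h0)
  obtain ⟨g, hg, hgn⟩ : ∃ g, (N ^ d) g = 0 ∧ (N ^ (m - 1)) g ≠ 0 := by
    by_contra! h
    exact Nat.find_min hex (m := m - 1) (by omega) h
  -- By Fitting's lemma every vector is the sum of a generalized eigenvector and of a vector in the
  -- range of `N ^ d`, which is orthogonal to the generalized eigenvectors.
  obtain ⟨y, hy, hgy⟩ : ∃ y, (N ^ d) y = 0 ∧ B ((N ^ (m - 1)) g) y ≠ 0 := by
    by_contra! h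
    refine hgn (hnd _ fun w => ?_)
    obtain ⟨y, hy, r, hr, rfl⟩ : ∃ y ∈ LinearMap.ker (N ^ d), ∃ r ∈ LinearMap.range (N ^ d),
        y + r = w := Submodule.mem_sup.mp (hd.sup_eq_top ▸ Submodule.mem_top)
    obtain ⟨r, rfl⟩ := hr
    rw [map_add, h y hy, ← bilin_pow_apply hN, ← Module.End.mul_apply, ← pow_add, add_comm d,
      pow_add, Module.End.mul_apply, hg]
    simp
  obtain ⟨z, hz, hzc⟩ : ∃ z, (N ^ d) z = 0 ∧ B z ((N ^ (m - 1)) z) ≠ 0 := by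
    by_contra! h
    have h3 := h (g + y) (by rw [map_add, hg, hy, add_zero])
    have h4 : B y ((N ^ (m - 1)) g) = B g ((N ^ (m - 1)) y) := by
      rw [hB, bilin_pow_apply hN]
    simp only [map_add, LinearMap.add_apply, h g hg, h y hy, h4, zero_add, add_zero] at h3
    rw [bilin_pow_apply hN] at hgy
    exact hgy ((mul_eq_zero.mp (by linear_combination h3 :
      2 * B g ((N ^ (m - 1)) y) = 0)).resolve_left h2)
  obtain ⟨x, hx, hxc, hx0⟩ := exists_clean_vector h2 hN (hm z hz) hzc (m - 1) le_rfl
  refine ⟨m, x, hm1, hx, fun k => ⟨fun hk => ?_, fun hk => hk ▸ hxc⟩⟩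
  by_contra hne
  apply hk
  rcases Nat.lt_or_ge k m with h | h
  · rw [← hx0 (m - 1 - k) (by omega) (by omega)]
    congr 3
    omega
  · obtain ⟨t, rfl⟩ := Nat.exists_eq_add_of_le' h
    rw [pow_add, Module.End.mul_apply, hx]
    simp

/-- Generalized eigenvectors for different eigenvalues are orthogonal. -/
theorem bilin_eq_zero_of_pow {T : Module.End K V} (hT : ∀ x y, B (T x) y = B x (T y)) {c d : K}
    (hcd : c ≠ d) (a b : ℕ) (x y : V) (hx : ((T - c • 1) ^ a) x = 0)
    (hy : ((T - d • 1) ^ b) y = 0) : B x y = 0 := by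
  induction hn : a + b using Nat.strong_induction_on generalizing a b x y with
  | _ n ih =>
    rcases a with _ | a
    · simp [show x = 0 by simpa using hx]
    rcases b with _ | b
    · simp [show y = 0 by simpa using hy]
    rw [pow_succ, Module.End.mul_apply] at hx hy
    have h1 := ih (a + (b + 1)) (by omega) a (b + 1) _ y hx
      (by rw [pow_succ, Module.End.mul_apply, hy]) rfl
    have h2 := ih (a + 1 + b) (by omega) (a + 1) b x _
      (by rw [pow_succ, Module.End.mul_apply, hx]) hy rfl
    simp only [LinearMap.sub_apply, LinearMap.smul_apply, Module.End.one_apply, map_sub, map_smul,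
      smul_eq_mul, hT] at h1 h2
    have h3 : (c - d) * B x y = 0 := by linear_combination h2 - h1
    exact (mul_eq_zero.mp h3).resolve_left (sub_ne_zero.mpr hcd)

end Cyclic

/-! ### Complexification -/

/-- The real part of a vector. -/
def reVec (z : C22) : R22 := fun i => (z i).re

/-- The imaginary part of a vector. -/
def imVec (z : C22) : R22 := fun i => (z i).im

theorem cpair_apply (u v : R22) (i : Fin 4) : cpair u v i = ⟨u i, v i⟩ := by
  apply Complex.ext <;> simp [cpair, cvec]

@[simp] theorem reVec_cpair (u v : R22) : reVec (cpair u v) = u := by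
  funext i
  simp [reVec, cpair_apply]

@[simp] theorem imVec_cpair (u v : R22) : imVec (cpair u v) = v := by
  funext i
  simp [imVec, cpair_apply]

@[simp] theorem cpair_re_im (z : C22) : cpair (reVec z) (imVec z) = z := by
  funext i
  rw [cpair_apply]
  rfl

theorem cpair_zero_right (u : R22) : cpair u 0 = cvec u := by
  funext i
  rw [cpair_apply]
  rfl

theorem cpair_injective {u v u' v' : R22} (h : cpair u v = cpair u' v') : u = u' ∧ v = v' :=
  ⟨by simpa using congrArg reVec h, by simpa using congrArg imVec h⟩

theorem star_cpair (u v : R22) : star (cpair u v) = cpair u (-v) := by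
  funext i
  rw [Pi.star_apply, cpair_apply, cpair_apply]
  rfl

theorem smul_cpair (a b : ℝ) (u v : R22) :
    (⟨a, b⟩ : ℂ) • cpair u v = cpair (a • u - b • v) (a • v + b • u) := by
  funext i
  apply Complex.ext <;> simp [cpair_apply]

theorem cpair_add (u v u' v' : R22) :
    cpair u v + cpair u' v' = cpair (u + u') (v + v') := by
  funext i
  apply Complex.ext <;> simp [cpair_apply]

theorem cplxEnd_cpair (S : Module.End ℝ R22) (u v : R22) :
    cplxEnd S (cpair u v) = cpair (S u) (S v) := by
  have h (x : R22) : S x = (LinearMap.toMatrix' S).mulVec x := by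
    rw [← Matrix.toLin'_apply, Matrix.toLin'_toMatrix']
  funext i
  rw [cplxEnd, Matrix.toLin'_apply, h u, h v, cpair_apply]
  apply Complex.ext <;> simp [Matrix.mulVec, dotProduct, cpair_apply]

theorem sC_apply (x y : C22) : sC x y = x 0 * y 0 + x 1 * y 1 - x 2 * y 2 - x 3 * y 3 := by
  have h : sC = Matrix.toBilin' ((!![1, 0, 0, 0; 0, 1, 0, 0; 0, 0, -1, 0; 0, 0, 0, -1] :
      Matrix (Fin 4) (Fin 4) ℝ).map (algebraMap ℝ ℂ)) := by
    rw [← psiGram22]; rfl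
  rw [h, Matrix.toBilin'_apply]
  simp [Fin.sum_univ_four]
  ring

theorem sC_comm (x y : C22) : sC x y = sC y x := by
  simp only [sC_apply]; ring

theorem sC_cpair (u v u' v' : R22) :
    sC (cpair u v) (cpair u' v') = ⟨s22 u u' - s22 v v', s22 u v' + s22 v u'⟩ := by
  apply Complex.ext <;> simp [sC_apply, s22_apply, cpair_apply] <;> ring

theorem cplxEnd_selfAdjoint {S : Module.End ℝ R22} (hS : LinearMap.IsSelfAdjoint s22 S)
    (x y : C22) : sC (cplxEnd S x) y = sC x (cplxEnd S y) := by
  rw [← cpair_re_im x, ← cpair_re_im y, cplxEnd_cpair, cplxEnd_cpair, sC_cpair, sC_cpair,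
    hS, hS, hS, hS]

theorem cplxEnd_star (S : Module.End ℝ R22) (x : C22) :
    cplxEnd S (star x) = star (cplxEnd S x) := by
  rw [← cpair_re_im x, star_cpair, cplxEnd_cpair, cplxEnd_cpair, star_cpair, map_neg]

/-- The vectors with real and imaginary part in `U`. -/
def cplxOf (U : Submodule ℝ R22) : Submodule ℂ C22 where
  carrier := {z | reVec z ∈ U ∧ imVec z ∈ U}
  zero_mem' := ⟨U.zero_mem, U.zero_mem⟩
  add_mem' := fun {x y} hx hy => ⟨U.add_mem hx.1 hy.1, U.add_mem hx.2 hy.2⟩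
  smul_mem' := fun c x hx => by
    rw [← cpair_re_im x, ← Complex.eta c, smul_cpair]
    simpa using ⟨U.sub_mem (U.smul_mem _ hx.1) (U.smul_mem _ hx.2),
      U.add_mem (U.smul_mem _ hx.2) (U.smul_mem _ hx.1)⟩

theorem cpair_mem_cplxOf {U : Submodule ℝ R22} {u v : R22} :
    cpair u v ∈ cplxOf U ↔ u ∈ U ∧ v ∈ U := by
  change reVec _ ∈ U ∧ imVec _ ∈ U ↔ _
  simp

/-! ### Splitting off a summand -/

/-- The summands that occur in `ℝ^{2,2}`. -/
def Summand.Good : Summand → Prop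
  | .real n _ _ => 1 ≤ n ∧ n ≤ 4
  | .cplx m _ b => (m = 1 ∨ m = 2) ∧ b ≠ 0

/-- A nondegenerate `S`-invariant subspace. -/
structure IsNondegInv (S : Module.End ℝ R22) (U : Submodule ℝ R22) : Prop where
  nondeg : ∀ x ∈ U, (∀ y ∈ U, s22 x y = 0) → x = 0
  inv : ∀ x ∈ U, S x ∈ U

section Splitting

variable {S : Module.End ℝ R22} {U : Submodule ℝ R22}

theorem cplxEnd_mem_cplxOf (hU : IsNondegInv S U) :
    ∀ x ∈ cplxOf U, cplxEnd S x ∈ cplxOf U := by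
  intro x hx
  rw [← cpair_re_im x] at hx ⊢
  rw [cpair_mem_cplxOf] at hx
  rw [cplxEnd_cpair, cpair_mem_cplxOf]
  exact ⟨hU.inv _ hx.1, hU.inv _ hx.2⟩

theorem sum_jordanBlock_smul {K M : Type*} [Field K] [AddCommGroup M] [Module K M] {n : ℕ} (c : K)
    (v : Fin n → M) (j : Fin n) : ∑ i, jordanBlock n c i j • v i =
      c • v j + if 0 < j.val then v ⟨j.val - 1, by omega⟩ else 0 := by
  have h (i : Fin n) : jordanBlock n c i j • v i =
      (if i = j then c • v i else 0) + if i.val + 1 = j.val then v i else 0 := by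
    simp only [jordanBlock, Matrix.of_apply]
    split_ifs with h1 h2 <;> simp
    exact absurd h2 (by rw [h1]; omega)
  simp only [h, Finset.sum_add_distrib, Finset.sum_ite_eq', Finset.mem_univ, if_true]
  congr 1
  split_ifs with h0
  · rw [Finset.sum_eq_single ⟨j.val - 1, by omega⟩]
    · simp only [ite_eq_left_iff]
      omega
    · intro i _ hi
      rw [if_neg]
      intro h
      exact hi (Fin.ext (by simp; omega))
    · simp
  · exact Finset.sum_eq_zero fun i _ => if_neg (by omega)

theorem gram_le_four {n : ℕ} {v : Fin n → R22} {G : Matrix (Fin n) (Fin n) ℝ}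
    (h : ∀ i j, s22 (v i) (v j) = G i j) (hG : G * G = 1) : n ≤ 4 := by
  have := (linearIndependent_of_gram s22 h hG).fintype_card_le_finrank
  simpa using this

/-- For a real eigenvalue the Jordan chain, normalized by a real factor, spans a summand; the sign
`ε` is the sign of `s(x, N^{m-1} x)`. -/
theorem exists_real_summand (hS : LinearMap.IsSelfAdjoint s22 S) (hU : IsNondegInv S U) {c : ℝ}
    {e : R22} (heU : e ∈ U) (he : e ≠ 0) (hSe : S e = c • e) :
    ∃ s : Summand, s.Good ∧ ∃ v : Fin s.dim → R22, (∀ i, v i ∈ U) ∧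
      (∀ i j, s22 (v i) (v j) = s.gram i j) ∧ HasMatrix S v s.mat := by
  obtain ⟨m, x, hm, hx, hk⟩ := exists_jordan_chain (K := ℝ) (V := U) (B := s22.restrict U)
    two_ne_zero (fun x y => s22_comm x y)
    (fun x hx => Subtype.ext (hU.nondeg x x.2 fun y hy => hx ⟨y, hy⟩))
    (T := S.restrict hU.inv) (fun x y => hS x y) (c := c) (e := ⟨e, heU⟩)
    (fun h => he (congrArg Subtype.val h)) (Subtype.ext hSe)
  set N := S.restrict hU.inv - c • 1
  have hN (x y : U) : s22.restrict U (N x) y = s22.restrict U x (N y) := by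
    have := hS x y
    simp [N, this]
  set β := s22.restrict U x ((N ^ (m - 1)) x) with hβ
  have hβ0 : β ≠ 0 := (hk _).mpr rfl
  obtain ⟨ε, hε⟩ : ∃ ε : ℤˣ, sg ε * |β| = β := by
    rcases lt_or_gt_of_ne hβ0 with h | h
    · exact ⟨-1, by simp [sg, abs_of_neg h]⟩
    · exact ⟨1, by simp [sg, abs_of_pos h]⟩
  set r := (Real.sqrt |β|)⁻¹
  have hr : r * r * β = sg ε := by
    have h1 : Real.sqrt |β| * Real.sqrt |β| = |β| := Real.mul_self_sqrt (abs_nonneg _)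
    rw [show r * r = |β|⁻¹ by rw [← h1, mul_inv]]
    calc |β|⁻¹ * β = |β|⁻¹ * (sg ε * |β|) := by rw [hε]
      _ = sg ε := by field_simp
  let v : Fin m → R22 := fun i => r • (((N ^ (m - 1 - i.val)) x : U) : R22)
  have hg (i j : Fin m) : s22 (v i) (v j) = antiGram m ε i j := by
    have h1 : s22 (v i) (v j) = r * r *
        s22.restrict U x ((N ^ ((m - 1 - i.val) + (m - 1 - j.val))) x) := by
      rw [pow_add, Module.End.mul_apply, ← bilin_pow_apply hN]
      simp [v, mul_assoc]
    rw [h1]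
    simp only [antiGram, Matrix.of_apply]
    split_ifs with h
    · rw [show m - 1 - i.val + (m - 1 - j.val) = m - 1 by omega, ← hβ, hr]
    · have : s22.restrict U x ((N ^ ((m - 1 - i.val) + (m - 1 - j.val))) x) = 0 := by
        by_contra h0
        have := (hk _).mp h0
        omega
      rw [this, mul_zero]
  refine ⟨.real m ε c, ⟨hm, gram_le_four hg (Summand.gram_mul_self (.real m ε c))⟩, v,
    fun i => U.smul_mem _ (Subtype.prop _), hg, fun (j : Fin m) => ?_⟩
  change S (v j) = ∑ i : Fin m, jordanBlock m c i j • v i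
  rw [sum_jordanBlock_smul]
  have h1 (y : U) : S y = c • (y : R22) + (N y : U) := by simp [N]
  have h2 : S (v j) = c • v j + r • (((N ^ (m - 1 - j.val + 1)) x : U) : R22) := by
    simp only [v]
    rw [map_smul, h1, pow_succ', Module.End.mul_apply, smul_add, smul_comm]
  rw [h2]
  congr 1
  split_ifs with h
  · simp only [v]
    congr 5
    omega
  · rw [show m - 1 - j.val + 1 = m by omega, hx]
    simp

theorem hasMatrix_realJordanBlock_one {v : Fin 2 → R22} {a b : ℝ}
    (h0 : S (v 0) = a • v 0 - b • v 1) (h1 : S (v 1) = a • v 1 + b • v 0) :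
    HasMatrix (n := 2) S v (realJordanBlock 1 a b) := by
  rw [realJordanBlock_one]
  intro j
  rw [Fin.sum_univ_two]
  fin_cases j
  · simp only [Fin.zero_eta, h0]; simp; module
  · simp only [Fin.mk_one, h1]; simp; module

theorem hasMatrix_realJordanBlock_two {v : Fin 4 → R22} {a b : ℝ}
    (h0 : S (v 0) = a • v 0 - b • v 1) (h1 : S (v 1) = a • v 1 + b • v 0)
    (h2 : S (v 2) = a • v 2 - b • v 3 + v 0) (h3 : S (v 3) = a • v 3 + b • v 2 + v 1) :
    HasMatrix (n := 4) S v (realJordanBlock 2 a b) := by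
  rw [realJordanBlock_two]
  intro j
  rw [Fin.sum_univ_four]
  fin_cases j
  · simp only [Fin.zero_eta, h0]; simp; module
  · simp only [Fin.mk_one, h1]; simp; module
  · simp only [Fin.reduceFinMk, h2]; simp; module
  · simp only [Fin.reduceFinMk, h3]; simp; module

/-- For a nonreal eigenvalue the real and imaginary parts of a Jordan chain in `ℂ⁴` span a summand.
The chain is orthogonal to its conjugate because the eigenvalue differs from its conjugate; this
separates the products of the real parts from those of the imaginary parts. -/
theorem exists_cplx_summand (hS : LinearMap.IsSelfAdjoint s22 S) (hU : IsNondegInv S U) {a b : ℝ}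
    (hb : b ≠ 0) {e : C22} (heU : e ∈ cplxOf U) (he : e ≠ 0)
    (hSe : cplxEnd S e = (⟨a, b⟩ : ℂ) • e) :
    ∃ s : Summand, s.Good ∧ ∃ v : Fin s.dim → R22, (∀ i, v i ∈ U) ∧
      (∀ i j, s22 (v i) (v j) = s.gram i j) ∧ HasMatrix S v s.mat := by
  have hinv := cplxEnd_mem_cplxOf hU
  have hnd : ∀ x ∈ cplxOf U, (∀ y ∈ cplxOf U, sC x y = 0) → x = 0 := by
    intro x hx h
    have h1 (y : R22) (hy : y ∈ U) : s22 (reVec x) y = 0 ∧ s22 (imVec x) y = 0 := by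
      have := h (cpair y 0) (cpair_mem_cplxOf.mpr ⟨hy, U.zero_mem⟩)
      rw [← cpair_re_im x, sC_cpair] at this
      simpa [Complex.ext_iff] using this
    have h2 := hU.nondeg _ hx.1 fun y hy => (h1 y hy).1
    have h3 := hU.nondeg _ hx.2 fun y hy => (h1 y hy).2
    rw [← cpair_re_im x, h2, h3, cpair_zero_right]
    funext i
    simp [cvec]
  obtain ⟨m, x, hm, hx, hk⟩ := exists_jordan_chain (K := ℂ) (V := cplxOf U)
    (B := sC.restrict (cplxOf U)) two_ne_zero (fun x y => sC_comm x y)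
    (fun x hx => Subtype.ext (hnd x x.2 fun y hy => hx ⟨y, hy⟩))
    (T := (cplxEnd S).restrict hinv) (fun x y => cplxEnd_selfAdjoint hS x y) (c := ⟨a, b⟩)
    (e := ⟨e, heU⟩) (fun h => he (congrArg Subtype.val h)) (Subtype.ext hSe)
  set N' := (cplxEnd S).restrict hinv - (⟨a, b⟩ : ℂ) • 1
  set N : Module.End ℂ C22 := cplxEnd S - (⟨a, b⟩ : ℂ) • 1 with hNdef
  have hcoe (k : ℕ) : (((N' ^ k) x : cplxOf U) : C22) = (N ^ k) (x : C22) := by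
    induction k with
    | zero => rfl
    | succ k ih =>
      rw [pow_succ', pow_succ', Module.End.mul_apply, Module.End.mul_apply, ← ih]
      rfl
  have hNsa (x y : C22) : sC (N x) y = sC x (N y) := by
    have := cplxEnd_selfAdjoint hS x y
    simp [N, this]
  have hxm : (N ^ m) (x : C22) = 0 := by rw [← hcoe, hx]; rfl
  have hk' (k : ℕ) : sC x ((N ^ k) (x : C22)) ≠ 0 ↔ k = m - 1 := by
    rw [← hcoe]
    exact hk k
  set β := sC x ((N ^ (m - 1)) (x : C22)) with hβ
  have hβ0 : β ≠ 0 := (hk' _).mpr rfl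
  -- The factor 2 makes the real and imaginary parts of the chain have products `±1`.
  obtain ⟨r, hr⟩ : ∃ r : ℂ, r * r = 2 / β := by
    obtain ⟨r, hr⟩ := IsAlgClosed.exists_pow_nat_eq (2 / β) (n := 2) two_pos
    exact ⟨r, by rw [← pow_two, hr]⟩
  set w : ℕ → C22 := fun i => r • (N ^ (m - 1 - i)) (x : C22) with hw
  have hwU (i : ℕ) : w i ∈ cplxOf U :=
    Submodule.smul_mem _ _ (by rw [← hcoe]; exact Subtype.prop _)
  have hg1 (i j : ℕ) (hi : i < m) (hj : j < m) :
      sC (w i) (w j) = if i + j + 1 = m then 2 else 0 := by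
    have h1 : sC (w i) (w j) = r * r *
        sC x ((N ^ ((m - 1 - i) + (m - 1 - j))) (x : C22)) := by
      rw [pow_add, Module.End.mul_apply, ← bilin_pow_apply hNsa]
      simp [w, mul_assoc]
    rw [h1]
    split_ifs with h
    · rw [show m - 1 - i + (m - 1 - j) = m - 1 by omega, ← hβ, hr]
      field_simp
    · have : sC x ((N ^ ((m - 1 - i) + (m - 1 - j))) (x : C22)) = 0 := by
        by_contra h0
        have := (hk' _).mp h0
        omega
      rw [this, mul_zero]
  have hstar (k : ℕ) (y : C22) :
      ((cplxEnd S - (⟨a, -b⟩ : ℂ) • 1) ^ k) (star y) = star ((N ^ k) y) := by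
    induction k generalizing y with
    | zero => rfl
    | succ k ih =>
      rw [pow_succ, pow_succ, Module.End.mul_apply, Module.End.mul_apply, ← ih]
      congr 1
      simp only [hNdef, LinearMap.sub_apply, LinearMap.smul_apply, Module.End.one_apply,
        cplxEnd_star, star_sub, star_smul]
      rfl
  have hwm (i : ℕ) : (N ^ m) (w i) = 0 := by
    rw [hw]
    simp only [map_smul]
    rw [← Module.End.mul_apply, ← pow_add, add_comm, pow_add, Module.End.mul_apply, hxm]
    simp
  have hg2 (i j : ℕ) : sC (w i) (star (w j)) = 0 := by
    refine bilin_eq_zero_of_pow (T := cplxEnd S) (cplxEnd_selfAdjoint hS) (c := ⟨a, b⟩)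
      (d := ⟨a, -b⟩) ?_ m m _ _ (hwm i) (by rw [hstar, hwm]; simp)
    intro h
    have := congrArg Complex.im h
    simp only at this
    exact hb (by linarith)
  have hreal (i j : ℕ) (hi : i < m) (hj : j < m) :
      s22 (reVec (w i)) (reVec (w j)) = (if i + j + 1 = m then 1 else 0) ∧
      s22 (imVec (w i)) (imVec (w j)) = (if i + j + 1 = m then -1 else 0) ∧
      s22 (reVec (w i)) (imVec (w j)) = 0 ∧ s22 (imVec (w i)) (reVec (w j)) = 0 := by
    have h1 := hg1 i j hi hj
    have h2 := hg2 i j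
    rw [← cpair_re_im (w i), ← cpair_re_im (w j)] at h1 h2
    rw [star_cpair, sC_cpair] at h2
    rw [sC_cpair] at h1
    simp only [map_neg] at h2
    split_ifs at h1 ⊢ <;> simp only [Complex.ext_iff, Complex.zero_re, Complex.zero_im,
      Complex.re_ofNat, Complex.im_ofNat] at h1 h2 <;> refine ⟨?_, ?_, ?_, ?_⟩ <;> linarith
  have hSw (i : ℕ) (hi : i < m) : cplxEnd S (w i) =
      (⟨a, b⟩ : ℂ) • w i + if 0 < i then w (i - 1) else 0 := by
    have h1 (y : C22) : cplxEnd S y = (⟨a, b⟩ : ℂ) • y + N y := by simp [N]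
    have h2 : cplxEnd S (w i) = (⟨a, b⟩ : ℂ) • w i + r • (N ^ (m - 1 - i + 1)) (x : C22) := by
      simp only [w]
      rw [map_smul, h1, pow_succ', Module.End.mul_apply, smul_add, smul_comm]
    rw [h2]
    congr 1
    split_ifs with h
    · simp only [w]
      congr 3
      omega
    · rw [show m - 1 - i + 1 = m by omega, hxm]
      simp
  have hSre (i : ℕ) (hi : i < m) :
      S (reVec (w i)) = a • reVec (w i) - b • imVec (w i) +
        (if 0 < i then reVec (w (i - 1)) else 0) ∧
      S (imVec (w i)) = a • imVec (w i) + b • reVec (w i) +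
        (if 0 < i then imVec (w (i - 1)) else 0) := by
    have h := hSw i hi
    rw [← cpair_re_im (w i), cplxEnd_cpair, smul_cpair] at h
    split_ifs at h ⊢
    · rw [← cpair_re_im (w (i - 1)), cpair_add] at h
      simpa using cpair_injective h
    · rw [add_zero] at h
      simpa using cpair_injective h
  let v : Fin (2 * m) → R22 := fun k =>
    if k.val % 2 = 0 then reVec (w (k.val / 2)) else imVec (w (k.val / 2))
  have hg (i j : Fin (2 * m)) : s22 (v i) (v j) = pairGram m i j := by
    obtain ⟨h1, h2, h3, h4⟩ := hreal (i.val / 2) (j.val / 2) (by omega) (by omega)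
    simp only [v, pairGram, Matrix.of_apply]
    rcases Nat.mod_two_eq_zero_or_one i.val with hi | hi <;>
      rcases Nat.mod_two_eq_zero_or_one j.val with hj | hj <;>
      simp [hi, hj, h1, h2, h3, h4]
  have hm2 : m = 1 ∨ m = 2 := by
    have := gram_le_four hg (Summand.gram_mul_self (.cplx m a b))
    omega
  refine ⟨.cplx m a b, ⟨hm2, hb⟩, v, fun i => ?_, hg, ?_⟩
  · have := hwU (i.val / 2)
    simp only [v]
    split_ifs
    exacts [this.1, this.2]
  · change HasMatrix S v (realJordanBlock m a b)
    have h0 := hSre 0 (by omega)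
    rcases hm2 with rfl | rfl
    · simp only [lt_irrefl, if_false, add_zero] at h0
      exact hasMatrix_realJordanBlock_one (v := v) h0.1 h0.2
    · have h1 := hSre 1 (by omega)
      simp only [lt_irrefl, if_false, add_zero] at h0
      simp only [Nat.one_pos, if_true, Nat.sub_self] at h1
      exact hasMatrix_realJordanBlock_two (v := v) h0.1 h0.2 h1.1 h1.2

/-- Every nonzero nondegenerate invariant subspace contains a summand. -/
theorem exists_summand (hS : LinearMap.IsSelfAdjoint s22 S) (hU : IsNondegInv S U)
    (hne : U ≠ ⊥) :
    ∃ s : Summand, s.Good ∧ ∃ v : Fin s.dim → R22, (∀ i, v i ∈ U) ∧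
      (∀ i j, s22 (v i) (v j) = s.gram i j) ∧ HasMatrix S v s.mat := by
  have hinv := cplxEnd_mem_cplxOf hU
  have hnt : Nontrivial (cplxOf U) := by
    obtain ⟨x, hx, hx0⟩ := Submodule.exists_mem_ne_zero_of_ne_bot hne
    refine ⟨⟨cpair x 0, cpair_mem_cplxOf.mpr ⟨hx, U.zero_mem⟩⟩, 0, fun h => hx0 ?_⟩
    have h1 : cpair x 0 = 0 := congrArg Subtype.val h
    have h2 := congrArg reVec h1
    rw [reVec_cpair] at h2
    rw [h2]
    rfl
  obtain ⟨⟨a, b⟩, hab⟩ := Module.End.exists_eigenvalue ((cplxEnd S).restrict hinv)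
  obtain ⟨e, he⟩ := hab.exists_hasEigenvector
  have hSe : cplxEnd S e = (⟨a, b⟩ : ℂ) • (e : C22) := congrArg Subtype.val he.apply_eq_smul
  have he0 : (e : C22) ≠ 0 := fun h => he.2 (Subtype.ext h)
  by_cases hb : b = 0
  · subst hb
    rw [← cpair_re_im (e : C22), cplxEnd_cpair, smul_cpair] at hSe
    obtain ⟨h1, h2⟩ := cpair_injective hSe
    by_cases hre : reVec (e : C22) = 0
    · refine exists_real_summand hS hU (c := a) e.2.2 (fun him => he0 ?_) (by simpa using h2)
      rw [← cpair_re_im (e : C22), hre, him]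
      funext i
      rw [cpair_apply]
      rfl
    · exact exists_real_summand hS hU (c := a) e.2.1 hre (by simpa using h1)
  · exact exists_cplx_summand hS hU hb e.2 he0 hSe

end Splitting

/-! ### Existence of a normal form -/

section Existence

variable {S : Module.End ℝ R22} {U : Submodule ℝ R22}

/-- The orthogonal complement, inside `U`, of the vectors `vᵢ`. -/
noncomputable def perp (U : Submodule ℝ R22) {n : ℕ} (v : Fin n → R22) : Submodule ℝ R22 :=
  U ⊓ ⨅ i, LinearMap.ker (s22 (v i))

theorem mem_perp {n : ℕ} {v : Fin n → R22} {x : R22} :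
    x ∈ perp U v ↔ x ∈ U ∧ ∀ i, s22 (v i) x = 0 := by
  simp [perp]

theorem perp_comm {n m : ℕ} (v : Fin n → R22) (w : Fin m → R22) :
    perp (perp U v) w = perp (perp U w) v :=
  inf_right_comm _ _ _

theorem exists_sub_mem_perp {n : ℕ} {v : Fin n → R22} {G : Matrix (Fin n) (Fin n) ℝ}
    (hv : ∀ i, v i ∈ U) (hg : ∀ i j, s22 (v i) (v j) = G i j) (hG : G * G = 1) {x : R22}
    (hx : x ∈ U) : ∃ p ∈ Submodule.span ℝ (Set.range v), x - p ∈ perp U v := by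
  refine ⟨∑ j, (G.mulVec fun i => s22 (v i) x) j • v j,
    Submodule.sum_mem _ fun j _ => Submodule.smul_mem _ _ (Submodule.subset_span ⟨j, rfl⟩),
    mem_perp.mpr ⟨U.sub_mem hx (Submodule.sum_mem _ fun j _ => Submodule.smul_mem _ _ (hv j)),
      fun i => ?_⟩⟩
  have h : (G.mulVec (G.mulVec fun i => s22 (v i) x)) i = s22 (v i) x := by
    rw [Matrix.mulVec_mulVec, hG, Matrix.one_mulVec]
  rw [map_sub, sub_eq_zero, ← h]
  simp only [map_sum, map_smul, hg, smul_eq_mul]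
  conv_lhs => rw [Matrix.mulVec, dotProduct]
  exact Finset.sum_congr rfl fun j _ => mul_comm _ _

theorem IsNondegInv.perp (hS : LinearMap.IsSelfAdjoint s22 S) (hU : IsNondegInv S U) {n : ℕ}
    {v : Fin n → R22} {G A : Matrix (Fin n) (Fin n) ℝ} (hv : ∀ i, v i ∈ U)
    (hg : ∀ i j, s22 (v i) (v j) = G i j) (hG : G * G = 1) (hA : HasMatrix S v A) :
    IsNondegInv S (perp U v) := by
  refine ⟨fun x hx h => ?_, fun x hx => ?_⟩
  · rw [mem_perp] at hx
    refine hU.nondeg x hx.1 fun y hy => ?_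
    obtain ⟨p, hp, hyp⟩ := exists_sub_mem_perp hv hg hG hy
    rw [← sub_add_cancel y p, map_add, h _ hyp, zero_add]
    obtain ⟨c, rfl⟩ := (Submodule.mem_span_range_iff_exists_fun ℝ).mp hp
    simp [s22_comm x, hx.2]
  · rw [mem_perp] at hx ⊢
    refine ⟨hU.inv x hx.1, fun i => ?_⟩
    rw [← hS, hA i]
    simp [hx.2]

/-- `U` contains mutually orthogonal bases of the summands in `L`, and is exhausted by them: a basis
of the first summand lies in `U`, its orthogonal complement in `U` is exhausted by the rest. -/
def Splits (S : Module.End ℝ R22) : Submodule ℝ R22 → List Summand → Prop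
  | U, [] => U = ⊥
  | U, s :: L => ∃ v : Fin s.dim → R22, (∀ i, v i ∈ U) ∧
      (∀ i j, s22 (v i) (v j) = s.gram i j) ∧ HasMatrix S v s.mat ∧ Splits S (perp U v) L

theorem exists_splits (hS : LinearMap.IsSelfAdjoint s22 S) (hU : IsNondegInv S U) :
    ∃ L : List Summand, (∀ s ∈ L, s.Good) ∧ Splits S U L := by
  induction hn : Module.finrank ℝ U using Nat.strong_induction_on generalizing U with
  | _ n ih =>
    by_cases hb : U = ⊥
    · exact ⟨[], by simp, hb⟩
    obtain ⟨s, hs, v, hv, hg, hm⟩ := exists_summand hS hU hb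
    have hlt : perp U v < U := by
      refine lt_of_le_of_ne inf_le_left fun h => ?_
      have hdim : 0 < s.dim := by
        cases s with
        | real n e c => exact hs.1
        | cplx m a b => rcases hs.1 with rfl | rfl <;> simp [Summand.dim]
      have hli := linearIndependent_of_gram s22 hg s.gram_mul_self
      refine hli.ne_zero ⟨0, hdim⟩ (hU.nondeg _ (hv _) fun y hy => ?_)
      rw [← h, mem_perp] at hy
      exact hy.2 _
    obtain ⟨L, hL, hsp⟩ := ih _ (hn ▸ Submodule.finrank_lt_finrank_of_lt hlt)
      (hU.perp hS hv hg s.gram_mul_self hm) rfl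
    exact ⟨s :: L, by simpa using ⟨hs, hL⟩, v, hv, hg, hm, hsp⟩

/-- The order in which the summands are split off does not matter. -/
theorem Splits.perm {L L' : List Summand} (hp : L.Perm L') (h : Splits S U L) :
    Splits S U L' := by
  induction hp generalizing U with
  | nil => exact h
  | cons s _ ih =>
    obtain ⟨v, hv, hg, hm, h'⟩ := h
    exact ⟨v, hv, hg, hm, ih h'⟩
  | swap s t L =>
    obtain ⟨v, hv, hg, hm, w, hw, hg', hm', h'⟩ := h
    refine ⟨w, fun i => (mem_perp.mp (hw i)).1, hg', hm', v, fun i => mem_perp.mpr ⟨hv i,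
      fun j => ?_⟩, hg, hm, perp_comm v w ▸ h'⟩
    rw [s22_comm]
    exact (mem_perp.mp (hw j)).2 i
  | trans _ _ ih1 ih2 => exact ih2 (ih1 h)

theorem Splits.exists_family {L : List Summand} (h : Splits S U L) :
    ∃ w : (i : Fin L.length) → Fin (L.get i).dim → R22, (∀ i a, w i a ∈ U) ∧
      (∀ i a b, s22 (w i a) (w i b) = (L.get i).gram a b) ∧
      (∀ i, HasMatrix S (w i) (L.get i).mat) ∧
      ∀ i j, i ≠ j → ∀ a b, s22 (w i a) (w j b) = 0 := by
  induction L generalizing U with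
  | nil => exact ⟨fun i => i.elim0, fun i => i.elim0, fun i => i.elim0, fun i => i.elim0,
      fun i => i.elim0⟩
  | cons s L ih =>
    obtain ⟨v, hv, hg, hm, h'⟩ := h
    obtain ⟨w, hw, hgw, hmw, ho⟩ := ih h'
    refine ⟨Fin.cons (α := fun i => Fin ((s :: L).get i).dim → R22) v w, ?_, ?_, ?_, ?_⟩
    · exact Fin.cases hv fun i a => (mem_perp.mp (hw i a)).1
    · exact Fin.cases hg hgw
    · exact Fin.cases hm hmw
    · refine Fin.cases (Fin.cases (fun h => absurd rfl h) fun j _ a b => ?_)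
        fun i => Fin.cases (fun _ a b => ?_) fun j hij a b => ?_
      · exact (mem_perp.mp (hw j b)).2 a
      · exact (s22_comm _ _).trans ((mem_perp.mp (hw i a)).2 b)
      · exact ho i j (fun h => hij (congrArg Fin.succ h)) a b

theorem Splits.exists_isAdapted {D : NForm} (h : Splits S U D.summands) :
    ∃ v, IsAdapted S D v := by
  obtain ⟨w, _, hg, hm, ho⟩ := h.exists_family
  exact exists_isAdapted_of_family hg hm ho

theorem Splits.finrank_le {L : List Summand} (h : Splits S U L) :
    Module.finrank ℝ U ≤ (L.map Summand.dim).sum := by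
  induction L generalizing U with
  | nil =>
    obtain rfl : U = ⊥ := h
    simp
  | cons s L ih =>
    obtain ⟨v, hv, hg, hm, h'⟩ := h
    have hle : U ≤ Submodule.span ℝ (Set.range v) ⊔ perp U v := fun x hx => by
      obtain ⟨p, hp, hxp⟩ := exists_sub_mem_perp hv hg s.gram_mul_self hx
      exact Submodule.mem_sup.mpr ⟨p, hp, x - p, hxp, by abel⟩
    have h1 := Submodule.finrank_mono hle
    have h2 := Submodule.finrank_add_le_finrank_add_finrank (Submodule.span ℝ (Set.range v))
      (perp U v)
    have h3 := finrank_range_le_card (R := ℝ) v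
    rw [Set.finrank, Fintype.card_fin] at h3
    have h4 := ih h'
    simp only [List.map_cons, List.sum_cons]
    omega

/-- `ε s` is positive definite on `W`. -/
def IsDefinite (e : ℤˣ) (W : Submodule ℝ R22) : Prop :=
  ∀ x ∈ W, x ≠ 0 → 0 < sg e * s22 x x

theorem IsDefinite.finrank_le {e : ℤˣ} {W : Submodule ℝ R22} (h : IsDefinite e W) :
    Module.finrank ℝ W ≤ 2 := by
  -- The projection of `W` to the coordinates of sign `ε` is injective.
  let f : Fin 2 → Fin 4 := if e = 1 then ![0, 1] else ![2, 3]
  have hinj : Function.Injective ((LinearMap.funLeft ℝ ℝ f).domRestrict W) := by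
    rw [← LinearMap.ker_eq_bot, LinearMap.ker_eq_bot']
    intro x hx
    by_contra hne
    have h1 := h x x.2 fun h0 => hne (Subtype.ext h0)
    have h2 := congrFun hx 0
    have h3 := congrFun hx 1
    rcases Int.units_eq_one_or e with rfl | rfl <;>
      simp [LinearMap.funLeft_apply, f] at h2 h3 <;>
      simp [s22_apply, sg, h2, h3] at h1 <;> nlinarith [mul_self_nonneg (x.1 0),
        mul_self_nonneg (x.1 1), mul_self_nonneg (x.1 2), mul_self_nonneg (x.1 3)]
  simpa using LinearMap.finrank_le_finrank_of_injective hinj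

theorem isDefinite_span {n : ℕ} {u : Fin n → R22} {e : ℤˣ}
    (h : ∀ i j, s22 (u i) (u j) = if i = j then sg e else 0) :
    IsDefinite e (Submodule.span ℝ (Set.range u)) ∧
      Module.finrank ℝ (Submodule.span ℝ (Set.range u)) = n := by
  have hli : LinearIndependent ℝ u := linearIndependent_of_gram s22
    (G := Matrix.diagonal fun _ => sg e) (G' := Matrix.diagonal fun _ => sg e)
    (by simpa [Matrix.diagonal_apply] using h) (by simp [sg_mul_self])
  refine ⟨fun x hx hne => ?_, by rw [finrank_span_eq_card hli, Fintype.card_fin]⟩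
  obtain ⟨c, rfl⟩ := (Submodule.mem_span_range_iff_exists_fun ℝ).mp hx
  have h1 : sg e * s22 (∑ i, c i • u i) (∑ i, c i • u i) = ∑ i, c i * c i := by
    simp only [map_sum, LinearMap.sum_apply, map_smul, LinearMap.smul_apply, h, smul_eq_mul,
      mul_ite, mul_zero, Finset.sum_ite_eq', Finset.mem_univ, if_true,
      Finset.mul_sum]
    exact Finset.sum_congr rfl fun i _ => by linear_combination c i * c i * sg_mul_self e
  rw [h1]
  refine lt_of_le_of_ne (Finset.sum_nonneg fun i _ => mul_self_nonneg _) fun h0 => hne ?_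
  have h2 := (Finset.sum_eq_zero_iff_of_nonneg fun i _ => mul_self_nonneg (c i)).mp h0.symm
  exact Finset.sum_eq_zero fun i hi => by simp [mul_self_eq_zero.mp (h2 i hi)]

/-- The part of the signature of a summand that belongs to the sign `ε`. -/
def Summand.sigOf (e : ℤˣ) (s : Summand) : ℕ := if e = 1 then s.sig.1 else s.sig.2

theorem IsFrame.exists_isDefinite {p q : ℕ} {v : Fin (p + q) → R22}
    (h : IsFrame U v (psiGram p q)) (e : ℤˣ) :
    ∃ W ≤ U, IsDefinite e W ∧ Module.finrank ℝ W = if e = 1 then p else q := by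
  have hle {n : ℕ} (f : Fin n → Fin (p + q)) :
      Submodule.span ℝ (Set.range fun i => v (f i)) ≤ U := by
    rw [← h.span_eq, Submodule.span_le]
    rintro _ ⟨i, rfl⟩
    exact Submodule.subset_span ⟨_, rfl⟩
  rcases Int.units_eq_one_or e with rfl | rfl
  · obtain ⟨h1, h2⟩ := isDefinite_span (e := 1) (u := fun i => v (Fin.castAdd q i)) fun i j => by
      rw [h.gram, psiGram, Matrix.diagonal_apply]
      simp [sg, Fin.ext_iff]
    exact ⟨_, hle _, h1, by simpa using h2⟩
  · obtain ⟨h1, h2⟩ := isDefinite_span (e := -1) (u := fun i => v (Fin.natAdd p i)) fun i j => by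
      rw [h.gram, psiGram, Matrix.diagonal_apply]
      simp [sg, Fin.ext_iff]
    exact ⟨_, hle _, h1, by simpa using h2⟩

theorem Summand.Good.exists_mem {s : Summand} (hs : s.Good) : ∃ D : NForm, s ∈ D.summands := by
  cases s with
  | real n e c =>
    obtain ⟨h1, h4⟩ := hs
    interval_cases n
    · rcases Int.units_eq_one_or e with rfl | rfl
      exacts [⟨.IX c c c c, by simp [NForm.summands]⟩, ⟨.IX c c c c, by simp [NForm.summands]⟩]
    · exact ⟨.VII e e c c, by simp [NForm.summands]⟩
    · rcases Int.units_eq_one_or e with rfl | rfl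
      exacts [⟨.IIIb c c, by simp [NForm.summands]⟩, ⟨.IIIa c c, by simp [NForm.summands]⟩]
    · exact ⟨.I e c, by simp [NForm.summands]⟩
  | cplx m a b =>
    rcases hs.1 with rfl | rfl
    exacts [⟨.VIII a b a b, by simp [NForm.summands]⟩, ⟨.II a b, by simp [NForm.summands]⟩]

theorem Splits.exists_isDefinite {L : List Summand} (hL : ∀ s ∈ L, s.Good) (h : Splits S U L)
    (e : ℤˣ) : ∃ W ≤ U, IsDefinite e W ∧
      Module.finrank ℝ W = (L.map (Summand.sigOf e)).sum := by
  induction L generalizing U with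
  | nil => exact ⟨⊥, bot_le, fun x hx h0 => absurd hx h0, by simp⟩
  | cons s L ih =>
    obtain ⟨v, hv, hg, hm, h'⟩ := h
    obtain ⟨W', hW', hd', hf'⟩ := ih (fun t ht => hL t (List.mem_cons_of_mem _ ht)) h'
    obtain ⟨D, hD⟩ := (hL s List.mem_cons_self).exists_mem
    have hfit : Fits S (Submodule.span ℝ (Set.range v)) s v :=
      ⟨⟨linearIndependent_of_gram s22 hg s.gram_mul_self, rfl, hg⟩, hm⟩
    obtain ⟨v', hv'⟩ := hfit.exists_psi hD
    obtain ⟨W, hW, hd, hf⟩ := hv'.exists_isDefinite e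
    have horth : ∀ x ∈ W, ∀ y ∈ W', s22 x y = 0 := by
      intro x hx y hy
      obtain ⟨c, rfl⟩ := (Submodule.mem_span_range_iff_exists_fun ℝ).mp (hW hx)
      simp [(mem_perp.mp (hW' hy)).2]
    have hdisj : W ⊓ W' = ⊥ := by
      rw [Submodule.eq_bot_iff]
      rintro x ⟨hx, hx'⟩
      by_contra hne
      have := hd x hx hne
      rw [horth x hx x hx', mul_zero] at this
      exact lt_irrefl _ this
    refine ⟨W ⊔ W', sup_le (hW.trans ?_) (hW'.trans inf_le_left), ?_, ?_⟩
    · rw [Submodule.span_le]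
      rintro _ ⟨i, rfl⟩
      exact hv i
    · intro z hz hne
      obtain ⟨x, hx, y, hy, rfl⟩ := Submodule.mem_sup.mp hz
      have hexp : sg e * s22 (x + y) (x + y) = sg e * s22 x x + sg e * s22 y y := by
        simp only [map_add, LinearMap.add_apply, horth x hx y hy, s22_comm y x]
        ring
      have hnn (W : Submodule ℝ R22) (hW : IsDefinite e W) (x : R22) (hx : x ∈ W) :
          0 ≤ sg e * s22 x x := by
        by_cases h0 : x = 0
        · simp [h0]
        · exact (hW x hx h0).le
      rw [hexp]
      by_cases h0 : x = 0
      · subst h0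
        rw [zero_add] at hne
        exact add_pos_of_nonneg_of_pos (hnn W hd _ hx) (hd' y hy hne)
      · exact add_pos_of_pos_of_nonneg (hd x hx h0) (hnn W' hd' _ hy)
    · have := Submodule.finrank_sup_add_finrank_inf_eq W W'
      rw [hdisj, finrank_bot, add_zero] at this
      rw [this, hf, hf', List.map_cons, List.sum_cons]
      rfl

theorem Summand.sigOf_add (s : Summand) : s.sigOf 1 + s.sigOf (-1) = s.dim := by
  cases s with
  | real n e c =>
    simp only [sigOf, sig, dim]
    rcases Int.units_eq_one_or e with rfl | rfl <;> simp <;> omega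
  | cplx m a b => simp [sigOf, sig, dim, two_mul]

/-- The position of a summand in the normal forms: positive odd blocks come first and negative odd
blocks last. -/
def Summand.key : Summand → ℕ
  | .real n e _ => if n % 2 = 0 then 1 else if e = 1 then 0 else 3
  | .cplx _ _ _ => 2

theorem Summand.Good.cases {s : Summand} (hs : s.Good) :
    (∃ c, s = .real 1 1 c ∧ s.sigOf 1 = 1 ∧ s.sigOf (-1) = 0 ∧ s.key = 0) ∨
    (∃ c, s = .real 1 (-1) c ∧ s.sigOf 1 = 0 ∧ s.sigOf (-1) = 1 ∧ s.key = 3) ∨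
    (∃ e c, s = .real 2 e c ∧ s.sigOf 1 = 1 ∧ s.sigOf (-1) = 1 ∧ s.key = 1) ∨
    (∃ a b, s = .cplx 1 a b ∧ b ≠ 0 ∧ s.sigOf 1 = 1 ∧ s.sigOf (-1) = 1 ∧ s.key = 2) ∨
    (∃ c, s = .real 3 1 c ∧ s.sigOf 1 = 2 ∧ s.sigOf (-1) = 1 ∧ s.key = 0) ∨
    (∃ c, s = .real 3 (-1) c ∧ s.sigOf 1 = 1 ∧ s.sigOf (-1) = 2 ∧ s.key = 3) ∨
    (∃ e c, s = .real 4 e c ∧ s.sigOf 1 = 2 ∧ s.sigOf (-1) = 2) ∨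
    (∃ a b, s = .cplx 2 a b ∧ b ≠ 0 ∧ s.sigOf 1 = 2 ∧ s.sigOf (-1) = 2) := by
  cases s with
  | real n e c =>
    obtain ⟨h1, h4⟩ := hs
    interval_cases n <;> rcases Int.units_eq_one_or e with rfl | rfl <;>
      simp [sigOf, sig, key]
  | cplx m a b =>
    obtain ⟨rfl | rfl, hb⟩ := hs <;> simp [sigOf, sig, key, hb]

/-- A sorted list of summands of total signature `(2, 2)` is one of the ten normal forms. -/
theorem exists_normalForm {L : List Summand} (hL : ∀ s ∈ L, s.Good)
    (hsort : L.Pairwise fun s t => s.key ≤ t.key) (hp : (L.map (Summand.sigOf 1)).sum = 2)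
    (hq : (L.map (Summand.sigOf (-1))).sum = 2) : ∃ D : NForm, D.Admissible ∧ D.summands = L := by
  have hpos {s : Summand} (hs : s.Good) : 1 ≤ s.sigOf 1 + s.sigOf (-1) := by
    rcases hs.cases with ⟨_, _, h⟩ | ⟨_, _, h⟩ | ⟨_, _, _, h⟩ | ⟨_, _, _, _, h⟩ | ⟨_, _, h⟩ |
      ⟨_, _, h⟩ | ⟨_, _, _, h⟩ | ⟨_, _, _, _, h⟩ <;> omega
  have hlen : L.length ≤ 4 := by
    have : L.length ≤ (L.map (Summand.sigOf 1)).sum + (L.map (Summand.sigOf (-1))).sum := by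
      clear hp hq hsort
      induction L with
      | nil => simp
      | cons s L ih =>
        have h1 := hpos (hL s List.mem_cons_self)
        have h2 := ih fun t ht => hL t (List.mem_cons_of_mem _ ht)
        simp only [List.length_cons, List.map_cons, List.sum_cons]
        omega
    omega
  rcases L with _ | ⟨s, _ | ⟨t, _ | ⟨u, _ | ⟨w, _ | ⟨x, L⟩⟩⟩⟩⟩
  · simp at hp
  · simp only [List.map_cons, List.map_nil, List.sum_cons, List.sum_nil] at hp hq
    rcases (hL s (by simp)).cases with ⟨_, rfl, h⟩ | ⟨_, rfl, h⟩ | ⟨_, _, rfl, h⟩ |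
      ⟨_, _, rfl, _, h⟩ | ⟨_, rfl, h⟩ | ⟨_, rfl, h⟩ | ⟨e, c, rfl, h⟩ | ⟨a, b, rfl, hb, h⟩ <;>
      try omega
    · exact ⟨.I e c, trivial, rfl⟩
    · exact ⟨.II a b, hb, rfl⟩
  · simp only [List.map_cons, List.map_nil, List.sum_cons, List.sum_nil, List.pairwise_cons,
      List.mem_cons, List.not_mem_nil, or_false, forall_eq] at hp hq hsort
    rcases (hL s (by simp)).cases with ⟨c, rfl, h⟩ | ⟨c, rfl, h⟩ | ⟨e, c, rfl, h⟩ |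
      ⟨a, b, rfl, hb, h⟩ | ⟨c, rfl, h⟩ | ⟨c, rfl, h⟩ | ⟨_, _, rfl, h⟩ | ⟨_, _, rfl, _, h⟩ <;>
      rcases (hL t (by simp)).cases with ⟨c', rfl, h'⟩ | ⟨c', rfl, h'⟩ | ⟨e', c', rfl, h'⟩ |
        ⟨a', b', rfl, hb', h'⟩ | ⟨c', rfl, h'⟩ | ⟨c', rfl, h'⟩ | ⟨_, _, rfl, h'⟩ |
        ⟨_, _, rfl, _, h'⟩ <;>
      try omega
    · exact ⟨.IIIa c c', trivial, rfl⟩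
    · exact ⟨.VII e e' c c', trivial, rfl⟩
    · exact ⟨.VI e c a' b', hb', rfl⟩
    · exact ⟨.VIII a b a' b', ⟨hb, hb'⟩, rfl⟩
    · exact ⟨.IIIb c c', trivial, rfl⟩
  · simp only [List.map_cons, List.map_nil, List.sum_cons, List.sum_nil, List.pairwise_cons,
      List.mem_cons, List.not_mem_nil, or_false, forall_eq, forall_eq_or_imp] at hp hq hsort
    have hs := hpos (hL s (by simp))
    have ht := hpos (hL t (by simp))
    have hu := hpos (hL u (by simp))
    rcases (hL s (by simp)).cases with ⟨c, rfl, h⟩ | ⟨c, rfl, h⟩ | ⟨e, c, rfl, h⟩ |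
      ⟨a, b, rfl, hb, h⟩ | ⟨c, rfl, h⟩ | ⟨c, rfl, h⟩ | ⟨_, _, rfl, h⟩ | ⟨_, _, rfl, _, h⟩ <;>
      try omega
    all_goals
      rcases (hL u (by simp)).cases with ⟨c'', rfl, h''⟩ | ⟨c'', rfl, h''⟩ | ⟨e'', c'', rfl, h''⟩ |
        ⟨a'', b'', rfl, hb'', h''⟩ | ⟨c'', rfl, h''⟩ | ⟨c'', rfl, h''⟩ | ⟨_, _, rfl, h''⟩ |
        ⟨_, _, rfl, _, h''⟩ <;>
      try omega
    all_goals
      rcases (hL t (by simp)).cases with ⟨c', rfl, h'⟩ | ⟨c', rfl, h'⟩ | ⟨e', c', rfl, h'⟩ |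
        ⟨a', b', rfl, hb', h'⟩ | ⟨c', rfl, h'⟩ | ⟨c', rfl, h'⟩ | ⟨_, _, rfl, h'⟩ |
        ⟨_, _, rfl, _, h'⟩ <;>
      try omega
    · exact ⟨.IV e' c c' c'', trivial, rfl⟩
    · exact ⟨.V c a' b' c'', hb', rfl⟩
  · simp only [List.map_cons, List.map_nil, List.sum_cons, List.sum_nil, List.pairwise_cons,
      List.mem_cons, List.not_mem_nil, or_false, forall_eq, forall_eq_or_imp] at hp hq hsort
    have hs := hpos (hL s (by simp))
    have ht := hpos (hL t (by simp))
    have hu := hpos (hL u (by simp))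
    have hw := hpos (hL w (by simp))
    rcases (hL s (by simp)).cases with ⟨c, rfl, h⟩ | ⟨c, rfl, h⟩ | ⟨e, c, rfl, h⟩ |
      ⟨a, b, rfl, hb, h⟩ | ⟨c, rfl, h⟩ | ⟨c, rfl, h⟩ | ⟨_, _, rfl, h⟩ | ⟨_, _, rfl, _, h⟩ <;>
      try omega
    all_goals
      rcases (hL t (by simp)).cases with ⟨c', rfl, h'⟩ | ⟨c', rfl, h'⟩ | ⟨e', c', rfl, h'⟩ |
        ⟨a', b', rfl, hb', h'⟩ | ⟨c', rfl, h'⟩ | ⟨c', rfl, h'⟩ | ⟨_, _, rfl, h'⟩ |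
        ⟨_, _, rfl, _, h'⟩ <;>
      try omega
    all_goals
      rcases (hL u (by simp)).cases with ⟨c'', rfl, h''⟩ | ⟨c'', rfl, h''⟩ | ⟨e'', c'', rfl, h''⟩ |
        ⟨a'', b'', rfl, hb'', h''⟩ | ⟨c'', rfl, h''⟩ | ⟨c'', rfl, h''⟩ | ⟨_, _, rfl, h''⟩ |
        ⟨_, _, rfl, _, h''⟩ <;>
      try omega
    all_goals
      rcases (hL w (by simp)).cases with ⟨d, rfl, k⟩ | ⟨d, rfl, k⟩ | ⟨_, d, rfl, k⟩ |
        ⟨_, _, rfl, _, k⟩ | ⟨d, rfl, k⟩ | ⟨d, rfl, k⟩ | ⟨_, _, rfl, k⟩ | ⟨_, _, rfl, _, k⟩ <;>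
      try omega
    exact ⟨.IX c c' c'' d, trivial, rfl⟩
  · simp only [List.length_cons] at hlen
    omega

theorem exists_form (hS : LinearMap.IsSelfAdjoint s22 S) :
    ∃ D : NForm, D.Admissible ∧ HasForm S D := by
  have htop : IsNondegInv S ⊤ := by
    refine ⟨fun x _ h => ?_, fun _ _ => trivial⟩
    have h' (i : Fin 4) := h (Pi.single i 1) trivial
    funext i
    have := h' i
    rw [s22_apply] at this
    fin_cases i <;> simpa using this
  obtain ⟨L₀, hL₀, hsp₀⟩ := exists_splits hS htop
  let r : Summand → Summand → Prop := fun s t => s.key ≤ t.key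
  have : DecidableRel r := fun s t => inferInstanceAs (Decidable (s.key ≤ t.key))
  have : Std.Total r := ⟨fun s t => le_total s.key t.key⟩
  have : IsTrans Summand r := ⟨fun _ _ _ h h' => le_trans h h'⟩
  have hperm := List.perm_insertionSort r L₀
  set L := L₀.insertionSort r
  have hL : ∀ s ∈ L, s.Good := fun s hs => hL₀ s (hperm.mem_iff.mp hs)
  have hsp := hsp₀.perm hperm.symm
  obtain ⟨W₁, _, hd₁, hf₁⟩ := hsp.exists_isDefinite hL 1
  obtain ⟨W₂, _, hd₂, hf₂⟩ := hsp.exists_isDefinite hL (-1)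
  have h1 := hd₁.finrank_le
  have h2 := hd₂.finrank_le
  have h3 := hsp.finrank_le
  have h4 : (L.map Summand.dim).sum =
      (L.map (Summand.sigOf 1)).sum + (L.map (Summand.sigOf (-1))).sum := by
    rw [← List.sum_map_add]
    simp only [Summand.sigOf_add]
  rw [finrank_top, Module.finrank_fin_fun] at h3
  obtain ⟨D, hD, hDL⟩ := exists_normalForm hL (List.pairwise_insertionSort r L₀)
    (by omega) (by omega)
  exact ⟨D, hD, (hasForm_iff_adapted S D).mpr (hDL ▸ hsp).exists_isAdapted⟩

end Existence

/-! ### Multiplicities from the Jordan canonical form -/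

theorem sum_get_eq {α : Type*} (L : List α) (f : α → ℕ) :
    ∑ i : Fin L.length, f (L.get i) = (L.map f).sum :=
  Fin.sum_univ_fun_getElem L f

open Classical in
theorem algMult_eq_sum (L : List JBlock) (z : ℂ) :
    algMult L z = ∑ i : Fin L.length, if (L.get i).eig = z then (L.get i).size else 0 := by
  rw [sum_get_eq L fun B => if B.eig = z then B.size else 0, algMult]
  induction L with
  | nil => rfl
  | cons B L ih =>
    by_cases h : B.eig = z <;> simp [h, ih]

open Classical in
theorem geoMult_eq_card (L : List JBlock) (z : ℂ) :
    geoMult L z = Fintype.card {i : Fin L.length // (L.get i).eig = z} := by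
  rw [Fintype.card_subtype, Finset.card_filter,
    sum_get_eq L fun B => if B.eig = z then 1 else 0, geoMult]
  induction L with
  | nil => rfl
  | cons B L ih =>
    by_cases h : B.eig = z <;> simp [h, ih, add_comm]

open Classical in
theorem rootMultiplicity_prod_X_sub_C {ι : Type*} [Fintype ι] (d : ι → ℂ) (z : ℂ) :
    (∏ i, (Polynomial.X - Polynomial.C (d i))).rootMultiplicity z =
      ∑ i, if d i = z then 1 else 0 := by
  rw [← Polynomial.count_roots, Polynomial.roots_prod _ _
    (Finset.prod_ne_zero_iff.mpr fun i _ => Polynomial.X_sub_C_ne_zero _)]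
  simp only [Polynomial.roots_X_sub_C, Multiset.bind_singleton, Multiset.count_map]
  rw [← Finset.card_filter]
  simp only [eq_comm (a := z)]
  rfl

section JordanForm

variable {T : Module.End ℂ C22} {L : List JBlock}

/-- The Jordan matrix is upper triangular for the lexicographic order, so its characteristic
polynomial is the product over its diagonal. -/
theorem HasJCF.rootMultiplicity (h : HasJCF T L) (z : ℂ) :
    T.charpoly.rootMultiplicity z = algMult L z := by
  classical
  obtain ⟨b, hb⟩ := h
  have hup : ((Matrix.reindex toLex toLex) (LinearMap.toMatrix b b T)).IsUpperTriangular := by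
    intro q p hpq
    change toLex (ofLex p) < toLex (ofLex q) at hpq
    rw [Matrix.reindex_apply, Matrix.submatrix_apply, hb]
    change Matrix.blockDiagonal' _ (ofLex q) (ofLex p) = 0
    generalize ofLex p = p at hpq
    generalize ofLex q = q at hpq
    obtain ⟨i, a⟩ := p
    obtain ⟨j, c⟩ := q
    rcases Sigma.Lex.lt_def.mp hpq with h | ⟨h, h'⟩
    · exact Matrix.blockDiagonal'_apply_ne _ _ _ (ne_of_gt h)
    · change i = j at h
      subst h
      rw [Matrix.blockDiagonal'_apply_eq]
      have h2 : a.val < c.val := h'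
      simp only [jordanBlock, Matrix.of_apply]
      rw [if_neg (fun h => by rw [h] at h2; exact lt_irrefl _ h2), if_neg (by omega)]
  rw [← LinearMap.charpoly_toMatrix T b, ← Matrix.charpoly_reindex toLex,
    Matrix.charpoly_of_isUpperTriangular _ hup, rootMultiplicity_prod_X_sub_C,
    ← Equiv.sum_comp toLex, Fintype.sum_sigma, algMult_eq_sum]
  refine Finset.sum_congr rfl fun i _ => ?_
  have hd (a : Fin (L.get i).size) : (Matrix.reindex toLex toLex) (LinearMap.toMatrix b b T)
      (toLex ⟨i, a⟩) (toLex ⟨i, a⟩) = (L.get i).eig := by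
    rw [Matrix.reindex_apply, Matrix.submatrix_apply, Equiv.symm_apply_apply, hb,
      Matrix.blockDiagonal'_apply_eq]
    simp [jordanBlock]
  simp only [hd]
  split_ifs <;> simp

theorem sum_jordanBlock_mul {n : ℕ} (c : ℂ) (x : Fin n → ℂ) (i : Fin n) :
    ∑ j, jordanBlock n c i j * x j =
      c * x i + if h : i.val + 1 < n then x ⟨i.val + 1, h⟩ else 0 := by
  have h (j : Fin n) : jordanBlock n c i j * x j =
      (if i = j then c * x j else 0) + if i.val + 1 = j.val then x j else 0 := by
    simp only [jordanBlock, Matrix.of_apply]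
    split_ifs with h1 h2 <;> simp
    exact absurd h2 (by rw [h1]; omega)
  simp only [h, Finset.sum_add_distrib, Finset.sum_ite_eq, Finset.mem_univ, if_true]
  congr 1
  split_ifs with h0
  · rw [Finset.sum_eq_single ⟨i.val + 1, h0⟩]
    · simp
    · intro j _ hj
      rw [if_neg]
      intro h
      exact hj (Fin.ext h.symm)
    · simp
  · exact Finset.sum_eq_zero fun j _ => if_neg (by omega)

/-- The eigenspace for `z` is spanned by the first vectors of the Jordan chains that belong to
`z`. -/
theorem HasJCF.finrank_eigenspace (h : HasJCF T L) (hL : ∀ B ∈ L, 0 < B.size) (z : ℂ) :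
    Module.finrank ℂ (Module.End.eigenspace T z) = geoMult L z := by
  classical
  obtain ⟨b, hb⟩ := h
  have hpos (i : Fin L.length) : 0 < (L.get i).size := hL _ (List.get_mem _ _)
  let f : {i : Fin L.length // (L.get i).eig = z} → Σ i : Fin L.length, Fin (L.get i).size :=
    fun i => ⟨i.1, ⟨0, hpos i.1⟩⟩
  have hf : Function.Injective f := fun i j hij => Subtype.ext (congrArg Sigma.fst hij)
  have hrepr (x : C22) (i : Fin L.length) (a : Fin (L.get i).size) :
      b.repr (T x) ⟨i, a⟩ = (L.get i).eig * b.repr x ⟨i, a⟩ +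
        if h : a.val + 1 < (L.get i).size then b.repr x ⟨i, ⟨a.val + 1, h⟩⟩ else 0 := by
    rw [← LinearMap.toMatrix_mulVec_repr b b, hb, Matrix.mulVec, dotProduct, Fintype.sum_sigma,
      Finset.sum_eq_single i]
    · simp only [Matrix.blockDiagonal'_apply_eq]
      exact sum_jordanBlock_mul _ (fun a => b.repr x ⟨i, a⟩) a
    · intro j _ hj
      exact Finset.sum_eq_zero fun c _ => by
        rw [Matrix.blockDiagonal'_apply_ne _ _ _ hj.symm, zero_mul]
    · simp
  have hspan : Module.End.eigenspace T z = Submodule.span ℂ (Set.range (b ∘ f)) := by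
    refine le_antisymm (fun x hx => ?_) (Submodule.span_le.mpr ?_)
    · rw [Module.End.mem_eigenspace_iff] at hx
      have hcoord (i : Fin L.length) (a : Fin (L.get i).size) :
          ((L.get i).eig - z) * b.repr x ⟨i, a⟩ +
            (if h : a.val + 1 < (L.get i).size then b.repr x ⟨i, ⟨a.val + 1, h⟩⟩ else 0) = 0 := by
        have := hrepr x i a
        rw [hx, map_smul, Finsupp.smul_apply, smul_eq_mul] at this
        linear_combination -this
      have hzero (i : Fin L.length) (a : Fin (L.get i).size)
          (h : ¬ ((L.get i).eig = z ∧ a.val = 0)) : b.repr x ⟨i, a⟩ = 0 := by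
        by_cases hi : (L.get i).eig = z
        · have h0 : 0 < a.val := Nat.pos_of_ne_zero fun h1 => h ⟨hi, h1⟩
          have := hcoord i ⟨a.val - 1, by omega⟩
          rw [hi, sub_self, zero_mul, zero_add, dif_pos (by simp only; omega)] at this
          rw [← this]
          congr 2
          exact Fin.ext (by simp only; omega)
        · -- Descend from the last vector of the chain.
          have key (k : ℕ) (a : Fin (L.get i).size) (hk : (L.get i).size - a.val = k) :
              b.repr x ⟨i, a⟩ = 0 := by
            induction k generalizing a with
            | zero => omega
            | succ k ih =>
              have := hcoord i a
              have h1 : (if h : a.val + 1 < (L.get i).size then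
                  b.repr x ⟨i, ⟨a.val + 1, h⟩⟩ else 0) = 0 := by
                split_ifs
                · exact ih _ (by simp only; omega)
                · rfl
              rw [h1, add_zero] at this
              exact (mul_eq_zero.mp this).resolve_left (sub_ne_zero.mpr hi)
          exact key _ a rfl
      rw [← b.sum_repr x]
      refine Submodule.sum_mem _ fun p _ => ?_
      obtain ⟨i, a⟩ := p
      by_cases h : (L.get i).eig = z ∧ a.val = 0
      · refine Submodule.smul_mem _ _ (Submodule.subset_span ⟨⟨i, h.1⟩, ?_⟩)
        simp only [Function.comp, f]
        congr 2
        exact Fin.ext h.2.symm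
      · rw [hzero i a h, zero_smul]
        exact Submodule.zero_mem _
    · rintro _ ⟨⟨i, hi⟩, rfl⟩
      rw [SetLike.mem_coe, Module.End.mem_eigenspace_iff]
      apply b.repr.injective
      ext ⟨j, a⟩
      rw [hrepr, map_smul, Finsupp.smul_apply, smul_eq_mul]
      simp only [Function.comp, f, Module.Basis.repr_self, Finsupp.single_apply]
      by_cases hij : i = j
      · subst hij
        rw [hi]
        simp [Fin.ext_iff]
      · have h1 (c : Fin (L.get j).size) :
            ((⟨i, ⟨0, hpos i⟩⟩ : Σ i : Fin L.length, Fin (L.get i).size) = ⟨j, c⟩) ↔ False :=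
          ⟨fun h => hij (congrArg Sigma.fst h), False.elim⟩
        simp [h1]
  rw [hspan, finrank_span_eq_card (b.linearIndependent.comp f hf), geoMult_eq_card]

end JordanForm

/-! ### Real multiplicities -/

theorem charpoly_cplxEnd (S : Module.End ℝ R22) :
    (cplxEnd S).charpoly = S.charpoly.map (algebraMap ℝ ℂ) := by
  rw [cplxEnd, Matrix.charpoly_toLin', Matrix.charpoly_map]
  exact congrArg _ (LinearMap.charpoly_toMatrix S (Pi.basisFun ℝ (Fin 4)))

theorem rootMultiplicity_real (S : Module.End ℝ R22) (x : ℝ) :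
    S.charpoly.rootMultiplicity x = (cplxEnd S).charpoly.rootMultiplicity (x : ℂ) := by
  rw [charpoly_cplxEnd]
  exact Polynomial.eq_rootMultiplicity_map (algebraMap ℝ ℂ).injective x

theorem finrank_cplxOf (U : Submodule ℝ R22) :
    Module.finrank ℂ (cplxOf U) = Module.finrank ℝ U := by
  let e : cplxOf U ≃ₗ[ℝ] U × U :=
    { toFun := fun z => (⟨reVec z, z.2.1⟩, ⟨imVec z, z.2.2⟩)
      invFun := fun p => ⟨cpair p.1 p.2, cpair_mem_cplxOf.mpr ⟨p.1.2, p.2.2⟩⟩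
      map_add' := fun _ _ => rfl
      map_smul' := fun c z => by
        refine Prod.ext (Subtype.ext (funext fun i => ?_)) (Subtype.ext (funext fun i => ?_)) <;>
          simp [reVec, imVec]
      left_inv := fun z => Subtype.ext (cpair_re_im _)
      right_inv := fun p => by simp }
  have h1 := e.finrank_eq
  rw [Module.finrank_prod, finrank_real_of_complex] at h1
  omega

theorem eigenspace_cplxEnd (S : Module.End ℝ R22) (x : ℝ) :
    Module.End.eigenspace (cplxEnd S) (x : ℂ) = cplxOf (Module.End.eigenspace S x) := by
  ext z
  rw [← cpair_re_im z, cpair_mem_cplxOf, Module.End.mem_eigenspace_iff,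
    Module.End.mem_eigenspace_iff, Module.End.mem_eigenspace_iff, cplxEnd_cpair,
    show (x : ℂ) = ⟨x, 0⟩ from rfl, smul_cpair]
  simp only [zero_smul, sub_zero, add_zero]
  exact ⟨cpair_injective, fun h => by rw [h.1, h.2]⟩

theorem finrank_eigenspace_real (S : Module.End ℝ R22) (x : ℝ) :
    Module.finrank ℝ (Module.End.eigenspace S x) =
      Module.finrank ℂ (Module.End.eigenspace (cplxEnd S) (x : ℂ)) := by
  rw [eigenspace_cplxEnd, finrank_cplxOf]

/-! ### Jordan canonical forms of the ten types -/

theorem toMatrix_eq_of_apply {ι : Type*} [Fintype ι] [DecidableEq ι]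
    {T : Module.End ℂ C22} (b : Module.Basis ι ℂ C22) (M : Matrix ι ι ℂ)
    (h : ∀ q, T (b q) = ∑ p, M p q • b p) : LinearMap.toMatrix b b T = M := by
  rw [← LinearMap.toMatrix_toLin b b M]
  congr 1
  refine b.ext fun q => ?_
  rw [h, Matrix.toLin_self]

/-- The vectors `W o, W (o + 1), …` form, in this order, Jordan chains for the blocks in a list. -/
def IsChainList (T : Module.End ℂ C22) (W : ℕ → C22) : ℕ → List JBlock → Prop
  | _, [] => True
  | o, B :: L => (∀ a : Fin B.size, T (W (o + a)) =
      B.eig • W (o + a) + if 0 < a.val then W (o + a - 1) else 0) ∧ IsChainList T W (o + B.size) L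

theorem IsChainList.apply {T : Module.End ℂ C22} {W : ℕ → C22} {L : List JBlock} {o : ℕ}
    (h : IsChainList T W o L) (i : Fin L.length) (a : Fin (L.get i).size) :
    T (W (o + ((L.take i).map JBlock.size).sum + a)) =
      (L.get i).eig • W (o + ((L.take i).map JBlock.size).sum + a) +
        if 0 < a.val then W (o + ((L.take i).map JBlock.size).sum + a - 1) else 0 := by
  induction L generalizing o with
  | nil => exact i.elim0
  | cons B L ih =>
    induction i using Fin.cases with
    | zero => exact h.1 a
    | succ i =>
      have := ih h.2 i a
      simp only [Fin.val_succ, List.take_succ_cons, List.map_cons, List.sum_cons, ← add_assoc]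
      exact this

theorem sum_take_map {α : Type*} (f : α → ℕ) (L : List α) (n : ℕ) (h : n ≤ L.length) :
    ∑ j : Fin n, f (L.get (Fin.castLE h j)) = ((L.take n).map f).sum := by
  induction L generalizing n with
  | nil =>
    obtain rfl : n = 0 := by simpa using h
    simp
  | cons B L ih =>
    cases n with
    | zero => simp
    | succ n =>
      rw [Fin.sum_univ_succ, List.take_succ_cons, List.map_cons, List.sum_cons,
        ← ih n (by simpa using h)]
      rfl

/-- Jordan chains that together form a basis give a Jordan canonical form. -/
theorem hasJCF_of_isChainList {T : Module.End ℂ C22} {L : List JBlock} {W : ℕ → C22}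
    (hW : LinearIndependent ℂ fun k : Fin 4 => W k)
    (h4 : ∑ i : Fin L.length, (L.get i).size = 4) (h : IsChainList T W 0 L) : HasJCF T L := by
  let e : (Σ i : Fin L.length, Fin (L.get i).size) ≃ Fin 4 := finSigmaFinEquiv.trans (finCongr h4)
  have he (i : Fin L.length) (a : Fin (L.get i).size) :
      (e ⟨i, a⟩ : ℕ) = ((L.take i).map JBlock.size).sum + a := by
    simp only [e]
    rw [Equiv.trans_apply, finCongr_apply, Fin.val_cast, finSigmaFinEquiv_apply]
    congr 1
    exact sum_take_map JBlock.size L i i.2.le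
  let b := (basisOfLinearIndependentOfCardEqFinrank hW (by simp)).reindex e.symm
  have hb (i : Fin L.length) (a : Fin (L.get i).size) :
      b ⟨i, a⟩ = W (((L.take i).map JBlock.size).sum + a) := by
    rw [← he]
    simp [b]
  refine ⟨b, toMatrix_eq_of_apply b _ ?_⟩
  rintro ⟨i, a⟩
  have h1 := h.apply i a
  rw [zero_add] at h1
  rw [hb, h1, Fintype.sum_sigma, Finset.sum_eq_single i]
  · simp only [Matrix.blockDiagonal'_apply_eq, hb]
    rw [sum_jordanBlock_smul]
    congr 1
    split_ifs with h0
    · congr 1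
      exact Nat.add_sub_assoc h0 _
    · rfl
  · intro j _ hj
    exact Finset.sum_eq_zero fun c _ => by rw [Matrix.blockDiagonal'_apply_ne _ _ _ hj, zero_smul]
  · simp

theorem HasMatrix.cplx {S : Module.End ℝ R22} {n : ℕ} {v : Fin n → R22}
    {A : Matrix (Fin n) (Fin n) ℝ} (h : HasMatrix S v A) :
    HasMatrix (cplxEnd S) (fun i => cvec (v i)) (A.map (algebraMap ℝ ℂ)) := by
  intro j
  have h1 : cplxEnd S (cvec (v j)) = cvec (S (v j)) := by
    rw [← cpair_zero_right, cplxEnd_cpair, map_zero, cpair_zero_right]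
  rw [h1, h j]
  funext k
  simp [cvec, Finset.sum_apply]

theorem gram_cvec {n : ℕ} {v : Fin n → R22} {G : Matrix (Fin n) (Fin n) ℝ}
    (h : ∀ i j, s22 (v i) (v j) = G i j) (i j : Fin n) :
    sC (cvec (v i)) (cvec (v j)) = G.map (algebraMap ℝ ℂ) i j := by
  rw [← cpair_zero_right, ← cpair_zero_right, sC_cpair, h]
  apply Complex.ext <;> simp

theorem linearIndependent_cvec {n : ℕ} {v : Fin n → R22} {G G' : Matrix (Fin n) (Fin n) ℝ}
    (h : ∀ i j, s22 (v i) (v j) = G i j) (hG : G' * G = 1) :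
    LinearIndependent ℂ fun i => cvec (v i) := by
  refine linearIndependent_of_gram sC (G := G.map (algebraMap ℝ ℂ))
    (G' := G'.map (algebraMap ℝ ℂ)) (gram_cvec h) ?_
  rw [← Matrix.map_mul, hG, Matrix.map_one _ (map_zero _) (map_one _)]

/-- The base change from an adapted basis to Jordan chains of the complexification: a pair `u, v`
that belongs to a block `K₁(a, b)` is replaced by `u + iv, u - iv`, and the basis `u₁, v₁, u₂, v₂`
of type II by `u₁ + iv₁, u₂ + iv₂, u₁ - iv₁, u₂ - iv₂`. -/
noncomputable def NForm.chainChange : NForm → Matrix (Fin 4) (Fin 4) ℂ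
  | .II _ _ => !![1, 0, 1, 0; Complex.I, 0, -Complex.I, 0; 0, 1, 0, 1; 0, Complex.I, 0, -Complex.I]
  | .V _ _ _ _ => !![1, 0, 0, 0; 0, 1, 1, 0; 0, Complex.I, -Complex.I, 0; 0, 0, 0, 1]
  | .VI _ _ _ _ => !![1, 0, 0, 0; 0, 1, 0, 0; 0, 0, 1, 1; 0, 0, Complex.I, -Complex.I]
  | .VIII _ _ _ _ => !![1, 1, 0, 0; Complex.I, -Complex.I, 0, 0; 0, 0, 1, 1;
      0, 0, Complex.I, -Complex.I]
  | _ => 1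

/-- The complex Jordan canonical form in the basis given by `chainChange`. -/
noncomputable def NForm.chainMat : NForm → Matrix (Fin 4) (Fin 4) ℂ
  | .II a b => !![⟨a, b⟩, 1, 0, 0; 0, ⟨a, b⟩, 0, 0; 0, 0, ⟨a, -b⟩, 1; 0, 0, 0, ⟨a, -b⟩]
  | .V l a b n => !![(l : ℂ), 0, 0, 0; 0, ⟨a, b⟩, 0, 0; 0, 0, ⟨a, -b⟩, 0; 0, 0, 0, (n : ℂ)]
  | .VI _ l a b => !![(l : ℂ), 1, 0, 0; 0, (l : ℂ), 0, 0; 0, 0, ⟨a, b⟩, 0; 0, 0, 0, ⟨a, -b⟩]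
  | .VIII a b c d => !![⟨a, b⟩, 0, 0, 0; 0, ⟨a, -b⟩, 0, 0; 0, 0, ⟨c, d⟩, 0; 0, 0, 0, ⟨c, -d⟩]
  | D => D.baseMat.map (algebraMap ℝ ℂ)

theorem chainChange_mat (D : NForm) :
    D.baseMat.map (algebraMap ℝ ℂ) * D.chainChange = D.chainChange * D.chainMat := by
  cases D
  case I | IIIa | IIIb | IV | VII | IX => simp [NForm.chainChange, NForm.chainMat]
  all_goals
    simp only [NForm.chainChange, NForm.chainMat, NForm.baseMat]
    ext i j
    fin_cases i <;> fin_cases j <;> apply Complex.ext <;>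
      simp [Matrix.mul_apply, Fin.sum_univ_four]

theorem chainChange_inverse (D : NForm) : ∃ Q, D.chainChange * Q = 1 := by
  have hI : Complex.I * Complex.I = -1 := Complex.I_mul_I
  cases D
  case I | IIIa | IIIb | IV | VII | IX => exact ⟨1, one_mul 1⟩
  case II => exact ⟨!![1 / 2, -Complex.I / 2, 0, 0; 0, 0, 1 / 2, -Complex.I / 2;
      1 / 2, Complex.I / 2, 0, 0; 0, 0, 1 / 2, Complex.I / 2], by
    simp only [NForm.chainChange]
    ext i j
    fin_cases i <;> fin_cases j <;> simp [Matrix.mul_apply, Fin.sum_univ_four] <;> grind⟩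
  case V => exact ⟨!![1, 0, 0, 0; 0, 1 / 2, -Complex.I / 2, 0; 0, 1 / 2, Complex.I / 2, 0;
      0, 0, 0, 1], by
    simp only [NForm.chainChange]
    ext i j
    fin_cases i <;> fin_cases j <;> simp [Matrix.mul_apply, Fin.sum_univ_four] <;> grind⟩
  case VI => exact ⟨!![1, 0, 0, 0; 0, 1, 0, 0; 0, 0, 1 / 2, -Complex.I / 2;
      0, 0, 1 / 2, Complex.I / 2], by
    simp only [NForm.chainChange]
    ext i j
    fin_cases i <;> fin_cases j <;> simp [Matrix.mul_apply, Fin.sum_univ_four] <;> grind⟩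
  case VIII => exact ⟨!![1 / 2, -Complex.I / 2, 0, 0; 1 / 2, Complex.I / 2, 0, 0;
      0, 0, 1 / 2, -Complex.I / 2; 0, 0, 1 / 2, Complex.I / 2], by
    simp only [NForm.chainChange]
    ext i j
    fin_cases i <;> fin_cases j <;> simp [Matrix.mul_apply, Fin.sum_univ_four] <;> grind⟩

theorem HasForm.exists_chainBasis {S : Module.End ℝ R22} {D : NForm} (h : HasForm S D) :
    ∃ W : ℕ → C22, (LinearIndependent ℂ fun k : Fin 4 => W k) ∧
      ∀ j : Fin 4, cplxEnd S (W j) = D.chainMat 0 j • W 0 + D.chainMat 1 j • W 1 +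
        D.chainMat 2 j • W 2 + D.chainMat 3 j • W 3 := by
  obtain ⟨v, hv⟩ := (hasForm_iff_adapted S D).mp h
  obtain ⟨Q, hQ⟩ := chainChange_inverse D
  have hli := linearIndependent_comb
    (linearIndependent_cvec hv.1.gram (baseGram_inverse D)) hQ
  have hm := hv.2.cplx.comb (chainChange_mat D)
  obtain ⟨W, hW⟩ : ∃ W : ℕ → C22, ∀ k : Fin 4, W k =
      comb (fun i => cvec (v i)) D.chainChange k :=
    ⟨fun k => comb (fun i => cvec (v i)) D.chainChange (Fin.ofNat 4 k), fun k => by simp⟩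
  rw [← funext hW] at hli hm
  exact ⟨W, hli, fun j => by simpa [Fin.sum_univ_four] using hm j⟩

theorem blocks_size_sum (D : NForm) : ∑ i : Fin D.blocks.length, (D.blocks.get i).size = 4 := by
  rw [sum_get_eq]
  cases D <;> rfl

theorem HasForm.hasJCF {S : Module.End ℝ R22} {D : NForm} (h : HasForm S D) :
    HasJCF (cplxEnd S) D.blocks := by
  obtain ⟨W, hW, hm⟩ := h.exists_chainBasis
  refine hasJCF_of_isChainList hW (blocks_size_sum D) ?_
  have h0 := hm 0
  have h1 := hm 1
  have h2 := hm 2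
  have h3 := hm 3
  clear hm
  cases D <;> simp [NForm.chainMat, NForm.baseMat] at h0 h1 h2 h3 <;>
    simp [NForm.blocks, NForm.summands, Summand.blocks, IsChainList, Fin.forall_fin_succ, h0, h1,
      h2, h3, add_comm]

theorem HasForm.hasJCF_reverse {S : Module.End ℝ R22} {lam mu : ℝ}
    (h : HasForm S (.IIIb lam mu)) : HasJCF (cplxEnd S) (NForm.IIIb lam mu).blocks.reverse := by
  obtain ⟨W, hW, hm⟩ := h.exists_chainBasis
  have h0 := hm 0
  have h1 := hm 1
  have h2 := hm 2
  have h3 := hm 3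
  clear hm
  simp [NForm.chainMat, NForm.baseMat] at h0 h1 h2 h3
  -- The vector of the block `J₁`, which is the last one, is moved to the front.
  let W' : ℕ → C22 := fun k => if k = 0 then W 3 else W (k - 1)
  have e0 : W' 0 = W 3 := rfl
  have e1 : W' 1 = W 0 := rfl
  have e2 : W' 2 = W 1 := rfl
  have e3 : W' 3 = W 2 := rfl
  have hW' : LinearIndependent ℂ fun k : Fin 4 => W' k := by
    convert hW.comp ![3, 0, 1, 2] (by decide) using 1
    funext k
    fin_cases k <;> rfl
  refine hasJCF_of_isChainList hW' (by rw [sum_get_eq]; rfl) ?_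
  simp [NForm.blocks, NForm.summands, Summand.blocks, IsChainList, Fin.forall_fin_succ, e0, e1, e2,
    e3, h0, h1, h2, h3, add_comm]

theorem blocks_size_pos (D : NForm) : ∀ B ∈ D.blocks, 0 < B.size := by
  cases D <;> simp [NForm.blocks, NForm.summands, Summand.blocks]

/-! ### Segre characteristics -/

theorem hasForm_of_change {S : Module.End ℝ R22} {D D' : NForm} (h : HasForm S D)
    {P Q : Matrix (Fin 4) (Fin 4) ℝ} (hPQ : P * Q = 1)
    (hG : P.transpose * D.baseGram * P = D'.baseGram) (hA : D.baseMat * P = P * D'.baseMat) :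
    HasForm S D' := by
  obtain ⟨v, hv⟩ := (hasForm_iff_adapted S D).mp h
  exact (hasForm_iff_adapted S D').mpr ⟨_, hG ▸ hv.1.comb hPQ, hv.2.comb hA⟩

/-- Replacing the last basis vector by its negative replaces `d` by `-d`. -/
theorem HasForm.conj_VIII {S : Module.End ℝ R22} {a b c d : ℝ} (h : HasForm S (.VIII a b c d)) :
    HasForm S (.VIII a b c (-d)) := by
  refine hasForm_of_change h (P := !![1, 0, 0, 0; 0, 1, 0, 0; 0, 0, 1, 0; 0, 0, 0, -1])
    (Q := !![1, 0, 0, 0; 0, 1, 0, 0; 0, 0, 1, 0; 0, 0, 0, -1]) ?_ ?_ ?_ <;> ext i j <;>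
    fin_cases i <;> fin_cases j <;>
    simp [Matrix.mul_apply, Fin.sum_univ_four, NForm.baseGram, NForm.baseMat]

theorem hasSegre_I {S : Module.End ℝ R22} {e : ℤˣ} {lam : ℝ}
    (h : HasForm S (.I e lam)) :
    HasSegre S (NForm.I e lam).blocks [ent 4 0] := by
  simp only [HasSegre, h.hasJCF, true_and]
  simp [segre, NForm.blocks, NForm.summands, Summand.blocks, ent, List.findIdx_cons]

theorem hasSegre_II {S : Module.End ℝ R22} {a b : ℝ} (hb : b ≠ 0)
    (h : HasForm S (.II a b)) :
    HasSegre S (NForm.II a b).blocks [ent 2 0, bar 2 1] := by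
  simp only [HasSegre, h.hasJCF, true_and]
  simp [segre, NForm.blocks, NForm.summands, Summand.blocks, ent, bar, List.findIdx_cons,
    Complex.ext_iff]
  grind

theorem hasSegre_IIIa {S : Module.End ℝ R22} {lam mu : ℝ}
    (h : HasForm S (.IIIa lam mu)) :
    (lam ≠ mu → HasSegre S (NForm.IIIa lam mu).blocks [ent 1 0, ent 3 1]) ∧
    (lam = mu → HasSegre S (NForm.IIIa lam mu).blocks [ent 1 0, ent 3 0]) := by
  simp only [HasSegre, h.hasJCF, true_and]
  simp [segre, NForm.blocks, NForm.summands, Summand.blocks, ent, List.findIdx_cons]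
  grind

theorem hasSegre_IIIb {S : Module.End ℝ R22} {lam mu : ℝ}
    (h : HasForm S (.IIIb lam mu)) :
    (lam ≠ mu → HasSegre S (NForm.IIIb lam mu).blocks [ent 3 0, ent 1 1] ∧
      HasSegre S (NForm.IIIb lam mu).blocks.reverse [ent 1 0, ent 3 1]) ∧
    (lam = mu → HasSegre S (NForm.IIIb lam mu).blocks [ent 3 0, ent 1 0] ∧
      HasSegre S (NForm.IIIb lam mu).blocks.reverse [ent 1 0, ent 3 0]) := by
  simp only [HasSegre, h.hasJCF, h.hasJCF_reverse, true_and]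
  simp [segre, NForm.blocks, NForm.summands, Summand.blocks, ent, List.findIdx_cons]
  grind

theorem hasSegre_IV {S : Module.End ℝ R22} {e : ℤˣ} {lam mu nu : ℝ}
    (h : HasForm S (.IV e lam mu nu)) :
    (lam ≠ mu → mu ≠ nu → lam ≠ nu →
      HasSegre S (NForm.IV e lam mu nu).blocks [ent 1 0, ent 2 1, ent 1 2]) ∧
    (lam = mu → mu ≠ nu → HasSegre S (NForm.IV e lam mu nu).blocks [ent 1 0, ent 2 0, ent 1 2]) ∧
    (mu = nu → lam ≠ mu → HasSegre S (NForm.IV e lam mu nu).blocks [ent 1 0, ent 2 1, ent 1 1]) ∧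
    (lam = nu → lam ≠ mu → HasSegre S (NForm.IV e lam mu nu).blocks [ent 1 0, ent 2 1, ent 1 0]) ∧
    (lam = mu → mu = nu → HasSegre S (NForm.IV e lam mu nu).blocks
      [ent 1 0, ent 2 0, ent 1 0]) := by
  simp only [HasSegre, h.hasJCF, true_and]
  simp [segre, NForm.blocks, NForm.summands, Summand.blocks, ent, List.findIdx_cons]
  grind

theorem hasSegre_V {S : Module.End ℝ R22} {lam a b nu : ℝ} (hb : b ≠ 0)
    (h : HasForm S (.V lam a b nu)) :
    (lam ≠ nu → HasSegre S (NForm.V lam a b nu).blocks [ent 1 0, ent 1 1, bar 1 2, ent 1 3]) ∧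
    (lam = nu → HasSegre S (NForm.V lam a b nu).blocks [ent 1 0, ent 1 1, bar 1 2, ent 1 0]) := by
  simp only [HasSegre, h.hasJCF, true_and]
  simp [segre, NForm.blocks, NForm.summands, Summand.blocks, ent, bar, List.findIdx_cons,
    Complex.ext_iff]
  grind

theorem hasSegre_VI {S : Module.End ℝ R22} {e : ℤˣ} {lam a b : ℝ} (hb : b ≠ 0)
    (h : HasForm S (.VI e lam a b)) :
    HasSegre S (NForm.VI e lam a b).blocks [ent 2 0, ent 1 1, bar 1 2] := by
  simp only [HasSegre, h.hasJCF, true_and]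
  simp [segre, NForm.blocks, NForm.summands, Summand.blocks, ent, bar, List.findIdx_cons,
    Complex.ext_iff]
  grind

theorem hasSegre_VII {S : Module.End ℝ R22} {e w : ℤˣ} {lam mu : ℝ}
    (h : HasForm S (.VII e w lam mu)) :
    (lam ≠ mu → HasSegre S (NForm.VII e w lam mu).blocks [ent 2 0, ent 2 1]) ∧
    (lam = mu → HasSegre S (NForm.VII e w lam mu).blocks [ent 2 0, ent 2 0]) := by
  simp only [HasSegre, h.hasJCF, true_and]
  simp [segre, NForm.blocks, NForm.summands, Summand.blocks, ent, List.findIdx_cons]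
  grind

/-- The coincidence `a + ib = c - id` needs no entry of its own: it becomes `a + ib = c + id` when
`d` is replaced by `-d`. -/
theorem hasSegre_VIII {S : Module.End ℝ R22} {a b c d : ℝ} (hb : b ≠ 0 ∧ d ≠ 0)
    (h : HasForm S (.VIII a b c d)) :
    (¬ (a = c ∧ b = d) → ¬ (a = c ∧ b = -d) →
      HasSegre S (NForm.VIII a b c d).blocks [ent 1 0, bar 1 1, ent 1 2, bar 1 3]) ∧
    (a = c → b = d → HasSegre S (NForm.VIII a b c d).blocks [ent 1 0, bar 1 1, ent 1 0, bar 1 1]) ∧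
    HasForm S (.VIII a b c (-d)) := by
  refine ⟨fun h1 h2 => ⟨h.hasJCF, ?_⟩, fun h1 h2 => ⟨h.hasJCF, ?_⟩, h.conj_VIII⟩ <;>
    simp [segre, NForm.blocks, NForm.summands, Summand.blocks, ent, bar, List.findIdx_cons,
      Complex.ext_iff] <;> grind

theorem hasSegre_IX {S : Module.End ℝ R22} {lam mu nu sigma : ℝ}
    (h : HasForm S (.IX lam mu nu sigma)) :
    (lam ≠ mu → lam ≠ nu → lam ≠ sigma → mu ≠ nu → mu ≠ sigma → nu ≠ sigma →
      HasSegre S (NForm.IX lam mu nu sigma).blocks [ent 1 0, ent 1 1, ent 1 2, ent 1 3]) ∧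
    (lam = mu → lam ≠ nu → lam ≠ sigma → nu ≠ sigma →
      HasSegre S (NForm.IX lam mu nu sigma).blocks [ent 1 0, ent 1 0, ent 1 2, ent 1 3]) ∧
    (lam = nu → lam ≠ mu → lam ≠ sigma → mu ≠ sigma →
      HasSegre S (NForm.IX lam mu nu sigma).blocks [ent 1 0, ent 1 1, ent 1 0, ent 1 3]) ∧
    (lam = sigma → lam ≠ mu → lam ≠ nu → mu ≠ nu →
      HasSegre S (NForm.IX lam mu nu sigma).blocks [ent 1 0, ent 1 1, ent 1 2, ent 1 0]) ∧
    (mu = nu → lam ≠ mu → lam ≠ sigma → mu ≠ sigma →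
      HasSegre S (NForm.IX lam mu nu sigma).blocks [ent 1 0, ent 1 1, ent 1 1, ent 1 3]) ∧
    (mu = sigma → lam ≠ mu → lam ≠ nu → mu ≠ nu →
      HasSegre S (NForm.IX lam mu nu sigma).blocks [ent 1 0, ent 1 1, ent 1 2, ent 1 1]) ∧
    (nu = sigma → lam ≠ mu → lam ≠ nu → mu ≠ nu →
      HasSegre S (NForm.IX lam mu nu sigma).blocks [ent 1 0, ent 1 1, ent 1 2, ent 1 2]) ∧
    (lam = mu → nu = sigma → lam ≠ nu →
      HasSegre S (NForm.IX lam mu nu sigma).blocks [ent 1 0, ent 1 0, ent 1 2, ent 1 2]) ∧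
    (lam = nu → mu = sigma → lam ≠ mu →
      HasSegre S (NForm.IX lam mu nu sigma).blocks [ent 1 0, ent 1 1, ent 1 0, ent 1 1]) ∧
    (lam = sigma → mu = nu → lam ≠ mu →
      HasSegre S (NForm.IX lam mu nu sigma).blocks [ent 1 0, ent 1 1, ent 1 1, ent 1 0]) ∧
    (lam = mu → mu = nu → lam ≠ sigma →
      HasSegre S (NForm.IX lam mu nu sigma).blocks [ent 1 0, ent 1 0, ent 1 0, ent 1 3]) ∧
    (lam = mu → mu = sigma → lam ≠ nu →
      HasSegre S (NForm.IX lam mu nu sigma).blocks [ent 1 0, ent 1 0, ent 1 2, ent 1 0]) ∧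
    (lam = nu → nu = sigma → lam ≠ mu →
      HasSegre S (NForm.IX lam mu nu sigma).blocks [ent 1 0, ent 1 1, ent 1 0, ent 1 0]) ∧
    (mu = nu → nu = sigma → lam ≠ mu →
      HasSegre S (NForm.IX lam mu nu sigma).blocks [ent 1 0, ent 1 1, ent 1 1, ent 1 1]) ∧
    (lam = mu → mu = nu → nu = sigma →
      HasSegre S (NForm.IX lam mu nu sigma).blocks [ent 1 0, ent 1 0, ent 1 0, ent 1 0]) := by
  refine ⟨?_, ?_, ?_, ?_, ?_, ?_, ?_, ?_, ?_, ?_, ?_, ?_, ?_, ?_, ?_⟩ <;> intros <;>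
    refine ⟨h.hasJCF, ?_⟩ <;> clear h <;>
    simp only [segre, NForm.blocks, NForm.summands, Summand.blocks, ent, List.findIdx_cons,
      List.flatMap_cons, List.flatMap_nil, List.append_nil, List.cons_append, List.nil_append,
      List.map_cons, List.map_nil, Complex.ofReal_inj] <;>
    subst_vars <;> simp_all [eq_comm]

/-! ### Eigenvectors and Jordan chains over the complex numbers -/

theorem hasMatrix_pair_iff (S : Module.End ℝ R22) (a b : ℝ) (v : Fin 2 → R22) :
    HasMatrix S v !![a, b; -b, a] ↔
      HasMatrix (cplxEnd S) ![cpair (v 0) (v 1), star (cpair (v 0) (v 1))]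
        !![⟨a, b⟩, 0; 0, ⟨a, -b⟩] := by
  simp only [HasMatrix, Fin.forall_fin_two, Fin.sum_univ_two, star_cpair]
  simp only [Matrix.of_apply, Matrix.cons_val_zero, Matrix.cons_val_one, Matrix.cons_val',
    Matrix.cons_val_fin_one, zero_smul, zero_add, add_zero, cplxEnd_cpair, smul_cpair]
  constructor
  · rintro ⟨h0, h1⟩
    rw [map_neg, h0, h1]
    constructor <;> congr 1 <;> module
  · rintro ⟨h, -⟩
    obtain ⟨h0, h1⟩ := cpair_injective h
    rw [h0, h1]
    constructor <;> module

theorem span_pair_eq_cplxSub {U : Submodule ℝ R22} {v : Fin 2 → R22}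
    (h : Submodule.span ℝ (Set.range v) = U) :
    Submodule.span ℂ (Set.range ![cpair (v 0) (v 1), star (cpair (v 0) (v 1))]) = cplxSub U := by
  subst h
  have hr : Set.range ![cpair (v 0) (v 1), star (cpair (v 0) (v 1))] =
      {cpair (v 0) (v 1), star (cpair (v 0) (v 1))} := by simp [Set.pair_comm]
  rw [hr, star_cpair]
  apply le_antisymm
  · rw [Submodule.span_le]
    have h0 (i : Fin 2) : cvec (v i) ∈ cplxSub (Submodule.span ℝ (Set.range v)) :=
      Submodule.subset_span ⟨_, Submodule.subset_span ⟨i, rfl⟩, rfl⟩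
    rintro x (rfl | rfl)
    · exact Submodule.add_mem _ (h0 0) (Submodule.smul_mem _ _ (h0 1))
    · have : cpair (v 0) (-v 1) = cvec (v 0) - Complex.I • cvec (v 1) := by
        funext i
        apply Complex.ext <;> simp [cpair, cvec]
      exact this ▸ Submodule.sub_mem _ (h0 0) (Submodule.smul_mem _ _ (h0 1))
  · rw [cplxSub, Submodule.span_le]
    rintro _ ⟨u, hu, rfl⟩
    rw [SetLike.mem_coe, Submodule.mem_span_range_iff_exists_fun] at hu
    obtain ⟨c, rfl⟩ := hu
    refine Submodule.mem_span_pair.mpr ⟨⟨c 0 / 2, -c 1 / 2⟩, ⟨c 0 / 2, c 1 / 2⟩, ?_⟩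
    rw [smul_cpair, smul_cpair, cpair_add, ← cpair_zero_right, Fin.sum_univ_two]
    congr 1 <;> module

/-- An invariant plane with a pair of complex conjugate eigenvalues, over `ℂ`. -/
theorem cplx_plane {S : Module.End ℝ R22} {U : Submodule ℝ R22} {a b : ℝ} {v : Fin 2 → R22}
    {w : C22} (hv : IsPsiON 1 1 U v) (hw : w = cpair (v 0) (v 1)) :
    (HasMatrix S v !![a, b; -b, a] ↔
      HasMatrix (cplxEnd S) ![w, star w] !![⟨a, b⟩, 0; 0, ⟨a, -b⟩]) ∧
    LinearIndependent ℂ ![w, star w] ∧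
    Submodule.span ℂ (Set.range ![w, star w]) = cplxSub U ∧
    hC w w = 0 ∧ hC (star w) (star w) = 0 ∧ hC w (star w) ≠ 0 ∧
    sC w w ≠ 0 ∧ sC (star w) (star w) ≠ 0 ∧ sC w (star w) = 0 := by
  subst hw
  have hg := hv.gram
  rw [psiGram11] at hg
  have g00 : s22 (v 0) (v 0) = 1 := hg 0 0
  have g01 : s22 (v 0) (v 1) = 0 := hg 0 1
  have g10 : s22 (v 1) (v 0) = 0 := hg 1 0
  have g11 : s22 (v 1) (v 1) = -1 := hg 1 1
  have s1 : sC (cpair (v 0) (v 1)) (cpair (v 0) (v 1)) = 2 := by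
    rw [sC_cpair]; apply Complex.ext <;> norm_num [g00, g01, g10, g11]
  have s2 : sC (star (cpair (v 0) (v 1))) (star (cpair (v 0) (v 1))) = 2 := by
    rw [star_cpair, sC_cpair]; apply Complex.ext <;> norm_num [g00, g01, g10, g11]
  have s3 : sC (cpair (v 0) (v 1)) (star (cpair (v 0) (v 1))) = 0 := by
    rw [star_cpair, sC_cpair]; apply Complex.ext <;> norm_num [g00, g01, g10, g11]
  refine ⟨hasMatrix_pair_iff S a b v, ?_, span_pair_eq_cplxSub hv.span_eq, ?_, ?_, ?_, ?_, ?_, s3⟩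
  · refine linearIndependent_of_gram sC (G := !![2, 0; 0, 2]) (G' := !![1 / 2, 0; 0, 1 / 2]) ?_ ?_
    · simp only [Fin.forall_fin_two]
      simp [s1, s2, s3, sC_comm (star _)]
    · ext i j
      fin_cases i <;> fin_cases j <;> simp [Matrix.mul_apply]
  · rw [hC, sC_comm, s3]
  · rw [hC, star_star, s3]
  · rw [hC, s2]; norm_num
  · rw [s1]; norm_num
  · rw [s2]; norm_num

/-- Two null vectors with scalar product `2` span a plane isometric to the Euclidean `ℂ²`. -/
theorem exists_isometry_dotProduct {w₁ w₂ : C22} (h₁ : sC w₁ w₁ = 0) (h₂ : sC w₂ w₂ = 0)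
    (h : sC w₁ w₂ = 2) :
    ∃ f : Submodule.span ℂ {w₁, w₂} ≃ₗ[ℂ] (Fin 2 → ℂ), ∀ x y, f x ⬝ᵥ f y = sC x y := by
  have hI : Complex.I * Complex.I = -1 := Complex.I_mul_I
  have h' : sC w₂ w₁ = 2 := by rw [sC_comm, h]
  have e₁ : w₁ ∈ Submodule.span ℂ {w₁, w₂} := Submodule.subset_span (by simp)
  have e₂ : w₂ ∈ Submodule.span ℂ {w₁, w₂} := Submodule.subset_span (by simp)
  -- the orthonormal basis is `(w₁ + w₂) / 2`, `i (w₁ - w₂) / 2`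
  let f : Submodule.span ℂ {w₁, w₂} ≃ₗ[ℂ] (Fin 2 → ℂ) :=
    { toFun := fun x => ![(sC w₁ x + sC w₂ x) / 2, Complex.I * (sC w₁ x - sC w₂ x) / 2]
      map_add' := fun x y => by
        ext i
        fin_cases i <;> simp <;> ring
      map_smul' := fun c x => by
        ext i
        fin_cases i <;> simp <;> ring
      invFun := fun c => ⟨((c 0 + Complex.I * c 1) / 2) • w₁ + ((c 0 - Complex.I * c 1) / 2) • w₂,
        Submodule.add_mem _ (Submodule.smul_mem _ _ e₁) (Submodule.smul_mem _ _ e₂)⟩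
      left_inv := fun x => by
        obtain ⟨x, hx⟩ := x
        obtain ⟨p, q, rfl⟩ := Submodule.mem_span_pair.mp hx
        simp only [map_add, map_smul, h₁, h₂, h, h', smul_eq_mul, Matrix.cons_val_zero,
          Matrix.cons_val_one, Subtype.mk.injEq]
        congr 2
        · linear_combination ((q - p) / 2) * hI
        · linear_combination ((p - q) / 2) * hI
      right_inv := fun c => by
        ext i
        fin_cases i <;> simp [h₁, h₂, h, h']
        linear_combination (-c 1) * hI }
  refine ⟨f, ?_⟩
  rintro ⟨x, hx⟩ ⟨y, hy⟩
  obtain ⟨p, q, rfl⟩ := Submodule.mem_span_pair.mp hx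
  obtain ⟨p', q', rfl⟩ := Submodule.mem_span_pair.mp hy
  simp [f, h₁, h₂, h, h']
  linear_combination (q - p) * (q' - p') * hI

theorem hasMatrix_chain {S : Module.End ℝ R22} {a b : ℝ} {v : Fin 4 → R22}
    (h : HasMatrix S v (NForm.II a b).baseMat) :
    HasMatrix (cplxEnd S) ![cpair (v 0) (v 1), cpair (v 2) (v 3), star (cpair (v 0) (v 1)),
        star (cpair (v 2) (v 3))]
      !![⟨a, b⟩, 1, 0, 0; 0, ⟨a, b⟩, 0, 0; 0, 0, ⟨a, -b⟩, 1; 0, 0, 0, ⟨a, -b⟩] := by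
  have h0 := h 0
  have h1 := h 1
  have h2 := h 2
  have h3 := h 3
  simp [NForm.baseMat, Fin.sum_univ_four] at h0 h1 h2 h3
  intro j
  rw [Fin.sum_univ_four]
  fin_cases j <;> simp [star_cpair, cplxEnd_cpair, smul_cpair, cpair_add, h0, h1, h2, h3] <;>
    congr 1 <;> module

/-- The invariant decomposition of `ℂ⁴` for type II. -/
theorem typeII_cplx {S : Module.End ℝ R22} {a b : ℝ} {v : Fin 4 → R22} {w₁ w₂ : C22}
    {W W' : Submodule ℂ C22} (hv : IsAdapted S (.II a b) v) (hw₁ : w₁ = cpair (v 0) (v 1))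
    (hw₂ : w₂ = cpair (v 2) (v 3)) (hW : W = Submodule.span ℂ {w₁, w₂})
    (hW' : W' = Submodule.span ℂ {star w₁, star w₂}) :
    LinearIndependent ℂ ![w₁, w₂, star w₁, star w₂] ∧
    HasMatrix (cplxEnd S) ![w₁, w₂, star w₁, star w₂]
      !![⟨a, b⟩, 1, 0, 0; 0, ⟨a, b⟩, 0, 0; 0, 0, ⟨a, -b⟩, 1; 0, 0, 0, ⟨a, -b⟩] ∧
    (∀ i, sC (![w₁, w₂, star w₁, star w₂] i) (![w₁, w₂, star w₁, star w₂] i) = 0 ∧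
      hC (![w₁, w₂, star w₁, star w₂] i) (![w₁, w₂, star w₁, star w₂] i) = 0) ∧
    IsCompl W W' ∧
    (∃ f : W ≃ₗ[ℂ] (Fin 2 → ℂ), ∀ x y : W, f x ⬝ᵥ f y = sC x y) ∧
    (∃ f : W' ≃ₗ[ℂ] (Fin 2 → ℂ), ∀ x y : W', f x ⬝ᵥ f y = sC x y) ∧
    (∀ x ∈ W, ∀ y ∈ W', sC x y = 0) ∧
    (∀ x ∈ W, ∀ y ∈ W, hC x y = 0) ∧ (∀ x ∈ W', ∀ y ∈ W', hC x y = 0) := by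
  have hm := hasMatrix_chain hv.2
  have hg := hv.1.gram
  simp only [NForm.baseGram, Fin.forall_fin_succ, IsEmpty.forall_iff, and_true] at hg
  simp at hg
  obtain ⟨⟨g00, g01, g02, g03⟩, ⟨g10, g11, g12, g13⟩, ⟨g20, g21, g22, g23⟩,
    ⟨g30, g31, g32, g33⟩⟩ := hg
  rw [← hw₁, ← hw₂] at hm
  have s11 : sC w₁ w₁ = 0 := by
    rw [hw₁, sC_cpair]; apply Complex.ext <;> simp [*]
  have s22' : sC w₂ w₂ = 0 := by
    rw [hw₂, sC_cpair]; apply Complex.ext <;> simp [*]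
  have s12 : sC w₁ w₂ = 2 := by
    rw [hw₁, hw₂, sC_cpair]; apply Complex.ext <;> norm_num [*]
  have t11 : sC (star w₁) (star w₁) = 0 := by
    rw [hw₁, star_cpair, sC_cpair]; apply Complex.ext <;> simp [*]
  have t22 : sC (star w₂) (star w₂) = 0 := by
    rw [hw₂, star_cpair, sC_cpair]; apply Complex.ext <;> simp [*]
  have t12 : sC (star w₁) (star w₂) = 2 := by
    rw [hw₁, hw₂, star_cpair, star_cpair, sC_cpair]; apply Complex.ext <;> norm_num [*]
  have m11 : sC w₁ (star w₁) = 0 := by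
    rw [hw₁, star_cpair, sC_cpair]; apply Complex.ext <;> simp [*]
  have m22 : sC w₂ (star w₂) = 0 := by
    rw [hw₂, star_cpair, sC_cpair]; apply Complex.ext <;> simp [*]
  have m12 : sC w₁ (star w₂) = 0 := by
    rw [hw₁, hw₂, star_cpair, sC_cpair]; apply Complex.ext <;> norm_num [*]
  have m21 : sC w₂ (star w₁) = 0 := by
    rw [hw₁, hw₂, star_cpair, sC_cpair]; apply Complex.ext <;> norm_num [*]
  clear hw₁ hw₂ hv
  have hli : LinearIndependent ℂ ![w₁, w₂, star w₁, star w₂] := by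
    refine linearIndependent_of_gram sC
      (G := !![0, 2, 0, 0; 2, 0, 0, 0; 0, 0, 0, 2; 0, 0, 2, 0])
      (G' := !![0, 1 / 2, 0, 0; 1 / 2, 0, 0, 0; 0, 0, 0, 1 / 2; 0, 0, 1 / 2, 0]) ?_ ?_
    · intro i j
      fin_cases i <;> fin_cases j <;>
        simp [s11, s22', s12, t11, t22, t12, m11, m22, m12, m21, sC_comm w₂ w₁,
          sC_comm (star w₂) (star w₁), sC_comm (star _) w₁, sC_comm (star _) w₂]
    · ext i j
      fin_cases i <;> fin_cases j <;> simp [Matrix.mul_apply, Fin.sum_univ_four]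
  have hstar (p q : ℂ) : star (p • star w₁ + q • star w₂) = star p • w₁ + star q • w₂ := by
    rw [star_add, star_smul, star_smul, star_star, star_star]
  have hmix : ∀ x ∈ W, ∀ y ∈ W', sC x y = 0 := by
    intro x hx y hy
    rw [hW] at hx
    rw [hW'] at hy
    obtain ⟨p, q, rfl⟩ := Submodule.mem_span_pair.mp hx
    obtain ⟨p', q', rfl⟩ := Submodule.mem_span_pair.mp hy
    simp [m11, m22, m12, m21]
  have hsW : ∀ x ∈ W, star x ∈ W' := by
    intro x hx
    rw [hW] at hx
    obtain ⟨p, q, rfl⟩ := Submodule.mem_span_pair.mp hx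
    rw [hW', star_add, star_smul, star_smul]
    exact Submodule.mem_span_pair.mpr ⟨_, _, rfl⟩
  have hsW' : ∀ x ∈ W', star x ∈ W := by
    intro x hx
    rw [hW'] at hx
    obtain ⟨p, q, rfl⟩ := Submodule.mem_span_pair.mp hx
    rw [hW, hstar]
    exact Submodule.mem_span_pair.mpr ⟨_, _, rfl⟩
  refine ⟨hli, hm, ?_, ?_, ?_, ?_, hmix, ?_, ?_⟩
  · intro i
    fin_cases i <;> simp [hC, s11, s22', t11, t22, m11, m22, sC_comm (star _) w₁,
      sC_comm (star _) w₂]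
  · refine IsCompl.of_eq ?_ ?_
    · rw [Submodule.eq_bot_iff]
      rintro x ⟨hx, hx'⟩
      have h0 : sC w₁ x = 0 := hmix _ (hW ▸ Submodule.subset_span (by simp)) _ hx'
      have h0' : sC w₂ x = 0 := hmix _ (hW ▸ Submodule.subset_span (by simp)) _ hx'
      rw [SetLike.mem_coe, hW] at hx
      obtain ⟨p, q, rfl⟩ := Submodule.mem_span_pair.mp hx
      simp [s11, s12] at h0
      simp [s22', sC_comm w₂ w₁, s12] at h0'
      simp [h0, h0']
    · rw [eq_top_iff, ← hli.span_eq_top_of_card_eq_finrank (by simp), Submodule.span_le, hW, hW']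
      rintro _ ⟨i, rfl⟩
      fin_cases i
      · exact Submodule.mem_sup_left (Submodule.subset_span (by simp))
      · exact Submodule.mem_sup_left (Submodule.subset_span (by simp))
      · exact Submodule.mem_sup_right (Submodule.subset_span (by simp))
      · exact Submodule.mem_sup_right (Submodule.subset_span (by simp))
  · subst hW
    exact exists_isometry_dotProduct s11 s22' s12
  · subst hW'
    exact exists_isometry_dotProduct t11 t22 t12
  · intro x hx y hy
    rw [hC, sC_comm]
    exact hmix y hy _ (hsW x hx)
  · intro x hx y hy
    exact hmix _ (hsW' x hx) y hy

/-! ### Uniqueness of the type -/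

theorem geoMult_eq_count (L : List JBlock) (z : ℂ) :
    geoMult L z = (L.map JBlock.eig).count z := by
  classical
  rw [geoMult, List.count, List.countP_map, List.countP_eq_length_filter]
  congr 2

/-- The eigenvalues belonging to the blocks are determined by the endomorphism, since their
multiplicities in the list are the geometric multiplicities. -/
theorem HasForm.eigenvalues_perm {S : Module.End ℝ R22} {D D' : NForm} (h : HasForm S D)
    (h' : HasForm S D') : (D.blocks.map JBlock.eig).Perm (D'.blocks.map JBlock.eig) := by
  classical
  rw [List.perm_iff_count]
  intro z
  have h1 := h.hasJCF.finrank_eigenspace (blocks_size_pos D) z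
  have h2 := h'.hasJCF.finrank_eigenspace (blocks_size_pos D') z
  have h3 := h1.symm.trans h2
  rw [geoMult_eq_count, geoMult_eq_count] at h3
  convert h3

theorem HasForm.length_eq {S : Module.End ℝ R22} {D D' : NForm} (h : HasForm S D)
    (h' : HasForm S D') : D.blocks.length = D'.blocks.length := by
  simpa using (h.eigenvalues_perm h').length_eq

theorem HasForm.nonreal_eq {S : Module.End ℝ R22} {D D' : NForm} (h : HasForm S D)
    (h' : HasForm S D') : (D.blocks.map JBlock.eig).countP (fun z => decide (z.im ≠ 0)) =
      (D'.blocks.map JBlock.eig).countP (fun z => decide (z.im ≠ 0)) :=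
  (h.eigenvalues_perm h').countP_eq _

/-- `(S - λ)(S - μ)`. -/
noncomputable def quadPoly (S : Module.End ℝ R22) (lam mu : ℝ) : Module.End ℝ R22 :=
  S * S - (lam + mu) • S + (lam * mu) • 1

theorem quadPoly_apply (S : Module.End ℝ R22) (lam mu : ℝ) (x : R22) :
    quadPoly S lam mu x = S (S x) - (lam + mu) • S x + (lam * mu) • x := by
  simp [quadPoly]

/-- The quadratic form `s(x, (S - λ)(S - μ)x)` if `λ = μ`, and `s(x, ((S - λ)(S - μ))²x)` otherwise.
For two Jordan blocks of real eigenvalues `λ`, `μ` it vanishes if both blocks have size two, and it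
is semidefinite of rank one if one of them has size three. -/
noncomputable def chainForm (S : Module.End ℝ R22) (lam mu : ℝ) (x : R22) : ℝ :=
  if lam = mu then s22 x (quadPoly S lam mu x)
  else s22 x (quadPoly S lam mu (quadPoly S lam mu x))

theorem chainForm_comm (S : Module.End ℝ R22) (lam mu : ℝ) :
    chainForm S lam mu = chainForm S mu lam := by
  have : quadPoly S lam mu = quadPoly S mu lam := by
    rw [quadPoly, quadPoly, add_comm, mul_comm mu, add_comm mu, add_comm]
  funext x
  simp only [chainForm, this, eq_comm (a := lam)]

theorem IsFrame.exists_coord {v : Fin 4 → R22} {G : Matrix (Fin 4) (Fin 4) ℝ}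
    (h : IsFrame ⊤ v G) (x : R22) :
    ∃ c : Fin 4 → ℝ, c 0 • v 0 + c 1 • v 1 + c 2 • v 2 + c 3 • v 3 = x := by
  have hx : x ∈ Submodule.span ℝ (Set.range v) := h.span_eq ▸ Submodule.mem_top
  obtain ⟨c, hc⟩ := (Submodule.mem_span_range_iff_exists_fun ℝ).mp hx
  exact ⟨c, by rw [← hc, Fin.sum_univ_four]⟩

theorem chainForm_IIIa {S : Module.End ℝ R22} {lam mu : ℝ} (h : HasForm S (.IIIa lam mu)) :
    (∃ x, chainForm S lam mu x < 0) ∧ ∀ x, chainForm S lam mu x ≤ 0 := by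
  obtain ⟨v, hf, hm⟩ := (hasForm_iff_adapted S _).mp h
  have hg := hf.gram
  have hS (j : Fin 4) := hm j
  simp only [NForm.baseGram, NForm.baseMat, Fin.forall_fin_succ, IsEmpty.forall_iff, and_true,
    Fin.sum_univ_four] at hg hS
  simp at hg hS
  obtain ⟨⟨g00, g01, g02, g03⟩, ⟨g10, g11, g12, g13⟩, ⟨g20, g21, g22, g23⟩,
    ⟨g30, g31, g32, g33⟩⟩ := hg
  obtain ⟨h0, h1, h2, h3⟩ := hS
  have T0 : quadPoly S lam mu (v 0) = 0 := by
    simp only [quadPoly_apply, h0, map_smul]; module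
  have T1 : quadPoly S lam mu (v 1) = 0 := by
    simp only [quadPoly_apply, h1, map_smul]; module
  have T2 : quadPoly S lam mu (v 2) = (mu - lam) • v 1 := by
    simp only [quadPoly_apply, h1, h2, map_smul, map_add]; module
  have T3 : quadPoly S lam mu (v 3) = v 1 + (mu - lam) • v 2 := by
    simp only [quadPoly_apply, h2, h3, map_smul, map_add]; module
  have key (c : Fin 4 → ℝ) :
      chainForm S lam mu (c 0 • v 0 + c 1 • v 1 + c 2 • v 2 + c 3 • v 3) =
        -(if lam = mu then 1 else (mu - lam) ^ 2) * c 3 ^ 2 := by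
    simp only [chainForm, map_add, map_smul, T0, T1, T2, T3]
    split_ifs with e
    · subst e
      simp [*]; ring
    · simp [*]; ring
  have hp : 0 < if lam = mu then (1 : ℝ) else (mu - lam) ^ 2 := by
    split_ifs with e
    · exact one_pos
    · exact pow_two_pos_of_ne_zero (sub_ne_zero.mpr (Ne.symm e))
  constructor
  · refine ⟨_, (key ![0, 0, 0, 1]).trans_lt ?_⟩
    simpa using hp
  · intro x
    obtain ⟨c, rfl⟩ := hf.exists_coord x
    rw [key]
    nlinarith [mul_nonneg hp.le (sq_nonneg (c 3))]

theorem chainForm_IIIb {S : Module.End ℝ R22} {lam mu : ℝ} (h : HasForm S (.IIIb lam mu)) :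
    (∃ x, 0 < chainForm S lam mu x) ∧ ∀ x, 0 ≤ chainForm S lam mu x := by
  obtain ⟨v, hf, hm⟩ := (hasForm_iff_adapted S _).mp h
  have hg := hf.gram
  have hS (j : Fin 4) := hm j
  simp only [NForm.baseGram, NForm.baseMat, Fin.forall_fin_succ, IsEmpty.forall_iff, and_true,
    Fin.sum_univ_four] at hg hS
  simp at hg hS
  obtain ⟨⟨g00, g01, g02, g03⟩, ⟨g10, g11, g12, g13⟩, ⟨g20, g21, g22, g23⟩,
    ⟨g30, g31, g32, g33⟩⟩ := hg
  obtain ⟨h0, h1, h2, h3⟩ := hS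
  have T0 : quadPoly S lam mu (v 0) = 0 := by
    simp only [quadPoly_apply, h0, map_smul]; module
  have T1 : quadPoly S lam mu (v 1) = (lam - mu) • v 0 := by
    simp only [quadPoly_apply, h0, h1, map_smul, map_add]; module
  have T2 : quadPoly S lam mu (v 2) = v 0 + (lam - mu) • v 1 := by
    simp only [quadPoly_apply, h1, h2, map_smul, map_add]; module
  have T3 : quadPoly S lam mu (v 3) = 0 := by
    simp only [quadPoly_apply, h3, map_smul]; module
  have key (c : Fin 4 → ℝ) :
      chainForm S lam mu (c 0 • v 0 + c 1 • v 1 + c 2 • v 2 + c 3 • v 3) =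
        (if lam = mu then 1 else (lam - mu) ^ 2) * c 2 ^ 2 := by
    simp only [chainForm, map_add, map_smul, T0, T1, T2, T3]
    split_ifs with e
    · subst e
      simp [*]; ring
    · simp [*]; ring
  have hp : 0 < if lam = mu then (1 : ℝ) else (lam - mu) ^ 2 := by
    split_ifs with e
    · exact one_pos
    · exact pow_two_pos_of_ne_zero (sub_ne_zero.mpr e)
  constructor
  · refine ⟨_, lt_of_lt_of_eq ?_ (key ![0, 0, 1, 0]).symm⟩
    simpa using hp
  · intro x
    obtain ⟨c, rfl⟩ := hf.exists_coord x
    rw [key]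
    positivity

theorem chainForm_VII {S : Module.End ℝ R22} {e w : ℤˣ} {lam mu : ℝ}
    (h : HasForm S (.VII e w lam mu)) (x : R22) : chainForm S lam mu x = 0 := by
  obtain ⟨v, hf, hm⟩ := (hasForm_iff_adapted S _).mp h
  have hS (j : Fin 4) := hm j
  simp only [NForm.baseMat, Fin.forall_fin_succ, IsEmpty.forall_iff, and_true,
    Fin.sum_univ_four] at hS
  simp at hS
  obtain ⟨h0, h1, h2, h3⟩ := hS
  have T0 : quadPoly S lam mu (v 0) = 0 := by
    simp only [quadPoly_apply, h0, map_smul]; module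
  have T1 : quadPoly S lam mu (v 1) = (lam - mu) • v 0 := by
    simp only [quadPoly_apply, h0, h1, map_smul, map_add]; module
  have T2 : quadPoly S lam mu (v 2) = 0 := by
    simp only [quadPoly_apply, h2, map_smul]; module
  have T3 : quadPoly S lam mu (v 3) = (mu - lam) • v 2 := by
    simp only [quadPoly_apply, h2, h3, map_smul, map_add]; module
  obtain ⟨c, rfl⟩ := hf.exists_coord x
  simp only [chainForm, map_add, map_smul, T0, T1, T2, T3]
  split_ifs with e
  · subst e
    simp
  · simp

/-- If the blocks of two forms belong to two real eigenvalues each, these are the same eigenvalues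
up to order, and so the two forms give the same quadratic form. -/
theorem chainForm_congr {S : Module.End ℝ R22} {D D' : NForm} (h : HasForm S D)
    (h' : HasForm S D') {lam mu lam' mu' : ℝ} (hD : D.blocks.map JBlock.eig = [(lam : ℂ), (mu : ℂ)])
    (hD' : D'.blocks.map JBlock.eig = [(lam' : ℂ), (mu' : ℂ)]) :
    chainForm S lam mu = chainForm S lam' mu' := by
  have hp := h.eigenvalues_perm h'
  rw [hD, hD'] at hp
  have hc : lam = lam' ∧ mu = mu' ∨ lam = mu' ∧ mu = lam' := by
    have := List.cons_perm_iff_perm_erase.mp hp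
    obtain ⟨h1, h2⟩ := this
    by_cases e : (lam' : ℂ) = lam
    · rw [e, List.erase_cons_head, List.perm_singleton] at h2
      left
      exact ⟨(Complex.ofReal_inj.mp e).symm, by simpa using h2⟩
    · rw [List.erase_cons_tail (by simpa using e)] at h2
      right
      have e' : lam ≠ lam' := fun h => e (by rw [h])
      simp [e'] at h1
      subst h1
      simp at h2
      exact ⟨rfl, h2⟩
  rcases hc with ⟨rfl, rfl⟩ | ⟨rfl, rfl⟩
  · rfl
  · exact chainForm_comm ..

theorem HasForm.type_eq {S : Module.End ℝ R22} {D D' : NForm} (hD : D.Admissible)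
    (hD' : D'.Admissible) (h : HasForm S D) (h' : HasForm S D') : D.type = D'.type := by
  have hl := h.length_eq h'
  have hn := h.nonreal_eq h'
  cases D <;> cases D' <;>
    simp [NForm.blocks, NForm.summands, Summand.blocks] at hl <;>
    simp only [NForm.Admissible] at hD hD' <;>
    simp [NForm.blocks, NForm.summands, Summand.blocks, hD, hD'] at hn <;>
    try rfl
  all_goals
    exfalso
    have hq := chainForm_congr h h' rfl rfl
  case IIIa.IIIb =>
    obtain ⟨x, hx⟩ := (chainForm_IIIa h).1
    exact absurd ((chainForm_IIIb h').2 x) (by rw [← hq]; exact hx.not_ge)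
  case IIIa.VII =>
    obtain ⟨x, hx⟩ := (chainForm_IIIa h).1
    exact hx.ne (hq ▸ chainForm_VII h' x)
  case IIIb.IIIa =>
    obtain ⟨x, hx⟩ := (chainForm_IIIb h).1
    exact absurd ((chainForm_IIIa h').2 x) (by rw [← hq]; exact hx.not_ge)
  case IIIb.VII =>
    obtain ⟨x, hx⟩ := (chainForm_IIIb h).1
    exact hx.ne' (hq ▸ chainForm_VII h' x)
  case VII.IIIa =>
    obtain ⟨x, hx⟩ := (chainForm_IIIa h').1
    exact hx.ne (hq ▸ chainForm_VII h x)
  case VII.IIIb =>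
    obtain ⟨x, hx⟩ := (chainForm_IIIb h').1
    exact hx.ne' (hq ▸ chainForm_VII h x)

theorem existsUnique_type {S : Module.End ℝ R22} (hS : LinearMap.IsSelfAdjoint s22 S) :
    ∃! t : SAType, IsOfType S t := by
  obtain ⟨D, hD, h⟩ := exists_form hS
  refine ⟨D.type, ⟨D, rfl, hD, h⟩, ?_⟩
  rintro _ ⟨D', rfl, hD', h'⟩
  exact h'.type_eq hD' hD h

/-! ### Decomposition into listed summands -/

theorem exists_vector_of_fits {S : Module.End ℝ R22} {U : Submodule ℝ R22} {e : ℤˣ} {c : ℝ}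
    {v : Fin 1 → R22} (h : Fits S U (.real 1 e c) v) :
    ∃ (v : R22) (c : ℝ), U = Submodule.span ℝ {v} ∧ (s22 v v = 1 ∨ s22 v v = -1) ∧
      ∀ u ∈ U, S u = c • u := by
  obtain ⟨⟨-, hU, hg⟩, hm⟩ := h
  have h0 : s22 (v 0) (v 0) = antiGram 1 e 0 0 := hg (0 : Fin 1) (0 : Fin 1)
  have h1 : S (v 0) = ∑ i, jordanBlock 1 c i 0 • v i := hm (0 : Fin 1)
  change Submodule.span ℝ (Set.range v) = U at hU
  rw [show Set.range v = {v 0} from Set.range_unique] at hU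
  refine ⟨v 0, c, hU.symm, ?_, ?_⟩
  · rw [h0, antiGram_one]
    rcases Int.units_eq_one_or e with rfl | rfl <;> simp [sg]
  · intro u hu
    rw [← hU] at hu
    obtain ⟨t, rfl⟩ := Submodule.mem_span_singleton.mp hu
    rw [map_smul, h1, sum_jordanBlock_smul, smul_comm]
    simp

theorem Fits.isListedSummand {D : NForm} (hD : D.Admissible) {S : Module.End ℝ R22} {s : Summand}
    (hs : s ∈ D.summands) {U : Submodule ℝ R22} {v : Fin s.dim → R22} (h : Fits S U s v) :
    IsListedSummand S U := by
  have hi := h.isIsometricTo hs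
  have hr : Module.finrank ℝ U = s.dim := by
    rw [← h.1.span_eq, finrank_span_eq_card h.1.indep, Fintype.card_fin]
  cases s with
  | real n e c =>
    have hn : n = 1 ∨ n = 2 ∨ n = 3 ∨ n = 4 := by
      cases D <;> simp [NForm.summands] at hs <;> grind
    rcases hn with rfl | rfl | rfl | rfl
    · left
      exact exists_vector_of_fits h
    · right; left
      refine ⟨hr, ?_, Or.inl ⟨e, c, v, h⟩⟩
      rcases Int.units_eq_one_or e with rfl | rfl <;> exact hi
    · right; right; left
      refine ⟨hr, ?_⟩
      rcases Int.units_eq_one_or e with rfl | rfl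
      · exact Or.inr ⟨hi, c, v, h⟩
      · exact Or.inl ⟨hi, c, v, h⟩
    · right; right; right
      exact ⟨Submodule.eq_top_of_finrank_eq (hr.trans (by simp [Summand.dim])),
        Or.inl ⟨e, c, v, h⟩⟩
  | cplx m a b =>
    have hm : (m = 1 ∨ m = 2) ∧ b ≠ 0 := by
      cases D <;> simp [NForm.summands] at hs <;> simp only [NForm.Admissible] at hD <;> grind
    obtain ⟨rfl | rfl, hb⟩ := hm
    · right; left
      exact ⟨hr, hi, Or.inr ⟨a, b, v, hb, h⟩⟩
    · right; right; right
      exact ⟨Submodule.eq_top_of_finrank_eq (hr.trans (by simp [Summand.dim])),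
        Or.inr ⟨a, b, v, hb, h⟩⟩

theorem exists_listed_decomposition {S : Module.End ℝ R22}
    (hS : LinearMap.IsSelfAdjoint s22 S) :
    ∃ k : ℕ, 1 ≤ k ∧ k ≤ 4 ∧ ∃ U : Fin k → Submodule ℝ R22,
      IsOrthInvDecomp S U ∧ ∀ i, IsListedSummand S (U i) := by
  obtain ⟨D, hD, U, hU, hf⟩ := exists_form hS
  have hk : 1 ≤ D.summands.length ∧ D.summands.length ≤ 4 := by
    cases D <;> simp [NForm.summands]
  refine ⟨D.summands.length, hk.1, hk.2, U, hU, fun i => ?_⟩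
  obtain ⟨v, hv⟩ := hf i
  exact hv.isListedSummand hD (List.get_mem _ _)

/-! ### Multiplicities -/

theorem HasForm.multiplicities {S : Module.End ℝ R22} {D : NForm} (h : HasForm S D) :
    HasJCF (cplxEnd S) D.blocks ∧
    (∀ z : ℂ, (cplxEnd S).charpoly.rootMultiplicity z = algMult D.blocks z ∧
      Module.finrank ℂ (Module.End.eigenspace (cplxEnd S) z) = geoMult D.blocks z) ∧
    (∀ x : ℝ, S.charpoly.rootMultiplicity x = algMult D.blocks (x : ℂ) ∧
      Module.finrank ℝ (Module.End.eigenspace S x) = geoMult D.blocks (x : ℂ)) := by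
  have hJ := h.hasJCF
  have hp := blocks_size_pos D
  refine ⟨hJ, fun z => ⟨hJ.rootMultiplicity z, hJ.finrank_eigenspace hp z⟩, fun x => ⟨?_, ?_⟩⟩
  · rw [rootMultiplicity_real, hJ.rootMultiplicity]
  · rw [finrank_eigenspace_real, hJ.finrank_eigenspace hp]

/-! ### Degenerations -/

theorem IsPsiON.permute {S : Module.End ℝ R22} {E E' : Fin 4 → R22}
    {A A' P : Matrix (Fin 4) (Fin 4) ℝ} (hE : IsPsiON 2 2 ⊤ E) (hA : HasMatrix S E A)
    (hE' : E' = comb E P) (hG : P.transpose * psiGram 2 2 * P = psiGram 2 2)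
    (hP : A * P = P * A') : IsPsiON 2 2 ⊤ E' ∧ HasMatrix S E' A' := by
  subst hE'
  exact (frame_matrix_iff hG (psiGram_mul_self 2 2) hP).mp ⟨hE, hA⟩

theorem isOfType_of_hasForm {S : Module.End ℝ R22} {D : NForm} (hD : D.Admissible)
    (h : HasForm S D) : IsOfType S D.type := ⟨D, rfl, hD, h⟩

theorem degeneration_II {S : Module.End ℝ R22} {E : Fin 4 → R22} {a : ℝ} (hE : IsWitt 2 ⊤ E)
    (hm : HasMatrix S E (wittMatII a 0)) :
    HasMatrix S E (wittMatVII 1 (-1) a a) ∧ HasForm S (.VII 1 (-1) a a) ∧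
      IsOfType S .VII ∧ HasSegre S (NForm.VII 1 (-1) a a).blocks [ent 2 0, ent 2 0] := by
  have he : wittMatII a 0 = wittMatVII 1 (-1) a a := by
    simp [wittMatII, wittMatVII, sg]
  rw [he] at hm
  have h : HasForm S (.VII 1 (-1) a a) :=
    (hasForm_iff_adapted S _).mpr ((adapted_VII_iff_witt S 1 (-1) a a).2.mpr ⟨E, hE, hm⟩)
  exact ⟨hm, h, isOfType_of_hasForm (D := .VII 1 (-1) a a) trivial h, (hasSegre_VII h).2 rfl⟩

theorem degeneration_V {S : Module.End ℝ R22} {E : Fin 4 → R22} {lam a nu : ℝ}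
    (hE : IsPsiON 2 2 ⊤ E) (hm : HasMatrix S E (NForm.V lam a 0 nu).psiMat) :
    HasMatrix S E (NForm.IX lam a a nu).psiMat ∧ HasForm S (.IX lam a a nu) ∧ IsOfType S .IX ∧
      (lam ≠ a → nu ≠ a → lam ≠ nu →
        HasSegre S (NForm.IX lam a a nu).blocks [ent 1 0, ent 1 1, ent 1 1, ent 1 3]) := by
  have he : (NForm.V lam a 0 nu).psiMat = (NForm.IX lam a a nu).psiMat := by
    simp [NForm.psiMat]
  rw [he] at hm
  have h : HasForm S (.IX lam a a nu) := (hasForm_iff_psi S _).mpr ⟨E, hE, hm⟩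
  refine ⟨hm, h, isOfType_of_hasForm (D := .IX lam a a nu) trivial h, fun h1 h2 h3 => ?_⟩
  exact (hasSegre_IX h).2.2.2.2.1 rfl h1 h3 h2.symm

theorem degeneration_VI {S : Module.End ℝ R22} {E : Fin 4 → R22} {e : ℤˣ} {lam a : ℝ}
    (hE : IsPsiON 2 2 ⊤ E) (hm : HasMatrix S E (NForm.VI e lam a 0).psiMat) :
    IsPsiON 2 2 ⊤ ![E 1, E 0, E 3, E 2] ∧
      HasMatrix S ![E 1, E 0, E 3, E 2] (NForm.IV e a lam a).psiMat ∧
      HasForm S (.IV e a lam a) ∧ IsOfType S .IV ∧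
      (lam ≠ a → HasSegre S (NForm.IV e a lam a).blocks [ent 1 0, ent 2 1, ent 1 0]) := by
  obtain ⟨h1, h2⟩ := hE.permute hm (E' := ![E 1, E 0, E 3, E 2])
    (P := !![0, 1, 0, 0; 1, 0, 0, 0; 0, 0, 0, 1; 0, 0, 1, 0]) (A' := (NForm.IV e a lam a).psiMat)
    (by funext j; fin_cases j <;> simp [comb, Fin.sum_univ_four])
    (by
      rw [psiGram22]
      ext i j
      fin_cases i <;> fin_cases j <;> simp [Matrix.mul_apply, Fin.sum_univ_four])
    (by
      simp only [NForm.psiMat]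
      ext i j
      fin_cases i <;> fin_cases j <;> simp [Matrix.mul_apply, Fin.sum_univ_four])
  have h : HasForm S (.IV e a lam a) := (hasForm_iff_psi S _).mpr ⟨_, h1, h2⟩
  exact ⟨h1, h2, h, isOfType_of_hasForm (D := .IV e a lam a) trivial h,
    fun hne => (hasSegre_IV h).2.2.2.1 rfl hne.symm⟩

theorem degeneration_VIII_left {S : Module.End ℝ R22} {E : Fin 4 → R22} {a c d : ℝ} (hd : d ≠ 0)
    (hE : IsPsiON 2 2 ⊤ E) (hm : HasMatrix S E (NForm.VIII a 0 c d).psiMat) :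
    IsPsiON 2 2 ⊤ ![E 0, E 1, E 3, E 2] ∧
      HasMatrix S ![E 0, E 1, E 3, E 2] (NForm.V a c d a).psiMat ∧
      HasForm S (.V a c d a) ∧ IsOfType S .V ∧
      HasSegre S (NForm.V a c d a).blocks [ent 1 0, ent 1 1, bar 1 2, ent 1 0] := by
  obtain ⟨h1, h2⟩ := hE.permute hm (E' := ![E 0, E 1, E 3, E 2])
    (P := !![1, 0, 0, 0; 0, 1, 0, 0; 0, 0, 0, 1; 0, 0, 1, 0]) (A' := (NForm.V a c d a).psiMat)
    (by funext j; fin_cases j <;> simp [comb, Fin.sum_univ_four])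
    (by
      rw [psiGram22]
      ext i j
      fin_cases i <;> fin_cases j <;> simp [Matrix.mul_apply, Fin.sum_univ_four])
    (by
      simp only [NForm.psiMat]
      ext i j
      fin_cases i <;> fin_cases j <;> simp [Matrix.mul_apply, Fin.sum_univ_four])
  have h : HasForm S (.V a c d a) := (hasForm_iff_psi S _).mpr ⟨_, h1, h2⟩
  exact ⟨h1, h2, h, isOfType_of_hasForm (D := .V a c d a) hd h,
    (hasSegre_V hd h).2 rfl⟩

theorem degeneration_VIII_right {S : Module.End ℝ R22} {E : Fin 4 → R22} {a b c : ℝ} (hb : b ≠ 0)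
    (hE : IsPsiON 2 2 ⊤ E) (hm : HasMatrix S E (NForm.VIII a b c 0).psiMat) :
    IsPsiON 2 2 ⊤ ![E 1, E 0, E 2, E 3] ∧
      HasMatrix S ![E 1, E 0, E 2, E 3] (NForm.V c a b c).psiMat ∧
      HasForm S (.V c a b c) ∧ IsOfType S .V ∧
      HasSegre S (NForm.V c a b c).blocks [ent 1 0, ent 1 1, bar 1 2, ent 1 0] := by
  obtain ⟨h1, h2⟩ := hE.permute hm (E' := ![E 1, E 0, E 2, E 3])
    (P := !![0, 1, 0, 0; 1, 0, 0, 0; 0, 0, 1, 0; 0, 0, 0, 1]) (A' := (NForm.V c a b c).psiMat)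
    (by funext j; fin_cases j <;> simp [comb, Fin.sum_univ_four])
    (by
      rw [psiGram22]
      ext i j
      fin_cases i <;> fin_cases j <;> simp [Matrix.mul_apply, Fin.sum_univ_four])
    (by
      simp only [NForm.psiMat]
      ext i j
      fin_cases i <;> fin_cases j <;> simp [Matrix.mul_apply, Fin.sum_univ_four])
  have h : HasForm S (.V c a b c) := (hasForm_iff_psi S _).mpr ⟨_, h1, h2⟩
  exact ⟨h1, h2, h, isOfType_of_hasForm (D := .V c a b c) hb h,
    (hasSegre_V hb h).2 rfl⟩

theorem degeneration_VIII_both {S : Module.End ℝ R22} {E : Fin 4 → R22} {a c : ℝ}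
    (hE : IsPsiON 2 2 ⊤ E) (hm : HasMatrix S E (NForm.VIII a 0 c 0).psiMat) :
    HasMatrix S E (NForm.IX a c a c).psiMat ∧ HasForm S (.IX a c a c) ∧ IsOfType S .IX ∧
      (a ≠ c → HasSegre S (NForm.IX a c a c).blocks [ent 1 0, ent 1 1, ent 1 0, ent 1 1]) := by
  have he : (NForm.VIII a 0 c 0).psiMat = (NForm.IX a c a c).psiMat := by
    simp [NForm.psiMat]
  rw [he] at hm
  have h : HasForm S (.IX a c a c) := (hasForm_iff_psi S _).mpr ⟨E, hE, hm⟩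
  refine ⟨hm, h, isOfType_of_hasForm (D := .IX a c a c) trivial h, fun hne => ?_⟩
  exact (hasSegre_IX h).2.2.2.2.2.2.2.2.1 rfl rfl hne

end Neutral22

theorem mainTheorem1 :
    -- every self-adjoint endomorphism has an orthogonal invariant decomposition into listed summands
    (∀ S : Module.End ℝ R22, LinearMap.IsSelfAdjoint s22 S →
      ∃ k : ℕ, 1 ≤ k ∧ k ≤ 4 ∧ ∃ U : Fin k → Submodule ℝ R22,
        IsOrthInvDecomp S U ∧ ∀ i, IsListedSummand S (U i)) ∧
    -- two-dimensional summands, one real Jordan block: Witt and pseudo-orthonormal bases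
    (∀ (S : Module.End ℝ R22) (U : Submodule ℝ R22) (e : ℤˣ) (c : ℝ) (v : Fin 2 → R22),
      (Fits S U (.real 2 e c) v ↔
        IsWitt 1 U ![v 0, sg e • v 1] ∧
          HasMatrix S ![v 0, sg e • v 1] !![c, sg e; 0, c]) ∧
      (Fits S U (.real 2 e c) v ↔
        IsPsiON 1 1 U ![hadd (v 0) (sg e • v 1), hsub (v 0) (sg e • v 1)] ∧
          HasMatrix S ![hadd (v 0) (sg e • v 1), hsub (v 0) (sg e • v 1)]
            !![c + sg e / 2, -sg e / 2; sg e / 2, c - sg e / 2])) ∧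
    -- two-dimensional summands, complex conjugate eigenvalues
    (∀ (S : Module.End ℝ R22) (U : Submodule ℝ R22) (a b : ℝ) (v : Fin 2 → R22),
      Fits S U (.cplx 1 a b) v ↔ IsPsiON 1 1 U v ∧ HasMatrix S v !![a, b; -b, a]) ∧
    (∀ (S : Module.End ℝ R22) (U : Submodule ℝ R22) (a b : ℝ) (v : Fin 2 → R22) (w : C22),
      IsPsiON 1 1 U v → w = cpair (v 0) (v 1) →
        (HasMatrix S v !![a, b; -b, a] ↔
          HasMatrix (cplxEnd S) ![w, star w] !![⟨a, b⟩, 0; 0, ⟨a, -b⟩]) ∧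
        LinearIndependent ℂ ![w, star w] ∧
        Submodule.span ℂ (Set.range ![w, star w]) = cplxSub U ∧
        hC w w = 0 ∧ hC (star w) (star w) = 0 ∧ hC w (star w) ≠ 0 ∧
        sC w w ≠ 0 ∧ sC (star w) (star w) ≠ 0 ∧ sC w (star w) = 0) ∧
    -- three-dimensional summands: pseudo-orthonormal bases
    (∀ (S : Module.End ℝ R22) (U : Submodule ℝ R22) (c : ℝ) (v : Fin 3 → R22),
      (Fits S U (.real 3 (-1) c) v ↔
        IsPsiON 1 2 U ![hsub (v 0) (v 2), v 1, hadd (v 0) (v 2)] ∧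
          HasMatrix S ![hsub (v 0) (v 2), v 1, hadd (v 0) (v 2)]
            !![c, 1 / √2, 0; -1 / √2, c, 1 / √2; 0, 1 / √2, c]) ∧
      (Fits S U (.real 3 1 c) v ↔
        IsPsiON 2 1 U ![hadd (v 0) (v 2), v 1, hsub (v 0) (v 2)] ∧
          HasMatrix S ![hadd (v 0) (v 2), v 1, hsub (v 0) (v 2)]
            !![c, 1 / √2, 0; 1 / √2, c, -1 / √2; 0, 1 / √2, c])) ∧
    -- every self-adjoint endomorphism is of exactly one of the ten types
    (∀ S : Module.End ℝ R22, LinearMap.IsSelfAdjoint s22 S → ∃! t : SAType, IsOfType S t) ∧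
    -- conversely, each form consists of self-adjoint endomorphisms, and each one occurs
    (∀ (D : NForm) (S : Module.End ℝ R22), HasForm S D → LinearMap.IsSelfAdjoint s22 S) ∧
    (∀ D : NForm, ∃ S : Module.End ℝ R22, HasForm S D) ∧
    -- the signatures of the summands
    (∀ (D : NForm) (S : Module.End ℝ R22), ∀ s ∈ D.summands,
      ∀ (U : Submodule ℝ R22) (v : Fin s.dim → R22), Fits S U s v →
        IsIsometricTo U s.sig.1 s.sig.2) ∧
    -- the basis giving the realized Jordan canonical form, and the normal matrices
    (∀ (D : NForm) (S : Module.End ℝ R22),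
      (HasForm S D ↔ ∃ v, IsAdapted S D v) ∧
      (∀ v, IsAdapted S D v ↔
        IsPsiON 2 2 ⊤ (D.psiBasis v) ∧ HasMatrix S (D.psiBasis v) D.psiMat) ∧
      (HasForm S D ↔ ∃ E, IsPsiON 2 2 ⊤ E ∧ HasMatrix S E D.psiMat)) ∧
    (∀ (S : Module.End ℝ R22) (e : ℤˣ) (lam : ℝ),
      (∀ v, IsAdapted S (.I e lam) v ↔
        IsWitt 2 ⊤ ![v 0, v 1, sg e • v 3, sg e • v 2] ∧
          HasMatrix S ![v 0, v 1, sg e • v 3, sg e • v 2] (wittMatI e lam)) ∧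
      (HasForm S (.I e lam) ↔ ∃ E, IsWitt 2 ⊤ E ∧ HasMatrix S E (wittMatI e lam))) ∧
    (∀ (S : Module.End ℝ R22) (a b : ℝ),
      (∀ v, IsAdapted S (.II a b) v ↔
        IsWitt 2 ⊤ ![v 0, v 1, v 2, -v 3] ∧
          HasMatrix S ![v 0, v 1, v 2, -v 3] (wittMatII a b)) ∧
      (HasForm S (.II a b) ↔ ∃ E, IsWitt 2 ⊤ E ∧ HasMatrix S E (wittMatII a b))) ∧
    (∀ (S : Module.End ℝ R22) (e w : ℤˣ) (lam mu : ℝ),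
      (∀ v, IsAdapted S (.VII e w lam mu) v ↔
        IsWitt 2 ⊤ ![v 0, v 2, sg e • v 1, sg w • v 3] ∧
          HasMatrix S ![v 0, v 2, sg e • v 1, sg w • v 3] (wittMatVII e w lam mu)) ∧
      (HasForm S (.VII e w lam mu) ↔
        ∃ E, IsWitt 2 ⊤ E ∧ HasMatrix S E (wittMatVII e w lam mu))) ∧
    -- type II over the complex numbers
    (∀ (S : Module.End ℝ R22) (a b : ℝ) (v : Fin 4 → R22) (w₁ w₂ : C22) (W W' : Submodule ℂ C22),
      IsAdapted S (.II a b) v → w₁ = cpair (v 0) (v 1) → w₂ = cpair (v 2) (v 3) →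
      W = Submodule.span ℂ {w₁, w₂} → W' = Submodule.span ℂ {star w₁, star w₂} →
        LinearIndependent ℂ ![w₁, w₂, star w₁, star w₂] ∧
        HasMatrix (cplxEnd S) ![w₁, w₂, star w₁, star w₂]
          !![⟨a, b⟩, 1, 0, 0; 0, ⟨a, b⟩, 0, 0; 0, 0, ⟨a, -b⟩, 1; 0, 0, 0, ⟨a, -b⟩] ∧
        (∀ i, sC (![w₁, w₂, star w₁, star w₂] i) (![w₁, w₂, star w₁, star w₂] i) = 0 ∧
          hC (![w₁, w₂, star w₁, star w₂] i) (![w₁, w₂, star w₁, star w₂] i) = 0) ∧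
        IsCompl W W' ∧
        (∃ f : W ≃ₗ[ℂ] (Fin 2 → ℂ), ∀ x y : W, f x ⬝ᵥ f y = sC x y) ∧
        (∃ f : W' ≃ₗ[ℂ] (Fin 2 → ℂ), ∀ x y : W', f x ⬝ᵥ f y = sC x y) ∧
        (∀ x ∈ W, ∀ y ∈ W', sC x y = 0) ∧
        (∀ x ∈ W, ∀ y ∈ W, hC x y = 0) ∧ (∀ x ∈ W', ∀ y ∈ W', hC x y = 0)) ∧
    -- Jordan canonical form and multiplicities of the eigenvalues
    (∀ (D : NForm) (S : Module.End ℝ R22), D.Admissible → HasForm S D →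
      HasJCF (cplxEnd S) D.blocks ∧
      (∀ z : ℂ, (cplxEnd S).charpoly.rootMultiplicity z = algMult D.blocks z ∧
        Module.finrank ℂ (Module.End.eigenspace (cplxEnd S) z) = geoMult D.blocks z) ∧
      (∀ x : ℝ, S.charpoly.rootMultiplicity x = algMult D.blocks (x : ℂ) ∧
        Module.finrank ℝ (Module.End.eigenspace S x) = geoMult D.blocks (x : ℂ))) ∧
    -- Segre characteristics and coincidences of eigenvalues within each type
    (∀ (S : Module.End ℝ R22) (D : NForm), D.Admissible → HasForm S D →
      match D with
      | .I _ _ => HasSegre S D.blocks [ent 4 0]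
      | .II _ _ => HasSegre S D.blocks [ent 2 0, bar 2 1]
      | .IIIa lam mu =>
          (lam ≠ mu → HasSegre S D.blocks [ent 1 0, ent 3 1]) ∧
          (lam = mu → HasSegre S D.blocks [ent 1 0, ent 3 0])
      | .IIIb lam mu =>
          (lam ≠ mu → HasSegre S D.blocks [ent 3 0, ent 1 1] ∧
            HasSegre S D.blocks.reverse [ent 1 0, ent 3 1]) ∧
          (lam = mu → HasSegre S D.blocks [ent 3 0, ent 1 0] ∧
            HasSegre S D.blocks.reverse [ent 1 0, ent 3 0])
      | .IV _ lam mu nu =>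
          (lam ≠ mu → mu ≠ nu → lam ≠ nu →
            HasSegre S D.blocks [ent 1 0, ent 2 1, ent 1 2]) ∧
          (lam = mu → mu ≠ nu → HasSegre S D.blocks [ent 1 0, ent 2 0, ent 1 2]) ∧
          (mu = nu → lam ≠ mu → HasSegre S D.blocks [ent 1 0, ent 2 1, ent 1 1]) ∧
          (lam = nu → lam ≠ mu → HasSegre S D.blocks [ent 1 0, ent 2 1, ent 1 0]) ∧
          (lam = mu → mu = nu → HasSegre S D.blocks [ent 1 0, ent 2 0, ent 1 0])
      | .V lam _ _ nu =>
          (lam ≠ nu → HasSegre S D.blocks [ent 1 0, ent 1 1, bar 1 2, ent 1 3]) ∧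
          (lam = nu → HasSegre S D.blocks [ent 1 0, ent 1 1, bar 1 2, ent 1 0])
      | .VI _ _ _ _ => HasSegre S D.blocks [ent 2 0, ent 1 1, bar 1 2]
      | .VII _ _ lam mu =>
          (lam ≠ mu → HasSegre S D.blocks [ent 2 0, ent 2 1]) ∧
          (lam = mu → HasSegre S D.blocks [ent 2 0, ent 2 0])
      | .VIII a b c d =>
          (¬ (a = c ∧ b = d) → ¬ (a = c ∧ b = -d) →
            HasSegre S D.blocks [ent 1 0, bar 1 1, ent 1 2, bar 1 3]) ∧
          (a = c → b = d → HasSegre S D.blocks [ent 1 0, bar 1 1, ent 1 0, bar 1 1]) ∧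
          -- the coincidence with the conjugate of the second eigenvalue is only a relabelling
          HasForm S (.VIII a b c (-d))
      | .IX lam mu nu sigma =>
          (lam ≠ mu → lam ≠ nu → lam ≠ sigma → mu ≠ nu → mu ≠ sigma → nu ≠ sigma →
            HasSegre S D.blocks [ent 1 0, ent 1 1, ent 1 2, ent 1 3]) ∧
          (lam = mu → lam ≠ nu → lam ≠ sigma → nu ≠ sigma →
            HasSegre S D.blocks [ent 1 0, ent 1 0, ent 1 2, ent 1 3]) ∧
          (lam = nu → lam ≠ mu → lam ≠ sigma → mu ≠ sigma →
            HasSegre S D.blocks [ent 1 0, ent 1 1, ent 1 0, ent 1 3]) ∧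
          (lam = sigma → lam ≠ mu → lam ≠ nu → mu ≠ nu →
            HasSegre S D.blocks [ent 1 0, ent 1 1, ent 1 2, ent 1 0]) ∧
          (mu = nu → lam ≠ mu → lam ≠ sigma → mu ≠ sigma →
            HasSegre S D.blocks [ent 1 0, ent 1 1, ent 1 1, ent 1 3]) ∧
          (mu = sigma → lam ≠ mu → lam ≠ nu → mu ≠ nu →
            HasSegre S D.blocks [ent 1 0, ent 1 1, ent 1 2, ent 1 1]) ∧
          (nu = sigma → lam ≠ mu → lam ≠ nu → mu ≠ nu →
            HasSegre S D.blocks [ent 1 0, ent 1 1, ent 1 2, ent 1 2]) ∧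
          (lam = mu → nu = sigma → lam ≠ nu →
            HasSegre S D.blocks [ent 1 0, ent 1 0, ent 1 2, ent 1 2]) ∧
          (lam = nu → mu = sigma → lam ≠ mu →
            HasSegre S D.blocks [ent 1 0, ent 1 1, ent 1 0, ent 1 1]) ∧
          (lam = sigma → mu = nu → lam ≠ mu →
            HasSegre S D.blocks [ent 1 0, ent 1 1, ent 1 1, ent 1 0]) ∧
          (lam = mu → mu = nu → lam ≠ sigma →
            HasSegre S D.blocks [ent 1 0, ent 1 0, ent 1 0, ent 1 3]) ∧
          (lam = mu → mu = sigma → lam ≠ nu →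
            HasSegre S D.blocks [ent 1 0, ent 1 0, ent 1 2, ent 1 0]) ∧
          (lam = nu → nu = sigma → lam ≠ mu →
            HasSegre S D.blocks [ent 1 0, ent 1 1, ent 1 0, ent 1 0]) ∧
          (mu = nu → nu = sigma → lam ≠ mu →
            HasSegre S D.blocks [ent 1 0, ent 1 1, ent 1 1, ent 1 1]) ∧
          (lam = mu → mu = nu → nu = sigma →
            HasSegre S D.blocks [ent 1 0, ent 1 0, ent 1 0, ent 1 0])) ∧
    -- degeneration of type II to type VII
    (∀ (S : Module.End ℝ R22) (E : Fin 4 → R22) (a : ℝ),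
      IsWitt 2 ⊤ E → HasMatrix S E (wittMatII a 0) →
        HasMatrix S E (wittMatVII 1 (-1) a a) ∧ HasForm S (.VII 1 (-1) a a) ∧
        IsOfType S .VII ∧ HasSegre S (NForm.VII 1 (-1) a a).blocks [ent 2 0, ent 2 0]) ∧
    -- degeneration of type V to type IX
    (∀ (S : Module.End ℝ R22) (E : Fin 4 → R22) (lam a nu : ℝ),
      IsPsiON 2 2 ⊤ E → HasMatrix S E (NForm.V lam a 0 nu).psiMat →
        HasMatrix S E (NForm.IX lam a a nu).psiMat ∧ HasForm S (.IX lam a a nu) ∧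
        IsOfType S .IX ∧
        (lam ≠ a → nu ≠ a → lam ≠ nu →
          HasSegre S (NForm.IX lam a a nu).blocks [ent 1 0, ent 1 1, ent 1 1, ent 1 3])) ∧
    -- degeneration of type VI to type IV
    (∀ (S : Module.End ℝ R22) (E : Fin 4 → R22) (e : ℤˣ) (lam a : ℝ),
      IsPsiON 2 2 ⊤ E → HasMatrix S E (NForm.VI e lam a 0).psiMat →
        IsPsiON 2 2 ⊤ ![E 1, E 0, E 3, E 2] ∧
        HasMatrix S ![E 1, E 0, E 3, E 2] (NForm.IV e a lam a).psiMat ∧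
        HasForm S (.IV e a lam a) ∧ IsOfType S .IV ∧
        (lam ≠ a → HasSegre S (NForm.IV e a lam a).blocks [ent 1 0, ent 2 1, ent 1 0])) ∧
    -- degenerations of type VIII to type V
    (∀ (S : Module.End ℝ R22) (E : Fin 4 → R22) (a c d : ℝ), d ≠ 0 →
      IsPsiON 2 2 ⊤ E → HasMatrix S E (NForm.VIII a 0 c d).psiMat →
        IsPsiON 2 2 ⊤ ![E 0, E 1, E 3, E 2] ∧
        HasMatrix S ![E 0, E 1, E 3, E 2] (NForm.V a c d a).psiMat ∧
        HasForm S (.V a c d a) ∧ IsOfType S .V ∧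
        HasSegre S (NForm.V a c d a).blocks [ent 1 0, ent 1 1, bar 1 2, ent 1 0]) ∧
    (∀ (S : Module.End ℝ R22) (E : Fin 4 → R22) (a b c : ℝ), b ≠ 0 →
      IsPsiON 2 2 ⊤ E → HasMatrix S E (NForm.VIII a b c 0).psiMat →
        IsPsiON 2 2 ⊤ ![E 1, E 0, E 2, E 3] ∧
        HasMatrix S ![E 1, E 0, E 2, E 3] (NForm.V c a b c).psiMat ∧
        HasForm S (.V c a b c) ∧ IsOfType S .V ∧
        HasSegre S (NForm.V c a b c).blocks [ent 1 0, ent 1 1, bar 1 2, ent 1 0]) ∧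
    -- degeneration of type VIII to type IX
    (∀ (S : Module.End ℝ R22) (E : Fin 4 → R22) (a c : ℝ),
      IsPsiON 2 2 ⊤ E → HasMatrix S E (NForm.VIII a 0 c 0).psiMat →
        HasMatrix S E (NForm.IX a c a c).psiMat ∧ HasForm S (.IX a c a c) ∧ IsOfType S .IX ∧
        (a ≠ c → HasSegre S (NForm.IX a c a c).blocks [ent 1 0, ent 1 1, ent 1 0, ent 1 1])) := by
  refine ⟨fun S hS => exists_listed_decomposition hS,
    fun S U e c v => ⟨fits_real_two_iff_witt S U e c v, fits_real_two_iff_psi S U e c v⟩,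
    fun S U a b v => fits_cplx_one_iff S U a b v,
    fun S U a b v w hv hw => cplx_plane hv hw,
    fun S U c v => ⟨fits_real_three_neg_iff S U c v, fits_real_three_pos_iff S U c v⟩,
    fun S hS => existsUnique_type hS,
    fun D S h => h.isSelfAdjoint,
    fun D => exists_hasForm D,
    fun D S s hs U v h => h.isIsometricTo hs,
    fun D S => ⟨hasForm_iff_adapted S D, isAdapted_iff_psi S D, hasForm_iff_psi S D⟩,
    fun S e lam => ⟨(adapted_I_iff_witt S e lam).1,
      (hasForm_iff_adapted S _).trans (adapted_I_iff_witt S e lam).2⟩,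
    fun S a b => ⟨(adapted_II_iff_witt S a b).1,
      (hasForm_iff_adapted S _).trans (adapted_II_iff_witt S a b).2⟩,
    fun S e w lam mu => ⟨(adapted_VII_iff_witt S e w lam mu).1,
      (hasForm_iff_adapted S _).trans (adapted_VII_iff_witt S e w lam mu).2⟩,
    fun S a b v w₁ w₂ W W' hv hw₁ hw₂ hW hW' => typeII_cplx hv hw₁ hw₂ hW hW',
    fun D S _ h => h.multiplicities,
    ?_,
    fun S E a hE hm => degeneration_II hE hm,
    fun S E lam a nu hE hm => degeneration_V hE hm,
    fun S E e lam a hE hm => degeneration_VI hE hm,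
    fun S E a c d hd hE hm => degeneration_VIII_left hd hE hm,
    fun S E a b c hb hE hm => degeneration_VIII_right hb hE hm,
    fun S E a c hE hm => degeneration_VIII_both hE hm⟩
  intro S D hD h
  cases D
  case I => exact hasSegre_I h
  case II => exact hasSegre_II hD h
  case IIIa => exact hasSegre_IIIa h
  case IIIb => exact hasSegre_IIIb h
  case IV => exact hasSegre_IV h
  case V => exact hasSegre_V hD h
  case VI => exact hasSegre_VI hD h
  case VII => exact hasSegre_VII h
  case VIII => exact hasSegre_VIII hD h
  case IX => exact hasSegre_IX h
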